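/- **Setting.** For $w\in\mathbb R^3$ let $w^\times$ be the matrix of $z\mapsto w\times z$, for a unit vector $u$ let $\pi_u=I_3-uu^\top$, and let $e_3=(0,0,1)^\top$; $\|\cdot\|$ is the Euclidean norm. Two rigid bodies, a vehicle ($B$) and a target ($T$), move for $t\ge 0$ according to $$\dot Q_i=Q_i\omega_i^\times,\qquad \dot p_i=v_i,\qquad \dot v_i=Q_ia_i+g e_3,\qquad Q_i\in SO(3),\quad i\in\{B,T\},$$ with $p_B(t)\ne p_T(t)$ for all $t\ge0$. Put $R=Q_T^\top Q_B$, $\xi=Q_B^\top(p_B-p_T)$, $y_\xi=\xi/\|\xi\|$, $y_\xi^{\mathcal I}=Q_By_\xi$, $\eta_{\mathcal I}=Q_Te_3$, $a_T^{\mathcal I}=Q_Ta_T$, $b=a_T^{\mathcal I}\times\eta_{\mathcal I}$. For an attitude estimate $\hat R\in SO(3)$ put $$A_\theta=\begin{bmatrix}-\omega_B^\times&I_3&0\\0&-\omega_B^\times&\hat R^\top a_T^\times e_3\\0&0&0\end{bmatrix}\in\mathbb R^{7\times7},\qquad C_\theta=\begin{bmatrix}\pi_{y_\xi}&0_{3,4}\end{bmatrix}.$$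 Let $S(t)\in\mathbb R^{7\times 7}$, $D(t)\in\mathbb R^{3\times3}$ be continuous, symmetric, bounded and uniformly positive definite on $[0,\infty)$. The error system with state $x_\theta=(\tilde\xi,\tilde v,\tilde\theta)\in\mathbb R^7$ is, with $\hat R=\exp(\tilde\theta e_3^\times)R$ in $A_\theta$, $$\dot x_\theta=A_\theta x_\theta-PC_\theta^\top D\,C_\theta x_\theta+\rho(t,x_\theta),\qquad \dot P=A_\theta P+PA_\theta^\top-PC_\theta^\top DC_\theta P+S,\qquad(\ast)$$ with $P$ initialized at a symmetric positive definite matrix and $\rho=O(|\tilde\theta|^2)$ as $x_\theta\to0$, uniformly in $t$ ($\rho$ continuous, and Lipschitz in $x_\theta$ on bounded sets, uniformly for $t$ in bounded intervals). It includes the unexpanded dynamics, in which $\dot{\tilde\xi}=-\omega_B^\times\tilde\xi+\tilde v-\sigma_\xi$, $\dot{\tilde v}=-\omega_B^\times\tilde v-\sigma_v+\hat R^\top(I_3-\exp(\tilde\theta e_3^\times))a_T$, $\dot{\tilde\theta}=-\sigma_\theta$, where $(\sigma_\xi,\sigma_v,\sigma_\theta)=PC_\theta^\top DC_\theta x_\theta$.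 **Lemma.** Assume that $\omega_B,\omega_T$ are bounded and uniformly continuous, that $a_T$ is bounded and continuous, and that there are $\delta,\mu>0$ such that for all $t\ge0$ $$\frac1\delta\int_t^{t+\delta}\pi_{y_\xi^{\mathcal I}(s)}\,ds\succeq\mu I_3 .$$ Assume that $b(t)=b_0+b_1(t)$ for all $t\ge 0$, with a constant vector $b_0\neq0$ and, for all $t\ge0$, $$\frac1\delta\int_t^{t+\delta}\big\|\pi_{y_\xi^{\mathcal I}(s)}\,b_1(t)\big\|^2ds\le\frac\mu4\|b_0\|^2 .$$ Then: 1. The pair $(A_\theta,C_\theta)$ is uniformly observable, locally around $\hat R=R$: there are $\varepsilon,\delta',\mu'>0$ such that for every continuous $\hat R:[0,\infty)\to SO(3)$ whose entries differ from those of $R$ by at most $\varepsilon$ at all times (in particular for $\hat R=R$), and for all $t\ge0$, $$\frac1{\delta'}\int_t^{t+\delta'}\Phi(s,t)^\top C_\theta(s)^\top C_\theta(s)\Phi(s,t)\,ds\succeq\mu' I_7,$$ where $\partial_s\Phi(s,t)=A_\theta(s)\Phi(s,t)$, $\Phi(t,t)=I_7$. 2. For every such $\rho$, and for the unexpanded dynamics,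 the equilibrium $(\tilde\xi,\tilde v,\tilde\theta)=0$ of $(\ast)$ is locally exponentially stable: for all $p_1,p_2>0$ there are $r,k,\lambda>0$ such that for all $t_0\ge0$, all $\|x_0\|<r$ and all $p_1I_7\preceq P_0\preceq p_2I_7$, there is a solution $(x_\theta,P)$ on $[t_0,\infty)$ with $(x_\theta,P)(t_0)=(x_0,P_0)$ and $P$ positive definite, and every solution on an interval $[t_0,T)$ with these initial values satisfies $\|x_\theta(t)\|\le k e^{-\lambda(t-t_0)}\|x_0\|$ there. -/

import Mathlib

open scoped Matrix

/-- Vectors of `ℝ³` and `3 × 3` real matrices. -/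
abbrev V3 : Type := Fin 3 → ℝ

abbrev M3 : Type := Matrix (Fin 3) (Fin 3) ℝ

/-- Index type of the seven-dimensional error state `(ξ̃, ṽ, θ̃)`. -/
abbrev Idx7 : Type := (Fin 3 ⊕ Fin 3) ⊕ Fin 1

abbrev V7 : Type := Idx7 → ℝ

abbrev M7 : Type := Matrix Idx7 Idx7 ℝ

noncomputable section

/-- The Euclidean norm (the norm that Mathlib puts on `ι → ℝ` is the sup norm). -/
def eucl {ι : Type} [Fintype ι] (w : ι → ℝ) : ℝ := ‖WithLp.toLp 2 w‖

def e3 : V3 := ![0, 0, 1]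

/-- The matrix `w^×` of the map `z ↦ w × z`. -/
def skew (w : V3) : M3 := !![0, -w 2, w 1; w 2, 0, -w 0; -w 1, w 0, 0]

/-- The projection `π_u = I₃ - u uᵀ`. -/
def proj (u : V3) : M3 := 1 - Matrix.vecMulVec u u

/-- The rotation `exp(θ u^×)` about the unit vector `u`, by Rodrigues' formula. -/
def rodrigues (θ : ℝ) (u : V3) : M3 :=
  1 + Real.sin θ • skew u + (1 - Real.cos θ) • (skew u * skew u)

/-- Derivative of a matrix-valued function, entry by entry. -/
def MatHasDerivWithinAt {m n : Type} (M : ℝ → Matrix m n ℝ) (M' : Matrix m n ℝ)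
    (J : Set ℝ) (t : ℝ) : Prop :=
  ∀ i j, HasDerivWithinAt (fun s => M s i j) (M' i j) J t

/-- Integral over `[a, b]` of a matrix-valued function, entry by entry. -/
def matIntegral {m n : Type} (M : ℝ → Matrix m n ℝ) (a b : ℝ) : Matrix m n ℝ :=
  Matrix.of fun i j => ∫ s in a..b, M s i j

/-- `M ⪰ N` for symmetric matrices. -/
def Succeq {n : Type} (M N : Matrix n n ℝ) : Prop := (M - N).PosSemidef

/-! ### Linear time-varying systems -/

/-- `Φ s t` is the state transition matrix of `A` from time `t` to time `s`, `0 ≤ t ≤ s`. -/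
def IsTransitionMatrix {n : Type} [Fintype n] [DecidableEq n]
    (A : ℝ → Matrix n n ℝ) (Φ : ℝ → ℝ → Matrix n n ℝ) : Prop :=
  ∀ t, 0 ≤ t → Φ t t = 1 ∧
    ∀ s, t ≤ s → MatHasDerivWithinAt (fun r => Φ r t) (A s * Φ s t) (Set.Ici t) s

/-- The observability Gramian `W(t, t + δ)`. -/
def gramian {m n : Type} [Fintype m] [Fintype n]
    (Φ : ℝ → ℝ → Matrix n n ℝ) (C : ℝ → Matrix m n ℝ) (t δ : ℝ) : Matrix n n ℝ :=
  (1 / δ) • matIntegral (fun s => (Φ s t)ᵀ * (C s)ᵀ * C s * Φ s t) t (t + δ)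

/-- The pair `(A, C)` is uniformly observable, with the constants `δ, μ`. -/
def UniformlyObservableWith {m n : Type} [Fintype m] [Fintype n] [DecidableEq n]
    (A : ℝ → Matrix n n ℝ) (C : ℝ → Matrix m n ℝ) (δ μ : ℝ) : Prop :=
  0 < δ ∧ 0 < μ ∧ ∃ Φ, IsTransitionMatrix A Φ ∧
    ∀ t, 0 ≤ t → Succeq (gramian Φ C t δ) (μ • 1)

/-! ### Rigid motions and measurements -/

/-- Motion for `t ≥ 0` of a rigid body with attitude `Q`, position `p`, velocity `v`, angular
velocity `ω` (body frame) and specific acceleration `a` (body frame), under gravity `g e₃`. -/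
structure IsRigidMotion (g : ℝ) (Q : ℝ → M3) (p v ω a : ℝ → V3) : Prop where
  rot : ∀ t, 0 ≤ t → Q t ∈ Matrix.specialOrthogonalGroup (Fin 3) ℝ
  att : ∀ t, 0 ≤ t → MatHasDerivWithinAt Q (Q t * skew (ω t)) (Set.Ici 0) t
  pos : ∀ t, 0 ≤ t → HasDerivWithinAt p (v t) (Set.Ici 0) t
  vel : ∀ t, 0 ≤ t → HasDerivWithinAt v (Q t *ᵥ a t + g • e3) (Set.Ici 0) t

/-- Bounded and uniformly continuous on `[0, ∞)`. -/
def BddUnifCont (f : ℝ → V3) : Prop :=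
  UniformContinuousOn f (Set.Ici 0) ∧ ∃ c, ∀ t, 0 ≤ t → eucl (f t) ≤ c

/-- The relative position `ξ = Q_Bᵀ (p_B - p_T)` in the body frame. -/
def relPos (QB : ℝ → M3) (pB pT : ℝ → V3) (t : ℝ) : V3 := (QB t)ᵀ *ᵥ (pB t - pT t)

/-- The bearing `y_ξ = ξ / |ξ|`. -/
def bearing (QB : ℝ → M3) (pB pT : ℝ → V3) (t : ℝ) : V3 :=
  (eucl (relPos QB pB pT t))⁻¹ • relPos QB pB pT t

/-- The bearing in the inertial frame, `Q_B y_ξ`. -/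
def bearingI (QB : ℝ → M3) (pB pT : ℝ → V3) (t : ℝ) : V3 := QB t *ᵥ bearing QB pB pT t

/-- The relative attitude `R = Q_Tᵀ Q_B`. -/
def relAtt (QB QT : ℝ → M3) (t : ℝ) : M3 := (QT t)ᵀ * QB t

/-- `b = a_T^I × η_I`, with `a_T^I = Q_T a_T` and `η_I = Q_T e₃`. -/
def bVec (QT : ℝ → M3) (aT : ℝ → V3) (t : ℝ) : V3 := (QT t *ᵥ aT t) ⨯₃ (QT t *ᵥ e3)

/-- Persistent excitation of the direction `y`, with the constants `δ, μ`. -/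
def BearingPE (y : ℝ → V3) (δ μ : ℝ) : Prop :=
  ∀ t, 0 ≤ t → Succeq ((1 / δ) • matIntegral (fun s => proj (y s)) t (t + δ)) (μ • 1)

/-! ### The error system with appended yaw error -/

/-- The block matrix `A_θ`, for the current values of `ω_B`, `R̂` and `a_T`. -/
def Atheta (ω : V3) (Rhat : M3) (a : V3) : M7 :=
  Matrix.fromBlocks
    (Matrix.fromBlocks (-skew ω) 1 0 (-skew ω))
    (Matrix.replicateCol (Fin 1) (Sum.elim 0 (Rhatᵀ *ᵥ (skew a *ᵥ e3))))
    0 0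

/-- The output matrix `C_θ = [π_y  0]`, for the current bearing `y`. -/
def Ctheta (y : V3) : Matrix (Fin 3) Idx7 ℝ :=
  Matrix.fromCols (Matrix.fromCols (proj y) 0) 0

/-- The components `ξ̃`, `ṽ`, `θ̃` of the state. -/
def posErr (x : V7) : V3 := fun i => x (Sum.inl (Sum.inl i))

def velErr (x : V7) : V3 := fun i => x (Sum.inl (Sum.inr i))

def yawErr (x : V7) : ℝ := x (Sum.inr 0)

/-- The attitude estimate `R̂ = R̃ R` for the attitude error `R̃ = exp(θ̃ e₃^×)`. -/
def attEst (R : M3) (x : V7) : M3 := rodrigues (yawErr x) e3 * R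

/-- The innovation `σ = K y`, with `K = P C_θᵀ D` and `y = C_θ x`. -/
def innovation (C : Matrix (Fin 3) Idx7 ℝ) (D : M3) (P : M7) (x : V7) : V7 :=
  (P * Cᵀ * D) *ᵥ (C *ᵥ x)

/-- Right-hand side `A_θ x - σ + ρ` of the error dynamics, with remainder `ρ`. -/
def errField (ωB aT : ℝ → V3) (R : ℝ → M3) (y : ℝ → V3) (D : ℝ → M3) (ρ : ℝ → V7 → V7)
    (t : ℝ) (x : V7) (P : M7) : V7 :=
  Atheta (ωB t) (attEst (R t) x) (aT t) *ᵥ x - innovation (Ctheta (y t)) (D t) P x + ρ t x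

/-- Right-hand side of the error dynamics before expansion in `θ̃`:
`ξ̃' = -ω_B^× ξ̃ + ṽ - σ_ξ`, `ṽ' = -ω_B^× ṽ - σ_v + R̂ᵀ (I₃ - exp(θ̃ e₃^×)) a_T`, `θ̃' = -σ_θ`. -/
def exactErrField (ωB aT : ℝ → V3) (R : ℝ → M3) (y : ℝ → V3) (D : ℝ → M3)
    (t : ℝ) (x : V7) (P : M7) : V7 :=
  Sum.elim
    (Sum.elim
      (-(skew (ωB t) *ᵥ posErr x) + velErr x)
      (-(skew (ωB t) *ᵥ velErr x)
        + (attEst (R t) x)ᵀ *ᵥ ((1 - rodrigues (yawErr x) e3) *ᵥ aT t)))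
    0
  - innovation (Ctheta (y t)) (D t) P x

/-- Right-hand side of the continuous Riccati equation for the pair `(A_θ, C_θ)`. -/
def riccatiField (ωB aT : ℝ → V3) (R : ℝ → M3) (y : ℝ → V3) (S : ℝ → M7) (D : ℝ → M3)
    (t : ℝ) (x : V7) (P : M7) : M7 :=
  let A := Atheta (ωB t) (attEst (R t) x) (aT t)
  let C := Ctheta (y t)
  A * P + P * Aᵀ - P * Cᵀ * D t * C * P + S t

/-- A remainder of order `O(|θ̃|²)` near the origin, uniformly in time; it is regular enough for the
differential equation to be well posed. -/
structure IsQuadraticRemainder (ρ : ℝ → V7 → V7) : Prop where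
  cont : ContinuousOn (fun q : ℝ × V7 => ρ q.1 q.2) (Set.Ici 0 ×ˢ Set.univ)
  lip : ∀ T r : ℝ, ∃ L : ℝ, ∀ t, 0 ≤ t → t ≤ T → ∀ x x' : V7, eucl x ≤ r → eucl x' ≤ r →
    eucl (ρ t x - ρ t x') ≤ L * eucl (x - x')
  quad : ∃ r c : ℝ, 0 < r ∧ ∀ t, 0 ≤ t → ∀ x : V7, eucl x ≤ r →
    eucl (ρ t x) ≤ c * |yawErr x| ^ 2

/-- `(x, P)` solves `x' = f(t, x, P)`, `P' = h(t, x, P)` on `J`. -/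
def IsObserverSolution (f : ℝ → V7 → M7 → V7) (h : ℝ → V7 → M7 → M7) (J : Set ℝ)
    (x : ℝ → V7) (P : ℝ → M7) : Prop :=
  ∀ t ∈ J, HasDerivWithinAt x (f t (x t) (P t)) J t ∧
    MatHasDerivWithinAt P (h t (x t) (P t)) J t

/-- Local exponential stability of `x = 0`, uniformly in the initial time and in the initial value
of the Riccati matrix between two positive multiples of the identity: solutions that start close
to `0` exist for all time, with a positive definite Riccati matrix, and every solution that starts
close to `0`, on whatever interval, decays exponentially. -/
def LocallyExpStable (f : ℝ → V7 → M7 → V7) (h : ℝ → V7 → M7 → M7) : Prop :=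
  ∀ p₁ p₂ : ℝ, 0 < p₁ → 0 < p₂ →
    ∃ r k l : ℝ, 0 < r ∧ 0 < k ∧ 0 < l ∧
      ∀ t₀, 0 ≤ t₀ → ∀ (x₀ : V7) (P₀ : M7), eucl x₀ < r →
        Succeq P₀ (p₁ • 1) → Succeq (p₂ • 1) P₀ →
        (∃ x P, IsObserverSolution f h (Set.Ici t₀) x P ∧ x t₀ = x₀ ∧ P t₀ = P₀ ∧
          ∀ t, t₀ ≤ t → (P t).PosDef) ∧
        ∀ T, t₀ < T → ∀ x P, IsObserverSolution f h (Set.Ico t₀ T) x P →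
          x t₀ = x₀ → P t₀ = P₀ →
          ∀ t ∈ Set.Ico t₀ T, eucl (x t) ≤ k * Real.exp (-l * (t - t₀)) * eucl x₀

/-- Continuous on `[0, ∞)`, symmetric, and between two positive multiples of the identity. -/
def IsWeight {n : Type} [DecidableEq n] (S : ℝ → Matrix n n ℝ) : Prop :=
  ContinuousOn S (Set.Ici 0) ∧ ∃ s₁ s₂ : ℝ, 0 < s₁ ∧ 0 < s₂ ∧
    ∀ t, 0 ≤ t → Succeq (S t) (s₁ • 1) ∧ Succeq (s₂ • 1) (S t)

end

/-! ### The Euclidean norm -/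

section Euclidean

variable {ι κ : Type} [Fintype ι] [Fintype κ]

/-! Observability. Conjugation by diag(Q_B, Q_B, 1) removes the rotation: in the inertial frame the
pair becomes X' = V, V' = θ b̂, θ' = 0, observed through the projections along the inertial bearing,
where b̂ = Q_B R̂ᵀ(a_T × e₃) equals b when R̂ = R. The question is thus whether the curve X₀ + (s -
t)V₀ + θ∬b̂ can be detected from its projections. Persistent excitation applied to the frozen vector
b₁(t) gives |b₁| ≤ |b₀|/2, so b₀·b ≥ |b₀|²/2 (`half_sq_le_dotProduct_bVec`), and b₀·b̂ ≥ |b₀|²/4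
persists for R̂ near R. Hence the second difference of X at t, t + h, t + 2h controls θ, and a first
difference then controls V₀ (`initial_data_le`). If M is the sum of the three distances |X|, the
speed is at most κM/h with κ independent of h. For large h the point hardly moves, relative to M,
during an excitation window of length δ, and the three windows together detect M
(`exists_observability_constants`).

Stability. The Riccati matrix stays between two multiples of the identity. The lower bound comes
from S alone, by a first-contact argument (`SolvesRiccatiOn.lt_quadForm`). The upper bound is a
duality estimate: a test vector solving the controlled adjoint equation bounds the quadratic form of
P, and a lower bound of the Gramian lets this vector start at 0, so that the initial value of P is
forgotten (`SolvesRiccatiOn.quadForm_le_of_gramian`). With these bounds xᵀP⁻¹x is a Lyapunov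
function that absorbs the quadratic remainder near the origin (`SolvesRiccatiOn.error_le`).

The system matrix depends on x through R̂, so the upper bound of P needs a small yaw error, while
smallness of x needs the upper bound of P. A continuity argument closes this loop
(`IsErrorSystem.exists_apriori`). Its estimates hold for every solution on every compact interval,
so they also exclude blow-up and give global existence. The unexpanded dynamics are the expanded
ones with an explicit quadratic remainder (`exactErrField_eq`). -/

theorem eucl_sq (w : ι → ℝ) : eucl w ^ 2 = w ⬝ᵥ w := by
  rw [eucl, EuclideanSpace.norm_sq_eq]
  simp [dotProduct, sq]

theorem eucl_nonneg (w : ι → ℝ) : 0 ≤ eucl w := norm_nonneg _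

@[simp] theorem eucl_zero : eucl (0 : ι → ℝ) = 0 := by simp [eucl]

theorem eucl_neg (w : ι → ℝ) : eucl (-w) = eucl w := by simp [eucl]

theorem eucl_add_le (v w : ι → ℝ) : eucl (v + w) ≤ eucl v + eucl w := by
  simpa [eucl] using norm_add_le (WithLp.toLp 2 v) (WithLp.toLp 2 w)

theorem eucl_sub_le (v w : ι → ℝ) : eucl (v - w) ≤ eucl v + eucl w := by
  simpa [eucl] using norm_sub_le (WithLp.toLp 2 v) (WithLp.toLp 2 w)

theorem eucl_smul (c : ℝ) (w : ι → ℝ) : eucl (c • w) = |c| * eucl w := by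
  simp [eucl, norm_smul]

theorem eucl_pos {w : ι → ℝ} (hw : w ≠ 0) : 0 < eucl w := by
  rw [eucl, norm_pos_iff]
  intro h
  exact hw (by simpa using congrArg WithLp.ofLp h)

theorem abs_dotProduct_le_eucl (v w : ι → ℝ) : |v ⬝ᵥ w| ≤ eucl v * eucl w := by
  have h := abs_real_inner_le_norm (WithLp.toLp 2 w) (WithLp.toLp 2 v)
  rw [EuclideanSpace.inner_toLp_toLp] at h
  simpa [eucl, mul_comm] using h

theorem dotProduct_le_eucl (v w : ι → ℝ) : v ⬝ᵥ w ≤ eucl v * eucl w :=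
  (le_abs_self _).trans (abs_dotProduct_le_eucl v w)

theorem abs_apply_le_eucl (w : ι → ℝ) (i : ι) : |w i| ≤ eucl w := by
  simpa [eucl] using PiLp.norm_apply_le (WithLp.toLp 2 w) i

theorem norm_le_eucl (w : ι → ℝ) : ‖w‖ ≤ eucl w :=
  (pi_norm_le_iff_of_nonneg (eucl_nonneg w)).2 fun i => abs_apply_le_eucl w i

theorem eucl_le_of_sq_le {v : ι → ℝ} {c : ℝ} (hc : 0 ≤ c) (h : v ⬝ᵥ v ≤ c ^ 2) : eucl v ≤ c :=
  le_of_sq_le_sq (by rw [eucl_sq]; exact h) hc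
where
  le_of_sq_le_sq {a b : ℝ} (h : a ^ 2 ≤ b ^ 2) (hb : 0 ≤ b) : a ≤ b := abs_le_of_sq_le_sq' h hb |>.2

theorem eucl_le_sum_abs (w : ι → ℝ) : eucl w ≤ ∑ i, |w i| := by
  refine eucl_le_of_sq_le (Finset.sum_nonneg fun i _ => abs_nonneg _) ?_
  have := Finset.sum_sq_le_sq_sum_of_nonneg (s := Finset.univ) (f := fun i => |w i|)
    (fun i _ => abs_nonneg _)
  simpa [dotProduct, ← sq] using this

theorem eucl_le_card_mul_norm (w : ι → ℝ) : eucl w ≤ Fintype.card ι * ‖w‖ := by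
  refine (eucl_le_sum_abs w).trans ?_
  calc ∑ i, |w i| ≤ ∑ _i : ι, ‖w‖ := Finset.sum_le_sum fun i _ => norm_le_pi_norm w i
    _ = _ := by simp

theorem continuous_eucl : Continuous (eucl : (ι → ℝ) → ℝ) := by
  unfold eucl
  exact continuous_norm.comp (PiLp.continuous_toLp 2 _)

theorem eucl_sumElim_sq (v : ι → ℝ) (w : κ → ℝ) :
    eucl (Sum.elim v w) ^ 2 = eucl v ^ 2 + eucl w ^ 2 := by
  simp [eucl_sq, dotProduct]

theorem eucl_sumElim_le (v : ι → ℝ) (w : κ → ℝ) :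
    eucl (Sum.elim v w) ≤ eucl v + eucl w := by
  have h := eucl_sumElim_sq v w
  nlinarith [eucl_nonneg v, eucl_nonneg w, eucl_nonneg (Sum.elim v w),
    mul_nonneg (eucl_nonneg v) (eucl_nonneg w)]

/-- A bound of the operator norm passes to the transpose. -/
theorem eucl_transpose_mulVec_le {M : Matrix ι κ ℝ} {c : ℝ} (hc : 0 ≤ c)
    (h : ∀ z, eucl (M *ᵥ z) ≤ c * eucl z) (w : ι → ℝ) : eucl (Mᵀ *ᵥ w) ≤ c * eucl w := by
  have h1 : eucl (Mᵀ *ᵥ w) ^ 2 = w ⬝ᵥ (M *ᵥ (Mᵀ *ᵥ w)) := by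
    rw [eucl_sq, Matrix.dotProduct_mulVec w, ← Matrix.mulVec_transpose]
  have h2 := (dotProduct_le_eucl w (M *ᵥ (Mᵀ *ᵥ w))).trans
    (mul_le_mul_of_nonneg_left (h (Mᵀ *ᵥ w)) (eucl_nonneg w))
  rw [← h1] at h2
  rcases (eucl_nonneg (Mᵀ *ᵥ w)).eq_or_lt with h0 | h0
  · rw [← h0]
    exact mul_nonneg hc (eucl_nonneg w)
  · nlinarith

end Euclidean

/-! ### Quadratic forms -/

section QuadraticForms

theorem Matrix.PosSemidef.transpose_eq {n : Type} {M : Matrix n n ℝ} (h : M.PosSemidef) : Mᵀ = M := by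
  simpa [Matrix.IsHermitian, Matrix.conjTranspose_eq_transpose_of_trivial] using h.isHermitian

variable {n m : Type} [Fintype n] [Fintype m]

theorem dotProduct_transpose_mulVec (M : Matrix m n ℝ) (v : n → ℝ) (w : m → ℝ) :
    v ⬝ᵥ (Mᵀ *ᵥ w) = (M *ᵥ v) ⬝ᵥ w := by
  rw [Matrix.dotProduct_mulVec, Matrix.vecMul_transpose]

theorem Matrix.PosSemidef.quadForm_nonneg {M : Matrix n n ℝ} (h : M.PosSemidef) (z : n → ℝ) :
    0 ≤ z ⬝ᵥ (M *ᵥ z) := by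
  simpa using h.dotProduct_mulVec_nonneg z

theorem posSemidef_of_quadForm {M : Matrix n n ℝ} (hM : Mᵀ = M)
    (h : ∀ z, 0 ≤ z ⬝ᵥ (M *ᵥ z)) : M.PosSemidef :=
  Matrix.PosSemidef.of_dotProduct_mulVec_nonneg
    (by simpa [Matrix.IsHermitian, Matrix.conjTranspose_eq_transpose_of_trivial] using hM)
    (by simpa using h)

theorem posDef_of_quadForm {M : Matrix n n ℝ} (hM : Mᵀ = M)
    (h : ∀ z, z ≠ 0 → 0 < z ⬝ᵥ (M *ᵥ z)) : M.PosDef :=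
  Matrix.PosDef.of_dotProduct_mulVec_pos
    (by simpa [Matrix.IsHermitian, Matrix.conjTranspose_eq_transpose_of_trivial] using hM)
    (by simpa using h)

/-- Weighted Cauchy-Schwarz (Young) inequality for a nonnegative quadratic form. -/
theorem two_mul_dotProduct_le {G : Matrix n n ℝ} (hG : Gᵀ = G)
    (h : ∀ z, 0 ≤ z ⬝ᵥ (G *ᵥ z)) (c d : n → ℝ) :
    2 * (c ⬝ᵥ (G *ᵥ d)) ≤ c ⬝ᵥ (G *ᵥ c) + d ⬝ᵥ (G *ᵥ d) := by
  have h1 := h (c - d)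
  have h2 : d ⬝ᵥ (G *ᵥ c) = c ⬝ᵥ (G *ᵥ d) := by
    rw [← hG, dotProduct_transpose_mulVec, hG, dotProduct_comm]
  rw [Matrix.mulVec_sub, sub_dotProduct, dotProduct_sub, dotProduct_sub, h2] at h1
  linarith

/-- `P² ≤ c P` for `0 ≤ P ≤ c`. -/
theorem eucl_mulVec_sq_le {P : Matrix n n ℝ} {c : ℝ} (hc : 0 < c) (hP : Pᵀ = P)
    (h0 : ∀ z, 0 ≤ z ⬝ᵥ (P *ᵥ z)) (h : ∀ z, z ⬝ᵥ (P *ᵥ z) ≤ c * eucl z ^ 2) (z : n → ℝ) :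
    eucl (P *ᵥ z) ^ 2 ≤ c * (z ⬝ᵥ (P *ᵥ z)) := by
  -- The cross term is 2c|Pz|², and the upper bound of P, applied to the vector Pz, absorbs half of
  -- it.
  have h1 := two_mul_dotProduct_le hP h0 (c • z) (P *ᵥ z)
  have h2 := h (P *ᵥ z)
  have h3 : z ⬝ᵥ (P *ᵥ (P *ᵥ z)) = eucl (P *ᵥ z) ^ 2 := by
    conv_lhs => rw [← hP]
    rw [dotProduct_transpose_mulVec, hP, eucl_sq]
  rw [Matrix.mulVec_smul, smul_dotProduct, smul_dotProduct, dotProduct_smul, h3] at h1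
  simp only [smul_eq_mul] at h1
  have h4 : c * eucl (P *ᵥ z) ^ 2 ≤ c * (c * (z ⬝ᵥ (P *ᵥ z))) := by linarith
  exact le_of_mul_le_mul_left h4 hc

variable [DecidableEq n]

theorem quadForm_smul_one (c : ℝ) (z : n → ℝ) :
    z ⬝ᵥ ((c • (1 : Matrix n n ℝ)) *ᵥ z) = c * eucl z ^ 2 := by
  rw [Matrix.smul_mulVec, Matrix.one_mulVec, dotProduct_smul, eucl_sq, smul_eq_mul]

theorem Succeq.mul_sq_le {M : Matrix n n ℝ} {c : ℝ} (h : Succeq M (c • 1)) (z : n → ℝ) :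
    c * eucl z ^ 2 ≤ z ⬝ᵥ (M *ᵥ z) := by
  have := Matrix.PosSemidef.quadForm_nonneg h z
  rw [Matrix.sub_mulVec, dotProduct_sub, quadForm_smul_one] at this
  linarith

theorem Succeq.le_mul_sq {M : Matrix n n ℝ} {c : ℝ} (h : Succeq (c • 1) M) (z : n → ℝ) :
    z ⬝ᵥ (M *ᵥ z) ≤ c * eucl z ^ 2 := by
  have := Matrix.PosSemidef.quadForm_nonneg h z
  rw [Matrix.sub_mulVec, dotProduct_sub, quadForm_smul_one] at this
  linarith

theorem Succeq.transpose_eq {n : Type} [DecidableEq n] {M : Matrix n n ℝ} {c : ℝ} (h : Succeq M (c • 1)) : Mᵀ = M := by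
  have := Matrix.PosSemidef.transpose_eq h
  rw [Matrix.transpose_sub, Matrix.transpose_smul, Matrix.transpose_one] at this
  exact sub_left_injective this

theorem succeq_of_mul_sq_le {M : Matrix n n ℝ} {c : ℝ} (hM : Mᵀ = M)
    (h : ∀ z, c * eucl z ^ 2 ≤ z ⬝ᵥ (M *ᵥ z)) : Succeq M (c • 1) := by
  refine posSemidef_of_quadForm (by simp [hM]) fun z => ?_
  rw [Matrix.sub_mulVec, dotProduct_sub, quadForm_smul_one]
  linarith [h z]

/-- The entries of a matrix `0 ≤ P ≤ c` are bounded by `c`. -/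
theorem abs_apply_le_of_quadForm {P : Matrix n n ℝ} {c : ℝ} (hP : Pᵀ = P)
    (h0 : ∀ z, 0 ≤ z ⬝ᵥ (P *ᵥ z)) (h : ∀ z, z ⬝ᵥ (P *ᵥ z) ≤ c * eucl z ^ 2) (i j : n) :
    |P i j| ≤ c := by
  have hd : ∀ k, P k k ≤ c := fun k => by
    have := h (Pi.single k 1)
    simpa [eucl_sq] using this
  -- Young's inequality with both signs of the basis vector bounds |P i j| by the mean of two
  -- diagonal entries.
  have h1 := two_mul_dotProduct_le hP h0 (Pi.single i 1) (Pi.single j 1)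
  have h2 := two_mul_dotProduct_le hP h0 (-Pi.single i 1) (Pi.single j 1)
  simp [Matrix.mulVec_neg] at h1 h2
  rw [abs_le]
  constructor <;> linarith [hd i, hd j]

theorem isUnit_det_of_quadForm_pos {M : Matrix n n ℝ}
    (h : ∀ z, z ≠ 0 → 0 < z ⬝ᵥ (M *ᵥ z)) : IsUnit M.det := by
  rw [← Matrix.isUnit_iff_isUnit_det, ← Matrix.mulVec_injective_iff_isUnit]
  intro v w hvw
  by_contra hne
  have := h (v - w) (sub_ne_zero.2 hne)
  simp [Matrix.mulVec_sub, hvw] at this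

end QuadraticForms

/-! ### Calculus of matrix-valued functions -/

section MatrixCalculus

variable {l m n : Type} {J : Set ℝ} {t : ℝ}

theorem MatHasDerivWithinAt.mono {M : ℝ → Matrix m n ℝ} {M' : Matrix m n ℝ} {K : Set ℝ}
    (h : MatHasDerivWithinAt M M' J t) (hK : K ⊆ J) : MatHasDerivWithinAt M M' K t :=
  fun i j => (h i j).mono hK

theorem MatHasDerivWithinAt.mul [Fintype m] {M : ℝ → Matrix l m ℝ} {N : ℝ → Matrix m n ℝ}
    {M' : Matrix l m ℝ} {N' : Matrix m n ℝ} (hM : MatHasDerivWithinAt M M' J t)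
    (hN : MatHasDerivWithinAt N N' J t) :
    MatHasDerivWithinAt (fun s => M s * N s) (M' * N t + M t * N') J t := by
  intro i j
  simp only [Matrix.mul_apply, Matrix.add_apply, ← Finset.sum_add_distrib]
  exact HasDerivWithinAt.fun_sum fun k _ => (hM i k).mul (hN k j)

theorem MatHasDerivWithinAt.transpose {M : ℝ → Matrix m n ℝ} {M' : Matrix m n ℝ}
    (hM : MatHasDerivWithinAt M M' J t) :
    MatHasDerivWithinAt (fun s => (M s)ᵀ) M'ᵀ J t :=
  fun i j => hM j i

theorem MatHasDerivWithinAt.sub {M N : ℝ → Matrix m n ℝ} {M' N' : Matrix m n ℝ}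
    (hM : MatHasDerivWithinAt M M' J t) (hN : MatHasDerivWithinAt N N' J t) :
    MatHasDerivWithinAt (fun s => M s - N s) (M' - N') J t :=
  fun i j => (hM i j).sub (hN i j)

theorem matHasDerivWithinAt_const (M : Matrix m n ℝ) :
    MatHasDerivWithinAt (fun _ => M) 0 J t :=
  fun _ _ => hasDerivWithinAt_const ..

theorem MatHasDerivWithinAt.congr_deriv {M : ℝ → Matrix m n ℝ} {M' N' : Matrix m n ℝ}
    (hM : MatHasDerivWithinAt M M' J t) (h : M' = N') : MatHasDerivWithinAt M N' J t :=
  h ▸ hM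

theorem MatHasDerivWithinAt.mulVec [Fintype n] {M : ℝ → Matrix m n ℝ} {M' : Matrix m n ℝ}
    {x : ℝ → n → ℝ} {x' : n → ℝ} [Fintype m]
    (hM : MatHasDerivWithinAt M M' J t) (hx : HasDerivWithinAt x x' J t) :
    HasDerivWithinAt (fun s => M s *ᵥ x s) (M' *ᵥ x t + M t *ᵥ x') J t := by
  rw [hasDerivWithinAt_pi] at hx ⊢
  intro i
  simp only [Matrix.mulVec, dotProduct, Pi.add_apply, ← Finset.sum_add_distrib]
  exact HasDerivWithinAt.fun_sum fun k _ => (hM i k).mul (hx k)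

theorem HasDerivWithinAt.dotProduct [Fintype n] {x y : ℝ → n → ℝ} {x' y' : n → ℝ}
    (hx : HasDerivWithinAt x x' J t) (hy : HasDerivWithinAt y y' J t) :
    HasDerivWithinAt (fun s => x s ⬝ᵥ y s) (x' ⬝ᵥ y t + x t ⬝ᵥ y') J t := by
  rw [hasDerivWithinAt_pi] at hx hy
  simp only [_root_.dotProduct, ← Finset.sum_add_distrib]
  exact HasDerivWithinAt.fun_sum fun k _ => (hx k).mul (hy k)

theorem MatHasDerivWithinAt.quadForm [Fintype n] {M : ℝ → Matrix n n ℝ} {M' : Matrix n n ℝ}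
    (hM : MatHasDerivWithinAt M M' J t) (q : n → ℝ) :
    HasDerivWithinAt (fun s => q ⬝ᵥ (M s *ᵥ q)) (q ⬝ᵥ (M' *ᵥ q)) J t := by
  have := (hasDerivWithinAt_const t J q).dotProduct (hM.mulVec (hasDerivWithinAt_const t J q))
  simpa using this

theorem MatHasDerivWithinAt.continuousWithinAt {M : ℝ → Matrix m n ℝ} {M' : Matrix m n ℝ}
    (hM : MatHasDerivWithinAt M M' J t) : ContinuousWithinAt M J t :=
  continuousWithinAt_pi.2 fun i => continuousWithinAt_pi.2 fun j => (hM i j).continuousWithinAt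

theorem ContinuousOn.matrix_mul {X : Type} [TopologicalSpace X] {s : Set X} [Fintype m]
    {M : X → Matrix l m ℝ} {N : X → Matrix m n ℝ}
    (hM : ContinuousOn M s) (hN : ContinuousOn N s) : ContinuousOn (fun x => M x * N x) s := by
  rw [continuousOn_iff_continuous_domRestrict] at *
  exact hM.matrix_mul hN

theorem ContinuousOn.matrix_transpose {X : Type} [TopologicalSpace X] {s : Set X}
    {M : X → Matrix m n ℝ} (hM : ContinuousOn M s) : ContinuousOn (fun x => (M x)ᵀ) s := by
  rw [continuousOn_iff_continuous_domRestrict] at *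
  exact hM.matrix_transpose

theorem ContinuousOn.matrix_mulVec {X : Type} [TopologicalSpace X] {s : Set X} [Fintype n]
    {M : X → Matrix m n ℝ} {v : X → n → ℝ}
    (hM : ContinuousOn M s) (hv : ContinuousOn v s) : ContinuousOn (fun x => M x *ᵥ v x) s := by
  rw [continuousOn_iff_continuous_domRestrict] at *
  exact hM.matrix_mulVec hv

theorem ContinuousOn.matrix_elem {X : Type} [TopologicalSpace X] {s : Set X}
    {M : X → Matrix m n ℝ} (hM : ContinuousOn M s) (i : m) (j : n) :
    ContinuousOn (fun x => M x i j) s :=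
  continuousOn_pi.1 (continuousOn_pi.1 hM i) j

/-! ### Matrices as a normed algebra: derivative of the inverse and a Grönwall argument. -/

section Norm

attribute [local instance] Matrix.linftyOpNormedAddCommGroup Matrix.linftyOpNormedSpace
  Matrix.linftyOpNormedRing Matrix.linftyOpNormedAlgebra

variable [Fintype n]

theorem MatHasDerivWithinAt.hasDerivWithinAt {M : ℝ → Matrix n n ℝ} {M' : Matrix n n ℝ}
    (hM : MatHasDerivWithinAt M M' J t) : HasDerivWithinAt M M' J t := by
  refine (hasDerivWithinAt_pi.2 fun i => ?_ : HasDerivWithinAt (F := n → n → ℝ) M M' J t)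
  exact hasDerivWithinAt_pi.2 fun j => hM i j

theorem matHasDerivWithinAt_of_hasDerivWithinAt {M : ℝ → Matrix n n ℝ} {M' : Matrix n n ℝ}
    (hM : HasDerivWithinAt M M' J t) : MatHasDerivWithinAt M M' J t := fun i j => by
  have h1 : HasDerivWithinAt (F := n → n → ℝ) M M' J t := hM
  have h2 := hasDerivWithinAt_pi.1 h1 i
  have h3 := hasDerivWithinAt_pi.1 h2 j
  exact h3

theorem MatHasDerivWithinAt.inv [DecidableEq n] {M : ℝ → Matrix n n ℝ} {M' : Matrix n n ℝ}
    (hM : MatHasDerivWithinAt M M' J t) (hdet : IsUnit (M t).det) :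
    MatHasDerivWithinAt (fun s => (M s)⁻¹) (-((M t)⁻¹ * M' * (M t)⁻¹)) J t := by
  obtain ⟨u, hu⟩ := (Matrix.isUnit_iff_isUnit_det _).2 hdet
  have h1 := hasFDerivAt_ringInverse (𝕜 := ℝ) u
  rw [hu] at h1
  have h2 := h1.comp_hasDerivWithinAt t hM.hasDerivWithinAt
  have e1 : Ring.inverse ∘ M = fun s => (M s)⁻¹ := by
    ext s : 1
    simp [Matrix.nonsing_inv_eq_ringInverse]
  have e2 : (-((ContinuousLinearMap.mulLeftRight ℝ (Matrix n n ℝ)) ↑u⁻¹) ↑u⁻¹) M'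
      = -((M t)⁻¹ * M' * (M t)⁻¹) := by
    rw [← hu, ← Matrix.coe_units_inv]
    rfl
  rw [e1, e2] at h2
  exact matHasDerivWithinAt_of_hasDerivWithinAt h2

/-- A matrix function with `E' = M E + E N` and `E(a) = 0` vanishes. -/
theorem eq_zero_of_linear_deriv [DecidableEq n] {E M N : ℝ → Matrix n n ℝ} {a b : ℝ}
    (hM : ContinuousOn M (Set.Icc a b)) (hN : ContinuousOn N (Set.Icc a b))
    (hE : ∀ s ∈ Set.Icc a b, MatHasDerivWithinAt E (M s * E s + E s * N s) (Set.Icc a b) s)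
    (h0 : E a = 0) : ∀ s ∈ Set.Icc a b, E s = 0 := by
  obtain ⟨K₁, hK₁⟩ := isCompact_Icc.exists_bound_of_continuousOn hM
  obtain ⟨K₂, hK₂⟩ := isCompact_Icc.exists_bound_of_continuousOn hN
  refine eq_zero_of_abs_deriv_le_mul_abs_self_of_eq_zero_right (K := K₁ + K₂)
    (f' := fun s => M s * E s + E s * N s)
    (fun s hs => (hE s hs).continuousWithinAt) (fun s hs => ?_) h0 (fun s hs => ?_)
  · have h1 := (hE s (Set.Ico_subset_Icc_self hs)).hasDerivWithinAt
    exact h1.mono_of_mem_nhdsWithin (Icc_mem_nhdsGE_of_mem hs)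
  · have hs' := Set.Ico_subset_Icc_self hs
    calc ‖M s * E s + E s * N s‖ ≤ ‖M s‖ * ‖E s‖ + ‖E s‖ * ‖N s‖ :=
          (norm_add_le _ _).trans (add_le_add (norm_mul_le _ _) (norm_mul_le _ _))
      _ ≤ K₁ * ‖E s‖ + ‖E s‖ * K₂ := by
          gcongr
          · exact hK₁ s hs'
          · exact hK₂ s hs'
      _ = (K₁ + K₂) * ‖E s‖ := by ring

end Norm

end MatrixCalculus

/-! ### Differential inequalities -/

section Scalar

variable {f f' : ℝ → ℝ} {a b : ℝ}

theorem sub_le_mul_of_deriv_le {c : ℝ} (hab : a ≤ b)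
    (hf : ∀ s ∈ Set.Icc a b, HasDerivWithinAt f (f' s) (Set.Icc a b) s)
    (h : ∀ s ∈ Set.Icc a b, f' s ≤ c) : f b - f a ≤ c * (b - a) := by
  have hd : ∀ s ∈ interior (Set.Icc a b), HasDerivAt f (f' s) s := fun s hs =>
    (hf s (interior_subset hs)).hasDerivAt (mem_interior_iff_mem_nhds.1 hs)
  refine (convex_Icc a b).image_sub_le_mul_sub_of_deriv_le (fun s hs => (hf s hs).continuousWithinAt)
    (fun s hs => (hd s hs).differentiableAt.differentiableWithinAt)
    (fun s hs => ?_) a (Set.left_mem_Icc.2 hab) b (Set.right_mem_Icc.2 hab) hab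
  rw [(hd s hs).deriv]
  exact h s (interior_subset hs)

/-- The product of f with exp(-K(s - a)) is nonincreasing. No sign of K or f is assumed: negative K
serves for decay, and -f in place of f for lower bounds. -/
theorem le_exp_mul_of_deriv_le {K : ℝ} (hab : a ≤ b)
    (hf : ∀ s ∈ Set.Icc a b, HasDerivWithinAt f (f' s) (Set.Icc a b) s)
    (h : ∀ s ∈ Set.Icc a b, f' s ≤ K * f s) : f b ≤ Real.exp (K * (b - a)) * f a := by
  have h1 := sub_le_mul_of_deriv_le (f := fun s => Real.exp (-K * (s - a)) * f s)
    (f' := fun s => Real.exp (-K * (s - a)) * (-K * 1) * f s + Real.exp (-K * (s - a)) * f' s)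
    (c := 0) hab
    (fun s hs => ((((hasDerivAt_id s).sub_const a).const_mul (-K)).exp.hasDerivWithinAt).mul
      (hf s hs))
    (fun s hs => by
      have := mul_le_mul_of_nonneg_left (h s hs) (Real.exp_pos (-K * (s - a))).le
      linarith)
  simp only [sub_self, mul_zero, Real.exp_zero, zero_mul, one_mul] at h1
  have h2 := mul_le_mul_of_nonneg_left (sub_nonpos.1 h1) (Real.exp_pos (K * (b - a))).le
  rwa [← mul_assoc, ← Real.exp_add, show K * (b - a) + -K * (b - a) = 0 by ring, Real.exp_zero,
    one_mul] at h2

end Scalar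

/-! ### Flows of linear systems -/

section Flow

variable {n : Type} [Fintype n] {A F : ℝ → Matrix n n ℝ} {a b α : ℝ}

/-- The derivative of |Fq|² lies between -2α|Fq|² and 2α|Fq|². The second half of the conclusion
yields invertibility of the flow and the bound of its inverse. -/
theorem eucl_flow_le [DecidableEq n] (hα : 0 ≤ α)
    (hA : ∀ s ∈ Set.Icc a b, ∀ z, eucl (A s *ᵥ z) ≤ α * eucl z)
    (hF : ∀ s ∈ Set.Icc a b, MatHasDerivWithinAt F (A s * F s) (Set.Icc a b) s) (h0 : F a = 1)
    {s : ℝ} (hs : s ∈ Set.Icc a b) (q : n → ℝ) :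
    eucl (F s *ᵥ q) ≤ Real.exp (α * (b - a)) * eucl q ∧
      eucl q ≤ Real.exp (α * (b - a)) * eucl (F s *ᵥ q) := by
  have hsub : Set.Icc a s ⊆ Set.Icc a b := Set.Icc_subset_Icc_right hs.2
  have hd : ∀ r ∈ Set.Icc a s, HasDerivWithinAt (fun r => (F r *ᵥ q) ⬝ᵥ (F r *ᵥ q))
      (2 * ((F r *ᵥ q) ⬝ᵥ (A r *ᵥ (F r *ᵥ q)))) (Set.Icc a s) r := fun r hr => by
    have h1 := ((hF r (hsub hr)).mono hsub).mulVec (hasDerivWithinAt_const r _ q)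
    refine (h1.dotProduct h1).congr_deriv ?_
    simp only [Matrix.mulVec_zero, add_zero, ← Matrix.mulVec_mulVec]
    rw [dotProduct_comm (A r *ᵥ (F r *ᵥ q))]
    ring
  have hb : ∀ r ∈ Set.Icc a s, |(F r *ᵥ q) ⬝ᵥ (A r *ᵥ (F r *ᵥ q))|
      ≤ α * ((F r *ᵥ q) ⬝ᵥ (F r *ᵥ q)) := fun r hr => by
    have h1 := abs_dotProduct_le_eucl (F r *ᵥ q) (A r *ᵥ (F r *ᵥ q))
    have h2 := mul_le_mul_of_nonneg_left (hA r (hsub hr) (F r *ᵥ q)) (eucl_nonneg (F r *ᵥ q))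
    rw [← eucl_sq]
    nlinarith
  have h1 := le_exp_mul_of_deriv_le (K := 2 * α) hs.1 hd fun r hr => by
    linarith [le_of_abs_le (hb r hr)]
  have h2 := le_exp_mul_of_deriv_le (K := -(2 * α)) hs.1 (fun r hr => (hd r hr).neg) fun r hr => by
    have := neg_le_of_abs_le (hb r hr)
    simp only [Pi.neg_apply]
    linarith
  simp only [h0, Matrix.one_mulVec, ← eucl_sq, Pi.neg_apply] at h1 h2
  have e1 : Real.exp (2 * α * (s - a)) ≤ Real.exp (α * (b - a)) ^ 2 := by
    rw [← Real.exp_nat_mul]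
    apply Real.exp_le_exp.2
    push_cast
    nlinarith [hs.2]
  constructor
  · refine abs_le_of_sq_le_sq' ?_ (mul_nonneg (Real.exp_pos _).le (eucl_nonneg _)) |>.2
    rw [mul_pow]
    exact h1.trans (mul_le_mul_of_nonneg_right e1 (sq_nonneg _))
  · refine abs_le_of_sq_le_sq' ?_ (mul_nonneg (Real.exp_pos _).le (eucl_nonneg _)) |>.2
    rw [mul_pow]
    refine le_trans ?_ (mul_le_mul_of_nonneg_right e1 (sq_nonneg _))
    have h3 : Real.exp (-(2 * α) * (s - a)) * eucl q ^ 2 ≤ eucl (F s *ᵥ q) ^ 2 := by linarith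
    have h4 := mul_le_mul_of_nonneg_left h3 (Real.exp_pos (2 * α * (s - a))).le
    rwa [← mul_assoc, ← Real.exp_add, show 2 * α * (s - a) + -(2 * α) * (s - a) = 0 by ring,
      Real.exp_zero, one_mul] at h4

theorem isUnit_det_flow [DecidableEq n] (hα : 0 ≤ α)
    (hA : ∀ s ∈ Set.Icc a b, ∀ z, eucl (A s *ᵥ z) ≤ α * eucl z)
    (hF : ∀ s ∈ Set.Icc a b, MatHasDerivWithinAt F (A s * F s) (Set.Icc a b) s) (h0 : F a = 1)
    {s : ℝ} (hs : s ∈ Set.Icc a b) : IsUnit (F s).det := by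
  rw [← Matrix.isUnit_iff_isUnit_det, ← Matrix.mulVec_injective_iff_isUnit]
  intro v w hvw
  by_contra hne
  have h1 := (eucl_flow_le hα hA hF h0 hs (v - w)).2
  have hvw' : F s *ᵥ v = F s *ᵥ w := hvw
  rw [Matrix.mulVec_sub, hvw', sub_self, eucl_zero, mul_zero] at h1
  exact absurd (eucl_pos (sub_ne_zero.2 hne)) (not_lt.2 h1)

/-- The inverse transpose propagates the adjoint equation e' = -Aᵀe, from which the test vectors for
the Riccati equation are built. -/
theorem flow_inv_transpose_deriv [DecidableEq n] {s : ℝ} {J : Set ℝ}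
    (hF : MatHasDerivWithinAt F (A s * F s) J s) (hdet : IsUnit (F s).det) :
    MatHasDerivWithinAt (fun r => ((F r)⁻¹)ᵀ) (-((A s)ᵀ * ((F s)⁻¹)ᵀ)) J s := by
  refine (hF.inv hdet).transpose.congr_deriv ?_
  rw [Matrix.mul_assoc, Matrix.mul_assoc, Matrix.mul_nonsing_inv _ hdet, Matrix.mul_one,
    Matrix.transpose_neg, Matrix.transpose_mul]

theorem eucl_flow_inv_transpose_le [DecidableEq n] (hα : 0 ≤ α)
    (hA : ∀ s ∈ Set.Icc a b, ∀ z, eucl (A s *ᵥ z) ≤ α * eucl z)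
    (hF : ∀ s ∈ Set.Icc a b, MatHasDerivWithinAt F (A s * F s) (Set.Icc a b) s) (h0 : F a = 1)
    {s : ℝ} (hs : s ∈ Set.Icc a b) (q : n → ℝ) :
    eucl (((F s)⁻¹)ᵀ *ᵥ q) ≤ Real.exp (α * (b - a)) * eucl q := by
  refine eucl_transpose_mulVec_le (Real.exp_pos _).le (fun z => ?_) q
  have h1 := (eucl_flow_le hα hA hF h0 hs ((F s)⁻¹ *ᵥ z)).2
  rwa [Matrix.mulVec_mulVec, Matrix.mul_nonsing_inv _ (isUnit_det_flow hα hA hF h0 hs),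
    Matrix.one_mulVec] at h1

end Flow

/-! ### Bounds for the Riccati equation -/

section Riccati

variable {n : Type} [Fintype n] {A G S P : ℝ → Matrix n n ℝ} {a b : ℝ}

/-- `P` solves the Riccati equation `P' = A P + P Aᵀ - P G P + S` on `[a, b]`. -/
def SolvesRiccatiOn (A G S P : ℝ → Matrix n n ℝ) (a b : ℝ) : Prop :=
  ∀ s ∈ Set.Icc a b, MatHasDerivWithinAt P
    (A s * P s + P s * (A s)ᵀ - P s * G s * P s + S s) (Set.Icc a b) s

theorem SolvesRiccatiOn.mono {a' b' : ℝ} (h : SolvesRiccatiOn A G S P a b) (ha : a ≤ a')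
    (hb : b' ≤ b) : SolvesRiccatiOn A G S P a' b' := fun s hs =>
  (h s (Set.Icc_subset_Icc ha hb hs)).mono (Set.Icc_subset_Icc ha hb)

theorem SolvesRiccatiOn.continuousOn (h : SolvesRiccatiOn A G S P a b) :
    ContinuousOn P (Set.Icc a b) := fun s hs => (h s hs).continuousWithinAt

/-- Pᵀ solves the same equation, and the difference E = P - Pᵀ satisfies the linear equation E' = (A
- PG)E + E(Aᵀ - GPᵀ) with E(a) = 0. -/
theorem SolvesRiccatiOn.transpose_eq [DecidableEq n] (h : SolvesRiccatiOn A G S P a b)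
    (hA : ContinuousOn A (Set.Icc a b)) (hG : ContinuousOn G (Set.Icc a b))
    (hGs : ∀ s ∈ Set.Icc a b, (G s)ᵀ = G s) (hSs : ∀ s ∈ Set.Icc a b, (S s)ᵀ = S s)
    (h0 : (P a)ᵀ = P a) : ∀ s ∈ Set.Icc a b, (P s)ᵀ = P s := by
  have hPc := h.continuousOn
  have key := eq_zero_of_linear_deriv (E := fun s => P s - (P s)ᵀ)
    (M := fun s => A s - P s * G s) (N := fun s => (A s)ᵀ - G s * (P s)ᵀ)
    (hA.sub (hPc.matrix_mul hG)) (hA.matrix_transpose.sub (hG.matrix_mul hPc.matrix_transpose))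
    (fun s hs => ((h s hs).sub (h s hs).transpose).congr_deriv (by
      simp only [Matrix.transpose_add, Matrix.transpose_sub, Matrix.transpose_mul,
        Matrix.transpose_transpose, hGs s hs, hSs s hs]
      noncomm_ring))
    (by simp [h0])
  exact fun s hs => (sub_eq_zero.1 (key s hs)).symm

/-- A test vector `e` with `e' = -Aᵀ e + G c` bounds the quadratic form of `P`. -/
theorem SolvesRiccatiOn.quadForm_le (h : SolvesRiccatiOn A G S P a b) (hab : a ≤ b)
    (hPs : ∀ s ∈ Set.Icc a b, (P s)ᵀ = P s) (hGs : ∀ s ∈ Set.Icc a b, (G s)ᵀ = G s)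
    (hG0 : ∀ s ∈ Set.Icc a b, ∀ z, 0 ≤ z ⬝ᵥ (G s *ᵥ z)) {e c : ℝ → n → ℝ} {κ : ℝ}
    (he : ∀ s ∈ Set.Icc a b,
      HasDerivWithinAt e (-((A s)ᵀ *ᵥ e s) + G s *ᵥ c s) (Set.Icc a b) s)
    (hκ : ∀ s ∈ Set.Icc a b, c s ⬝ᵥ (G s *ᵥ c s) + e s ⬝ᵥ (S s *ᵥ e s) ≤ κ) :
    e b ⬝ᵥ (P b *ᵥ e b) ≤ e a ⬝ᵥ (P a *ᵥ e a) + κ * (b - a) := by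
  -- The terms with A cancel because e follows the adjoint equation. Completing the square in Pe
  -- against c then removes P from the bound of the derivative.
  have hd : ∀ s ∈ Set.Icc a b, HasDerivWithinAt (fun s => e s ⬝ᵥ (P s *ᵥ e s))
      (2 * (c s ⬝ᵥ (G s *ᵥ (P s *ᵥ e s))) - (P s *ᵥ e s) ⬝ᵥ (G s *ᵥ (P s *ᵥ e s))
        + e s ⬝ᵥ (S s *ᵥ e s)) (Set.Icc a b) s := fun s hs => by
    refine ((he s hs).dotProduct ((h s hs).mulVec (he s hs))).congr_deriv ?_
    have hP : ∀ v w, v ⬝ᵥ (P s *ᵥ w) = (P s *ᵥ v) ⬝ᵥ w := fun v w => by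
      rw [← dotProduct_transpose_mulVec, hPs s hs]
    have hG : ∀ v w, v ⬝ᵥ (G s *ᵥ w) = (G s *ᵥ v) ⬝ᵥ w := fun v w => by
      rw [← dotProduct_transpose_mulVec, hGs s hs]
    have hA : ∀ v w, v ⬝ᵥ (A s *ᵥ w) = ((A s)ᵀ *ᵥ v) ⬝ᵥ w := fun v w => by
      rw [← dotProduct_transpose_mulVec, Matrix.transpose_transpose]
    simp only [Matrix.add_mulVec, Matrix.sub_mulVec, ← Matrix.mulVec_mulVec, Matrix.mulVec_add,
      Matrix.mulVec_neg, dotProduct_add, dotProduct_sub, add_dotProduct, neg_dotProduct,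
      dotProduct_neg]
    rw [hA (e s), hP (e s) (G s *ᵥ _), hP (e s) ((A s)ᵀ *ᵥ _), hP (e s) (G s *ᵥ _), hG (c s),
      dotProduct_comm (P s *ᵥ e s) (G s *ᵥ c s)]
    ring
  have := sub_le_mul_of_deriv_le (c := κ) hab hd fun s hs => by
    linarith [hκ s hs, two_mul_dotProduct_le (hGs s hs) (hG0 s hs) (c s) (P s *ᵥ e s)]
  linarith

/-- As long as `S ≥ s₁ > 0`, solutions cannot come below a small multiple of the identity. -/
theorem SolvesRiccatiOn.lt_quadForm (h : SolvesRiccatiOn A G S P a b)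
    (hPs : ∀ s ∈ Set.Icc a b, (P s)ᵀ = P s) {α γ s₁ m : ℝ} (hm : 0 < m)
    (hA : ∀ s ∈ Set.Icc a b, ∀ z, eucl (A s *ᵥ z) ≤ α * eucl z)
    (hG : ∀ s ∈ Set.Icc a b, ∀ z, z ⬝ᵥ (G s *ᵥ z) ≤ γ * eucl z ^ 2)
    (hS : ∀ s ∈ Set.Icc a b, ∀ z, s₁ * eucl z ^ 2 ≤ z ⬝ᵥ (S s *ᵥ z))
    (hms : 2 * α * m + γ * m ^ 2 < s₁)
    (h0 : ∀ z, z ≠ 0 → m * eucl z ^ 2 < z ⬝ᵥ (P a *ᵥ z)) :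
    ∀ s ∈ Set.Icc a b, ∀ z, z ≠ 0 → m * eucl z ^ 2 < z ⬝ᵥ (P s *ᵥ z) := by
  have hPc := h.continuousOn
  -- Pairs of a time and a unit direction that violate the bound. Compactness provides a first
  -- violation time τ.
  set K : Set (ℝ × (n → ℝ)) := {p | p.1 ∈ Set.Icc a b ∧ eucl p.2 = 1 ∧
    p.2 ⬝ᵥ (P p.1 *ᵥ p.2) ≤ m} with hK
  have hsphere : IsCompact {z : n → ℝ | eucl z = 1} := by
    refine Metric.isCompact_of_isClosed_isBounded
      (isClosed_singleton.preimage continuous_eucl) ?_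
    refine isBounded_iff_forall_norm_le.2 ⟨1, fun z hz => ?_⟩
    exact (norm_le_eucl z).trans (le_of_eq hz)
  have hKc : IsCompact K := by
    have hc : IsCompact (Set.Icc a b ×ˢ {z : n → ℝ | eucl z = 1}) := isCompact_Icc.prod hsphere
    have hcont : ContinuousOn (fun p : ℝ × (n → ℝ) => p.2 ⬝ᵥ (P p.1 *ᵥ p.2))
        (Set.Icc a b ×ˢ {z : n → ℝ | eucl z = 1}) := by
      have h1 : ContinuousOn (fun p : ℝ × (n → ℝ) => P p.1)
          (Set.Icc a b ×ˢ {z : n → ℝ | eucl z = 1}) :=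
        hPc.comp continuousOn_fst fun p hp => hp.1
      have h2 := h1.matrix_mulVec (v := fun p : ℝ × (n → ℝ) => p.2) continuousOn_snd
      rw [continuousOn_iff_continuous_domRestrict] at h2 ⊢
      exact (continuous_snd.comp continuous_subtype_val).dotProduct h2
    have := hcont.preimage_isClosed_of_isClosed hc.isClosed (isClosed_Iic (a := m))
    convert hc.of_isClosed_subset this Set.inter_subset_left using 1
    ext p
    simp [hK, and_assoc]
  by_contra! hcon
  obtain ⟨s, hs, z, hz, hle⟩ := hcon
  have hne : (Prod.fst '' K).Nonempty := by
    refine ⟨s, (s, (eucl z)⁻¹ • z), ⟨hs, ?_, ?_⟩, rfl⟩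
    · have := eucl_pos hz
      rw [eucl_smul, abs_of_pos (inv_pos.2 this), inv_mul_cancel₀ this.ne']
    · have := eucl_pos hz
      simp only [Matrix.mulVec_smul, smul_dotProduct, dotProduct_smul, smul_eq_mul]
      rw [← mul_assoc, ← sq, inv_pow, inv_mul_le_iff₀ (by positivity)]
      linarith
  obtain ⟨τ, ⟨⟨_, z₁⟩, ⟨hτ, hz₁, hzm⟩, rfl⟩, hmin⟩ := (hKc.image continuous_fst).exists_isLeast hne
  simp only at hτ hz₁ hzm hmin
  rename_i τ
  have hz₁0 : z₁ ≠ 0 := by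
    rintro rfl
    simp at hz₁
  have haτ : a < τ := by
    rcases hτ.1.eq_or_lt with h1 | h1
    · have := h0 z₁ hz₁0
      rw [hz₁, h1] at this
      linarith
    · exact h1
  have hbefore : ∀ r ∈ Set.Ico a τ, ∀ w, m * eucl w ^ 2 ≤ w ⬝ᵥ (P r *ᵥ w) := fun r hr w => by
    by_contra! hlt
    have hw : w ≠ 0 := by
      rintro rfl
      simp at hlt
    have hp := eucl_pos hw
    have : r ∈ Prod.fst '' K := by
      refine ⟨(r, (eucl w)⁻¹ • w), ⟨⟨hr.1, hr.2.le.trans hτ.2⟩, ?_, ?_⟩, rfl⟩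
      · rw [eucl_smul, abs_of_pos (inv_pos.2 hp), inv_mul_cancel₀ hp.ne']
      · simp only [Matrix.mulVec_smul, smul_dotProduct, dotProduct_smul, smul_eq_mul]
        rw [← mul_assoc, ← sq, inv_pow, inv_mul_le_iff₀ (by positivity)]
        linarith
    exact absurd (hmin this) (not_le.2 hr.2)
  have hsub : Set.Icc a τ ⊆ Set.Icc a b := Set.Icc_subset_Icc_right hτ.2
  have hnb : (nhdsWithin τ (Set.Ico a τ)).NeBot := by
    rw [← mem_closure_iff_nhdsWithin_neBot, closure_Ico haτ.ne]
    exact Set.right_mem_Icc.2 haτ.le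
  have hat : ∀ w, m * eucl w ^ 2 ≤ w ⬝ᵥ (P τ *ᵥ w) := fun w => by
    have h1 : Filter.Tendsto (fun r => w ⬝ᵥ (P r *ᵥ w)) (nhdsWithin τ (Set.Ico a τ))
        (nhds (w ⬝ᵥ (P τ *ᵥ w))) :=
      (((h τ hτ).quadForm w).continuousWithinAt.mono
        (Set.Ico_subset_Icc_self.trans hsub)).tendsto
    exact ge_of_tendsto h1 (eventually_nhdsWithin_of_forall fun r hr => hbefore r hr w)
  have heq : z₁ ⬝ᵥ (P τ *ᵥ z₁) = m := le_antisymm hzm (by simpa [hz₁] using hat z₁)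
  -- At first contact P(τ) - m is positive semidefinite and its form vanishes at z₁, so z₁ lies in
  -- its kernel.
  have hker : P τ *ᵥ z₁ = m • z₁ := by
    classical
    have hpsd : (P τ - m • (1 : Matrix n n ℝ)).PosSemidef := succeq_of_mul_sq_le (hPs τ hτ) hat
    have := (hpsd.dotProduct_mulVec_zero_iff z₁).1 (by
      rw [star_trivial, Matrix.sub_mulVec, dotProduct_sub, quadForm_smul_one, heq, hz₁]
      ring)
    rw [Matrix.sub_mulVec, Matrix.smul_mulVec, Matrix.one_mulVec] at this
    exact sub_eq_zero.1 this
  -- On the eigenvector z₁ the right-hand side is at least s₁ - 2αm - γm², which is positive by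
  -- `hms`. The form, however, reaches its value m from above, so its left derivative cannot be
  -- positive.
  have hder : 0 < z₁ ⬝ᵥ ((A τ * P τ + P τ * (A τ)ᵀ - P τ * G τ * P τ + S τ) *ᵥ z₁) := by
    have hP : ∀ w, z₁ ⬝ᵥ (P τ *ᵥ w) = m * (z₁ ⬝ᵥ w) := fun w => by
      rw [← hPs τ hτ, dotProduct_transpose_mulVec, hker, smul_dotProduct, smul_eq_mul]
    simp only [Matrix.add_mulVec, Matrix.sub_mulVec, ← Matrix.mulVec_mulVec,
      dotProduct_add, dotProduct_sub, hP, hker, Matrix.mulVec_smul, dotProduct_smul, smul_eq_mul]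
    rw [dotProduct_transpose_mulVec, dotProduct_comm (A τ *ᵥ z₁)]
    have h1 := abs_dotProduct_le_eucl z₁ (A τ *ᵥ z₁)
    have h2 := hA τ hτ z₁
    have h3 := hG τ hτ z₁
    have h4 := hS τ hτ z₁
    rw [hz₁] at h1 h2 h3 h4
    have h5 := neg_le_of_abs_le h1
    nlinarith [mul_le_mul_of_nonneg_left h3 (sq_nonneg m)]
  have hdw : HasDerivWithinAt (fun r => z₁ ⬝ᵥ (P r *ᵥ z₁)) _ (Set.Ico a τ) τ :=
    ((h τ hτ).quadForm z₁).mono (Set.Ico_subset_Icc_self.trans hsub)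
  have hlim := hasDerivWithinAt_iff_tendsto_slope.1 hdw
  have hdiff : Set.Ico a τ \ {τ} = Set.Ico a τ := by
    ext r
    simp only [Set.mem_sdiff, Set.mem_Ico, Set.mem_singleton_iff]
    constructor
    · exact fun h => h.1
    · exact fun h => ⟨h, h.2.ne⟩
  rw [hdiff] at hlim
  have hle0 := le_of_tendsto hlim (b := 0) (eventually_nhdsWithin_of_forall fun r hr => by
    rw [slope_def_field]
    refine div_nonpos_of_nonneg_of_nonpos ?_ (sub_nonpos.2 hr.2.le)
    have := hbefore r hr z₁
    rw [hz₁] at this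
    linarith)
  linarith

/-- Growth bound for solutions of the Riccati equation. -/
theorem SolvesRiccatiOn.quadForm_le_growth [DecidableEq n] (h : SolvesRiccatiOn A G S P a b)
    (hab : a ≤ b) {F : ℝ → Matrix n n ℝ} {α s₂ p : ℝ} (hα : 0 ≤ α) (hs₂ : 0 ≤ s₂) (hp : 0 ≤ p)
    (hPs : ∀ s ∈ Set.Icc a b, (P s)ᵀ = P s) (hGs : ∀ s ∈ Set.Icc a b, (G s)ᵀ = G s)
    (hG0 : ∀ s ∈ Set.Icc a b, ∀ z, 0 ≤ z ⬝ᵥ (G s *ᵥ z))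
    (hS : ∀ s ∈ Set.Icc a b, ∀ z, z ⬝ᵥ (S s *ᵥ z) ≤ s₂ * eucl z ^ 2)
    (hA : ∀ s ∈ Set.Icc a b, ∀ z, eucl (A s *ᵥ z) ≤ α * eucl z)
    (hF : ∀ s ∈ Set.Icc a b, MatHasDerivWithinAt F (A s * F s) (Set.Icc a b) s) (h0 : F a = 1)
    (hP0 : ∀ z, z ⬝ᵥ (P a *ᵥ z) ≤ p * eucl z ^ 2) (z : n → ℝ) :
    z ⬝ᵥ (P b *ᵥ z) ≤ (p + s₂ * Real.exp (α * (b - a)) ^ 2 * (b - a))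
      * Real.exp (α * (b - a)) ^ 2 * eucl z ^ 2 := by
  set E := Real.exp (α * (b - a)) with hE
  have hb := Set.right_mem_Icc.2 hab
  have hdet := fun s hs => isUnit_det_flow hα hA hF h0 (s := s) hs
  -- Chosen so that the test vector carried by the adjoint flow, with control c = 0, arrives at z at
  -- time b.
  set q := (F b)ᵀ *ᵥ z with hq
  have hqz : eucl q ≤ E * eucl z :=
    eucl_transpose_mulVec_le (Real.exp_pos _).le (fun w => (eucl_flow_le hα hA hF h0 hb w).1) z
  have key := h.quadForm_le hab hPs hGs hG0 (e := fun s => ((F s)⁻¹)ᵀ *ᵥ q) (c := fun _ => 0)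
    (κ := s₂ * (E * eucl q) ^ 2)
    (fun s hs => by
      refine ((flow_inv_transpose_deriv (hF s hs) (hdet s hs)).mulVec
        (hasDerivWithinAt_const s _ q)).congr_deriv ?_
      simp [Matrix.neg_mulVec, Matrix.mulVec_mulVec])
    (fun s hs => by
      simp only [Matrix.mulVec_zero, dotProduct_zero, zero_add]
      refine (hS s hs _).trans (mul_le_mul_of_nonneg_left ?_ hs₂)
      exact pow_le_pow_left₀ (eucl_nonneg _) (eucl_flow_inv_transpose_le hα hA hF h0 hs q) 2)
  have e1 : ((F b)⁻¹)ᵀ *ᵥ q = z := by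
    rw [hq, Matrix.mulVec_mulVec, ← Matrix.transpose_mul, Matrix.mul_nonsing_inv _ (hdet b hb),
      Matrix.transpose_one, Matrix.one_mulVec]
  simp only [e1, h0, inv_one, Matrix.transpose_one, Matrix.one_mulVec] at key
  refine key.trans ?_
  have hq2 : eucl q ^ 2 ≤ E ^ 2 * eucl z ^ 2 := by
    rw [← mul_pow]
    exact pow_le_pow_left₀ (eucl_nonneg _) hqz 2
  have hba : 0 ≤ b - a := sub_nonneg.2 hab
  calc _ ≤ p * eucl q ^ 2 + s₂ * (E * eucl q) ^ 2 * (b - a) := by linarith [hP0 q]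
    _ = (p + s₂ * E ^ 2 * (b - a)) * eucl q ^ 2 := by ring
    _ ≤ (p + s₂ * E ^ 2 * (b - a)) * (E ^ 2 * eucl z ^ 2) :=
      mul_le_mul_of_nonneg_left hq2 (by positivity)
    _ = _ := by ring

theorem matIntegral_hasDerivWithinAt {m : Type} {M : ℝ → Matrix m m ℝ}
    (hM : ContinuousOn M (Set.Icc a b)) {s : ℝ} (hs : s ∈ Set.Icc a b) :
    MatHasDerivWithinAt (fun r => matIntegral M a r) (M s) (Set.Icc a b) s := by
  intro i j
  have : Fact (s ∈ Set.Icc a b) := ⟨hs⟩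
  have hc := hM.matrix_elem i j
  refine intervalIntegral.integral_hasDerivWithinAt_right
    ((hc.mono (Set.Icc_subset_Icc_right hs.2)).intervalIntegrable_of_Icc hs.1)
    (hc.stronglyMeasurableAtFilter_nhdsWithin measurableSet_Icc s) (hc s hs)

/-- A lower bound of the observability Gramian gives a bound for solutions of the Riccati equation
that does not depend on their initial value. -/
theorem SolvesRiccatiOn.quadForm_le_of_gramian [DecidableEq n] (h : SolvesRiccatiOn A G S P a b)
    (hab : a ≤ b) {F : ℝ → Matrix n n ℝ} {α γ s₂ w : ℝ} (hα : 0 ≤ α) (hγ : 0 ≤ γ) (hs₂ : 0 ≤ s₂)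
    (hw : 0 < w)
    (hPs : ∀ s ∈ Set.Icc a b, (P s)ᵀ = P s) (hGs : ∀ s ∈ Set.Icc a b, (G s)ᵀ = G s)
    (hGc : ContinuousOn G (Set.Icc a b))
    (hG0 : ∀ s ∈ Set.Icc a b, ∀ z, 0 ≤ z ⬝ᵥ (G s *ᵥ z))
    (hG : ∀ s ∈ Set.Icc a b, ∀ z, z ⬝ᵥ (G s *ᵥ z) ≤ γ * eucl z ^ 2)
    (hS : ∀ s ∈ Set.Icc a b, ∀ z, z ⬝ᵥ (S s *ᵥ z) ≤ s₂ * eucl z ^ 2)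
    (hA : ∀ s ∈ Set.Icc a b, ∀ z, eucl (A s *ᵥ z) ≤ α * eucl z)
    (hF : ∀ s ∈ Set.Icc a b, MatHasDerivWithinAt F (A s * F s) (Set.Icc a b) s) (h0 : F a = 1)
    (hW : ∀ q, w * eucl q ^ 2 ≤
      q ⬝ᵥ (matIntegral (fun s => (F s)ᵀ * G s * F s) a b *ᵥ q)) (z : n → ℝ) :
    z ⬝ᵥ (P b *ᵥ z) ≤ (γ * Real.exp (α * (b - a)) ^ 2 + s₂ * (Real.exp (α * (b - a))
      * (γ * Real.exp (α * (b - a)) ^ 2 * (b - a) + 1)) ^ 2)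
      * (b - a) * (Real.exp (α * (b - a)) / w) ^ 2 * eucl z ^ 2 := by
  set E := Real.exp (α * (b - a)) with hE
  have hba : 0 ≤ b - a := sub_nonneg.2 hab
  have hE0 : 0 < E := Real.exp_pos _
  have hb := Set.right_mem_Icc.2 hab
  have hdet := fun s hs => isUnit_det_flow hα hA hF h0 (s := s) hs
  have hFc : ContinuousOn F (Set.Icc a b) := fun s hs => (hF s hs).continuousWithinAt
  set W := fun s => matIntegral (fun s => (F s)ᵀ * G s * F s) a s with hWdef
  have hWd : ∀ s ∈ Set.Icc a b, MatHasDerivWithinAt W ((F s)ᵀ * G s * F s) (Set.Icc a b) s :=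
    fun s hs => matIntegral_hasDerivWithinAt
      ((hFc.matrix_transpose.matrix_mul hGc).matrix_mul hFc) hs
  have hWa : W a = 0 := by
    ext i j
    simp [W, matIntegral]
  have hWs : ∀ s ∈ Set.Icc a b, (W s)ᵀ = W s := fun s hs => by
    ext i j
    simp only [W, matIntegral, Matrix.transpose_apply, Matrix.of_apply]
    refine intervalIntegral.integral_congr fun r hr => ?_
    rw [Set.uIcc_of_le hs.1] at hr
    have : ((F r)ᵀ * G r * F r)ᵀ = (F r)ᵀ * G r * F r := by
      simp only [Matrix.transpose_mul, Matrix.transpose_transpose,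
        hGs r ⟨hr.1, hr.2.trans hs.2⟩, Matrix.mul_assoc]
    exact congrFun (congrFun this i) j
  have hGt : ∀ s ∈ Set.Icc a b, ∀ v, v ⬝ᵥ (((F s)ᵀ * G s * F s) *ᵥ v)
      = (F s *ᵥ v) ⬝ᵥ (G s *ᵥ (F s *ᵥ v)) := fun s hs v => by
    rw [← Matrix.mulVec_mulVec, ← Matrix.mulVec_mulVec, dotProduct_transpose_mulVec]
  have hGF : ∀ s ∈ Set.Icc a b, ∀ v, (F s *ᵥ v) ⬝ᵥ (G s *ᵥ (F s *ᵥ v))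
      ≤ γ * E ^ 2 * eucl v ^ 2 := fun s hs v => by
    refine (hG s hs _).trans ?_
    rw [mul_assoc, ← mul_pow]
    exact mul_le_mul_of_nonneg_left
      (pow_le_pow_left₀ (eucl_nonneg _) (eucl_flow_le hα hA hF h0 hs v).1 2) hγ
  -- An upper bound for W; the summand 1 only keeps it strictly positive, as `eucl_mulVec_sq_le`
  -- requires.
  set ω := γ * E ^ 2 * (b - a) + 1 with hω
  have hω0 : 0 < ω := by positivity
  have hWle : ∀ s ∈ Set.Icc a b, ∀ v, v ⬝ᵥ (W s *ᵥ v) ≤ ω * eucl v ^ 2 := fun s hs v => by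
    have hsub : Set.Icc a s ⊆ Set.Icc a b := Set.Icc_subset_Icc_right hs.2
    have h1 := sub_le_mul_of_deriv_le (c := γ * E ^ 2 * eucl v ^ 2) hs.1
      (fun r hr => ((hWd r (hsub hr)).quadForm v).mono hsub)
      (fun r hr => by rw [hGt r (hsub hr)]; exact hGF r (hsub hr) v)
    simp only [hWa, Matrix.zero_mulVec, dotProduct_zero, sub_zero] at h1
    refine h1.trans ?_
    have h2 : γ * E ^ 2 * eucl v ^ 2 * (s - a) ≤ γ * E ^ 2 * eucl v ^ 2 * (b - a) :=
      mul_le_mul_of_nonneg_left (by linarith [hs.2]) (by positivity)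
    have h3 := sq_nonneg (eucl v)
    rw [hω]
    nlinarith
  have hW0 : ∀ s ∈ Set.Icc a b, ∀ v, 0 ≤ v ⬝ᵥ (W s *ᵥ v) := fun s hs v => by
    have hsub : Set.Icc a s ⊆ Set.Icc a b := Set.Icc_subset_Icc_right hs.2
    have h1 := sub_le_mul_of_deriv_le (c := 0) hs.1
      (fun r hr => (((hWd r (hsub hr)).quadForm v).mono hsub).neg)
      (fun r hr => by
        rw [hGt r (hsub hr)]
        exact neg_nonpos.2 (hG0 r (hsub hr) _))
    simp only [hWa, Matrix.zero_mulVec, dotProduct_zero, Pi.neg_apply] at h1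
    linarith
  have hWn : ∀ s ∈ Set.Icc a b, ∀ v, eucl (W s *ᵥ v) ≤ ω * eucl v := fun s hs v => by
    refine abs_le_of_sq_le_sq' ?_ (mul_nonneg hω0.le (eucl_nonneg v)) |>.2
    have h1 := eucl_mulVec_sq_le hω0 (hWs s hs) (hW0 s hs) (hWle s hs) v
    have h2 := mul_le_mul_of_nonneg_left (hWle s hs v) hω0.le
    calc _ ≤ _ := h1.trans h2
      _ = _ := by ring
  have hWdet : IsUnit (W b).det := isUnit_det_of_quadForm_pos fun v hv =>
    lt_of_lt_of_le (mul_pos hw (pow_pos (eucl_pos hv) 2)) (hW v)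
  -- With the control c = Fq, the test vector (F⁻¹)ᵀWq vanishes at time a because W(a) = 0, and
  -- equals z at time b. This is why P(a) drops out of the bound.
  set q := (W b)⁻¹ *ᵥ ((F b)ᵀ *ᵥ z) with hq
  have hWq : W b *ᵥ q = (F b)ᵀ *ᵥ z := by
    rw [hq, Matrix.mulVec_mulVec, Matrix.mul_nonsing_inv _ hWdet, Matrix.one_mulVec]
  have hqz : eucl q ≤ E / w * eucl z := by
    have h1 : eucl ((F b)ᵀ *ᵥ z) ≤ E * eucl z :=
      eucl_transpose_mulVec_le hE0.le (fun w => (eucl_flow_le hα hA hF h0 hb w).1) z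
    have h2 := hW q
    have h3 : q ⬝ᵥ (W b *ᵥ q) ≤ eucl q * (E * eucl z) := by
      rw [hWq]
      exact (dotProduct_le_eucl _ _).trans (mul_le_mul_of_nonneg_left h1 (eucl_nonneg q))
    have h4 : w * eucl q ^ 2 ≤ eucl q * (E * eucl z) := h2.trans h3
    rw [div_mul_eq_mul_div, le_div_iff₀ hw]
    rcases (eucl_nonneg q).eq_or_lt with h5 | h5
    · rw [← h5, zero_mul]
      exact mul_nonneg hE0.le (eucl_nonneg z)
    · nlinarith
  have key := h.quadForm_le hab hPs hGs hG0 (e := fun s => ((F s)⁻¹)ᵀ *ᵥ (W s *ᵥ q))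
    (c := fun s => F s *ᵥ q)
    (κ := γ * E ^ 2 * eucl q ^ 2 + s₂ * (E * (ω * eucl q)) ^ 2)
    (fun s hs => by
      refine ((flow_inv_transpose_deriv (hF s hs) (hdet s hs)).mulVec
        ((hWd s hs).mulVec (hasDerivWithinAt_const s _ q))).congr_deriv ?_
      have e2 : ((F s)⁻¹)ᵀ * ((F s)ᵀ * G s * F s) = G s * F s := by
        rw [Matrix.mul_assoc, ← Matrix.mul_assoc, ← Matrix.transpose_mul,
          Matrix.mul_nonsing_inv _ (hdet s hs), Matrix.transpose_one, Matrix.one_mul]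
      simp only [Matrix.neg_mulVec, Matrix.mulVec_zero, add_zero]
      rw [Matrix.mulVec_mulVec (M := ((F s)⁻¹)ᵀ) (v := q), e2]
      simp only [Matrix.mulVec_mulVec, Matrix.mul_assoc])
    (fun s hs => by
      refine add_le_add (hGF s hs q) ((hS s hs _).trans (mul_le_mul_of_nonneg_left ?_ hs₂))
      refine pow_le_pow_left₀ (eucl_nonneg _) ?_ 2
      exact (eucl_flow_inv_transpose_le hα hA hF h0 hs _).trans
        (mul_le_mul_of_nonneg_left (hWn s hs q) hE0.le))
  have e1 : ((F b)⁻¹)ᵀ *ᵥ (W b *ᵥ q) = z := by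
    rw [hWq, Matrix.mulVec_mulVec, ← Matrix.transpose_mul, Matrix.mul_nonsing_inv _ (hdet b hb),
      Matrix.transpose_one, Matrix.one_mulVec]
  simp only [e1, hWa, Matrix.zero_mulVec, Matrix.mulVec_zero, dotProduct_zero, zero_add] at key
  have hq2 : eucl q ^ 2 ≤ (E / w) ^ 2 * eucl z ^ 2 := by
    rw [← mul_pow]
    exact pow_le_pow_left₀ (eucl_nonneg _) hqz 2
  calc _ ≤ _ := key
    _ = (γ * E ^ 2 + s₂ * (E * ω) ^ 2) * (b - a) * eucl q ^ 2 := by ring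
    _ ≤ (γ * E ^ 2 + s₂ * (E * ω) ^ 2) * (b - a) * ((E / w) ^ 2 * eucl z ^ 2) :=
      mul_le_mul_of_nonneg_left hq2 (by positivity)
    _ = _ := by ring

/-- The Lyapunov function `xᵀ P⁻¹ x` decays exponentially along the error dynamics. -/
theorem SolvesRiccatiOn.error_le [DecidableEq n] (h : SolvesRiccatiOn A G S P a b) (hab : a ≤ b)
    {x r : ℝ → n → ℝ} {s₁ p₁ p₂ p₃ l : ℝ} (hp₁ : 0 < p₁) (hp₃ : 0 < p₃)
    (hp₂ : 0 < p₂) (hl : 4 * l * p₂ ≤ s₁)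
    (hs₁ : 0 ≤ s₁)
    (hPs : ∀ s ∈ Set.Icc a b, (P s)ᵀ = P s)
    (hG0 : ∀ s ∈ Set.Icc a b, ∀ z, 0 ≤ z ⬝ᵥ (G s *ᵥ z))
    (hS : ∀ s ∈ Set.Icc a b, ∀ z, s₁ * eucl z ^ 2 ≤ z ⬝ᵥ (S s *ᵥ z))
    (hP₁ : ∀ s ∈ Set.Icc a b, ∀ z, p₁ * eucl z ^ 2 ≤ z ⬝ᵥ (P s *ᵥ z))
    (hP₂ : ∀ s ∈ Set.Icc a b, ∀ z, z ⬝ᵥ (P s *ᵥ z) ≤ p₂ * eucl z ^ 2)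
    (hP₃ : ∀ z, p₃ * eucl z ^ 2 ≤ z ⬝ᵥ (P a *ᵥ z))
    (hx : ∀ s ∈ Set.Icc a b, HasDerivWithinAt x
      (A s *ᵥ x s - P s *ᵥ (G s *ᵥ x s) + r s) (Set.Icc a b) s)
    (hr : ∀ s ∈ Set.Icc a b, 4 * p₂ * eucl (r s) ≤ s₁ * eucl (x s)) :
    eucl (x b) ≤ Real.sqrt (p₂ / p₃) * Real.exp (-l * (b - a)) * eucl (x a) := by
  have hdet : ∀ s ∈ Set.Icc a b, IsUnit (P s).det := fun s hs =>
    isUnit_det_of_quadForm_pos fun v hv =>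
      lt_of_lt_of_le (mul_pos hp₁ (pow_pos (eucl_pos hv) 2)) (hP₁ s hs v)
  set η := fun s => (P s)⁻¹ *ᵥ x s with hη
  have hPη : ∀ s ∈ Set.Icc a b, P s *ᵥ η s = x s := fun s hs => by
    rw [hη, Matrix.mulVec_mulVec, Matrix.mul_nonsing_inv _ (hdet s hs), Matrix.one_mulVec]
  have hinvs : ∀ s ∈ Set.Icc a b, ((P s)⁻¹)ᵀ = (P s)⁻¹ := fun s hs => by
    rw [Matrix.transpose_nonsing_inv, hPs s hs]
  have hP0 : ∀ s ∈ Set.Icc a b, ∀ z, 0 ≤ z ⬝ᵥ (P s *ᵥ z) := fun s hs z =>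
    (mul_nonneg hp₁.le (sq_nonneg _)).trans (hP₁ s hs z)
  -- The terms with A cancel. The innovation contributes -2xᵀGx, and the derivative of P⁻¹ returns
  -- one xᵀGx together with -ηᵀSη.
  have hd : ∀ s ∈ Set.Icc a b, HasDerivWithinAt (fun s => x s ⬝ᵥ η s)
      (-(x s ⬝ᵥ (G s *ᵥ x s)) - η s ⬝ᵥ (S s *ᵥ η s) + 2 * (η s ⬝ᵥ r s)) (Set.Icc a b) s :=
    fun s hs => by
      refine ((hx s hs).dotProduct (((h s hs).inv (hdet s hs)).mulVec (hx s hs))).congr_deriv ?_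
      have hinv : ∀ v, x s ⬝ᵥ ((P s)⁻¹ *ᵥ v) = η s ⬝ᵥ v := fun v => by
        rw [← hinvs s hs, dotProduct_transpose_mulVec]
      have hPd : ∀ v, η s ⬝ᵥ (P s *ᵥ v) = x s ⬝ᵥ v := fun v => by
        conv_lhs => rw [← hPs s hs]
        rw [dotProduct_transpose_mulVec, hPη s hs]
      have hη' : (P s)⁻¹ *ᵥ x s = η s := rfl
      simp only [Matrix.neg_mulVec, ← Matrix.mulVec_mulVec, dotProduct_neg, dotProduct_add, hinv,
        hη', Matrix.add_mulVec, Matrix.sub_mulVec, dotProduct_sub, hPη s hs, hPd,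
        dotProduct_transpose_mulVec, add_dotProduct, sub_dotProduct]
      rw [dotProduct_comm (A s *ᵥ x s), dotProduct_comm (P s *ᵥ _), hPd, dotProduct_comm (r s)]
      ring
  have hV : ∀ s ∈ Set.Icc a b, x s ⬝ᵥ η s = η s ⬝ᵥ (P s *ᵥ η s) := fun s hs => by
    rw [hPη s hs, dotProduct_comm]
  -- Since |x| ≤ p₂|η|, the remainder costs at most half of s₁|η|². The other half dominates 2l
  -- times the Lyapunov function, by the choice of l.
  have hdecay := le_exp_mul_of_deriv_le (K := -(2 * l)) hab hd fun s hs => by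
    have h1 : eucl (x s) ≤ p₂ * eucl (η s) := by
      refine abs_le_of_sq_le_sq' ?_ (mul_nonneg hp₂.le (eucl_nonneg _)) |>.2
      have := eucl_mulVec_sq_le hp₂ (hPs s hs) (hP0 s hs) (hP₂ s hs) (η s)
      rw [hPη s hs] at this
      have h3 := mul_le_mul_of_nonneg_left (hP₂ s hs (η s)) hp₂.le
      rw [hPη s hs] at h3
      nlinarith
    have h2 : 4 * eucl (r s) ≤ s₁ * eucl (η s) := by
      have := (hr s hs).trans (mul_le_mul_of_nonneg_left h1 hs₁)
      refine le_of_mul_le_mul_left (a := p₂) ?_ hp₂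
      linarith
    have h3 : η s ⬝ᵥ r s ≤ eucl (η s) * eucl (r s) := dotProduct_le_eucl _ _
    have h4 := mul_le_mul_of_nonneg_left h2 (eucl_nonneg (η s))
    have h5 := hS s hs (η s)
    have h6 := hP₂ s hs (η s)
    have h7 := hG0 s hs (x s)
    rw [hV s hs]
    have h8 := hP0 s hs (η s)
    have h9 : 2 * l * (η s ⬝ᵥ (P s *ᵥ η s)) ≤ s₁ / 2 * eucl (η s) ^ 2 := by
      rcases le_or_gt l 0 with hl0 | hl0
      · have : 2 * l * (η s ⬝ᵥ (P s *ᵥ η s)) ≤ 0 :=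
          mul_nonpos_of_nonpos_of_nonneg (by linarith) h8
        exact this.trans (by positivity)
      · have := mul_le_mul_of_nonneg_left h6 (by linarith : 0 ≤ 2 * l)
        have h10 := mul_le_mul_of_nonneg_right hl (sq_nonneg (eucl (η s)))
        nlinarith
    nlinarith
  have ha := Set.left_mem_Icc.2 hab
  have hb := Set.right_mem_Icc.2 hab
  have hxb : eucl (x b) ^ 2 ≤ p₂ * (x b ⬝ᵥ η b) := by
    have := eucl_mulVec_sq_le hp₂ (hPs b hb) (hP0 b hb) (hP₂ b hb) (η b)
    rwa [← hV b hb, hPη b hb] at this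
  -- Only the initial lower bound p₃ enters the gain; p₁ serves for invertibility and nonnegativity
  -- of P along the interval.
  have hxa : p₃ * (x a ⬝ᵥ η a) ≤ eucl (x a) ^ 2 := by
    have h1 := hP₃ (η a)
    rw [← hV a ha] at h1
    have h2 := dotProduct_le_eucl (x a) (η a)
    have h3 : p₃ * eucl (η a) ≤ eucl (x a) := by
      rcases (eucl_nonneg (η a)).eq_or_lt with h5 | h5
      · rw [← h5, mul_zero]
        exact eucl_nonneg _
      · nlinarith
    nlinarith [mul_le_mul_of_nonneg_right h3 (eucl_nonneg (x a))]
  refine abs_le_of_sq_le_sq' ?_ (by have := eucl_nonneg (x a); positivity) |>.2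
  rw [mul_pow, mul_pow, Real.sq_sqrt (by positivity), ← Real.exp_nat_mul]
  have e1 : ((2 : ℕ) : ℝ) * (-l * (b - a)) = -(2 * l) * (b - a) := by
    push_cast
    ring
  rw [e1]
  have h1 := mul_le_mul_of_nonneg_left hdecay hp₂.le
  have h2 : x a ⬝ᵥ η a ≤ eucl (x a) ^ 2 / p₃ := by
    rw [le_div_iff₀ hp₃]
    linarith
  calc _ ≤ _ := hxb.trans h1
    _ ≤ p₂ * (Real.exp (-(2 * l) * (b - a)) * (eucl (x a) ^ 2 / p₃)) := by gcongr
    _ = _ := by ring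

end Riccati

/-! ### Global solutions of differential equations -/

section GlobalExistence

open Set Metric NNReal

variable {E : Type} [NormedAddCommGroup E] [NormedSpace ℝ E] {f : ℝ → E → E}

/-- `z` solves `z' = f(t, z)` on `J`. -/
def SolvesOn (f : ℝ → E → E) (J : Set ℝ) (z : ℝ → E) : Prop :=
  ∀ t ∈ J, HasDerivWithinAt z (f t (z t)) J t

theorem SolvesOn.mono {J K : Set ℝ} {z : ℝ → E} (h : SolvesOn f J z) (hK : K ⊆ J) :
    SolvesOn f K z := fun t ht => (h t (hK ht)).mono hK

theorem hasDerivWithinAt_of_notMem_closure {z : ℝ → E} {z' : E} {J : Set ℝ} {t : ℝ}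
    (h : t ∉ closure J) : HasDerivWithinAt z z' J t :=
  HasFDerivWithinAt.of_notMem_closure h

theorem SolvesOn.glue {a b c : ℝ} {z w : ℝ → E} (hab : a ≤ b) (hbc : b ≤ c)
    (hz : SolvesOn f (Icc a b) z) (hw : SolvesOn f (Icc b c) w) (h : w b = z b) :
    SolvesOn f (Icc a c) (fun t => if t ≤ b then z t else w t) := by
  set y := fun t => if t ≤ b then z t else w t with hy
  have h1 : ∀ t ∈ Icc a b, y t = z t := fun t ht => if_pos ht.2
  have h2 : ∀ t ∈ Icc b c, y t = w t := fun t ht => by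
    rcases ht.1.eq_or_lt with rfl | hlt
    · rw [h1 b (right_mem_Icc.2 hab), h]
    · exact if_neg (not_le.2 hlt)
  intro t ht
  rw [← Icc_union_Icc_eq_Icc hab hbc]
  rcases lt_trichotomy t b with hlt | rfl | hlt
  · have htm : t ∈ Icc a b := ⟨ht.1, hlt.le⟩
    refine HasDerivWithinAt.union (((hz t htm).congr h1 (h1 t htm)).congr_deriv (by rw [h1 t htm]))
      (hasDerivWithinAt_of_notMem_closure ?_)
    rw [isClosed_Icc.closure_eq]
    exact fun hm => absurd hm.1 (not_le.2 hlt)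
  · have htm : t ∈ Icc a t := right_mem_Icc.2 hab
    have htm' : t ∈ Icc t c := left_mem_Icc.2 hbc
    exact HasDerivWithinAt.union
      (((hz t htm).congr h1 (h1 t htm)).congr_deriv (by rw [h1 t htm]))
      (((hw t htm').congr h2 (h2 t htm')).congr_deriv (by rw [h2 t htm']))
  · have htm : t ∈ Icc b c := ⟨hlt.le, ht.2⟩
    refine HasDerivWithinAt.union (hasDerivWithinAt_of_notMem_closure ?_)
      (((hw t htm).congr h2 (h2 t htm)).congr_deriv (by rw [h2 t htm]))
    rw [isClosed_Icc.closure_eq]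
    exact fun hm => absurd hm.2 (not_le.2 hlt)

/-- On the ball of radius |M| + 1 and up to time T + 1 the field has a common Lipschitz constant and
a common bound, so the Picard-Lindelöf step depends neither on the initial time nor on the initial
value. -/
theorem exists_uniform_step [CompleteSpace E] {t₀ : ℝ}
    (hcont : ∀ z, ContinuousOn (fun t => f t z) (Ici t₀))
    (hlip : ∀ T r : ℝ, ∃ K : ℝ≥0, ∀ t ∈ Icc t₀ T, LipschitzOnWith K (f t) (closedBall 0 r))
    (M T : ℝ) :
    ∃ h : ℝ, 0 < h ∧ ∀ t₁ ∈ Icc t₀ T, ∀ z₁, ‖z₁‖ ≤ M →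
      ∃ w, w t₁ = z₁ ∧ SolvesOn f (Icc t₁ (t₁ + h)) w := by
  obtain ⟨K, hK⟩ := hlip (T + 1) (|M| + 1)
  obtain ⟨C, hC⟩ := isCompact_Icc.exists_bound_of_continuousOn
    ((hcont 0).mono (Icc_subset_Ici_self : Icc t₀ (T + 1) ⊆ Ici t₀))
  set L : ℝ := |C| + K * (|M| + 1) with hL
  have hL0 : 0 ≤ L := by positivity
  -- The first term keeps the interval below T + 1; the second keeps the solution within distance 1
  -- of z₁ at speed L.
  refine ⟨min 1 (1 / (L + 1)), by positivity, fun t₁ ht₁ z₁ hz₁ => ?_⟩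
  set h := min 1 (1 / (L + 1)) with hh
  have hh0 : 0 < h := by positivity
  have hball : closedBall z₁ (1 : ℝ≥0) ⊆ closedBall (0 : E) (|M| + 1) := by
    intro z hz
    rw [mem_closedBall_iff_norm] at hz ⊢
    have := norm_add_le (z - z₁) z₁
    rw [sub_add_cancel] at this
    rw [sub_zero]
    have h2 := hz₁.trans (le_abs_self M)
    have h3 : ‖z - z₁‖ ≤ 1 := hz
    linarith
  have hsub : Icc t₁ (t₁ + h) ⊆ Icc t₀ (T + 1) :=
    Icc_subset_Icc ht₁.1 (add_le_add ht₁.2 (min_le_left _ _))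
  have hPL : IsPicardLindelof f (tmin := t₁) (tmax := t₁ + h)
      ⟨t₁, left_mem_Icc.2 (by linarith)⟩ z₁ 1 0 ⟨L, hL0⟩ K := by
    refine ⟨fun t ht => (hK t (hsub ht)).mono hball, fun z _ => (hcont z).mono
      (hsub.trans Icc_subset_Ici_self), fun t ht z hz => ?_, ?_⟩
    · have h1 := (hK t (hsub ht)).dist_le_mul z (hball hz) 0
        (mem_closedBall_self (by positivity))
      rw [dist_eq_norm, dist_zero_right] at h1
      have h2 := hC t (hsub ht)
      have h3 := mem_closedBall_zero_iff.1 (hball hz)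
      have h4 := norm_add_le (f t z - f t 0) (f t 0)
      rw [sub_add_cancel] at h4
      have h5 : (K : ℝ) * ‖z‖ ≤ K * (|M| + 1) := by gcongr
      change ‖f t z‖ ≤ L
      linarith [le_abs_self C]
    · simp only [add_sub_cancel_left, sub_self, max_eq_left hh0.le]
      change L * h ≤ 1 - 0
      have : L * h ≤ L * (1 / (L + 1)) := mul_le_mul_of_nonneg_left (min_le_right _ _) hL0
      refine this.trans ?_
      rw [sub_zero, mul_one_div, div_le_one (by linarith)]
      linarith
  exact hPL.exists_eq_forall_mem_Icc_hasDerivWithinAt₀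

/-- The a priori bound holds at the end of each partial solution, so the same step length can be
used again, and finitely many steps reach T. -/
theorem exists_solvesOn_Icc [CompleteSpace E] {t₀ M : ℝ} {z₀ : E}
    (hcont : ∀ z, ContinuousOn (fun t => f t z) (Ici t₀))
    (hlip : ∀ T r : ℝ, ∃ K : ℝ≥0, ∀ t ∈ Icc t₀ T, LipschitzOnWith K (f t) (closedBall 0 r))
    (hbound : ∀ T, t₀ ≤ T → ∀ z, z t₀ = z₀ → SolvesOn f (Icc t₀ T) z →
      ∀ t ∈ Icc t₀ T, ‖z t‖ ≤ M) {T : ℝ} (hT : t₀ ≤ T) :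
    ∃ z, z t₀ = z₀ ∧ SolvesOn f (Icc t₀ T) z := by
  obtain ⟨h, hh, hstep⟩ := exists_uniform_step hcont hlip M T
  have key : ∀ k : ℕ, ∃ z, z t₀ = z₀ ∧ SolvesOn f (Icc t₀ (min T (t₀ + k * h))) z := by
    intro k
    induction k with
    | zero =>
      refine ⟨fun _ => z₀, rfl, fun t ht => ?_⟩
      have : t = t₀ := by simpa [hT] using ht
      subst this
      simp only [CharP.cast_eq_zero, zero_mul, add_zero, min_eq_right hT, Icc_self]
      exact HasFDerivWithinAt.of_finite (finite_singleton t)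
    | succ k ih =>
      obtain ⟨z, hz0, hz⟩ := ih
      set t₁ := min T (t₀ + k * h) with ht₁
      have h01 : t₀ ≤ t₁ := le_min hT (by have := mul_nonneg k.cast_nonneg hh.le; linarith)
      obtain ⟨w, hw1, hw⟩ := hstep t₁ ⟨h01, min_le_left _ _⟩ (z t₁)
        (hbound t₁ h01 z hz0 hz t₁ (right_mem_Icc.2 h01))
      refine ⟨_, ?_, (hz.glue h01 (by linarith) hw hw1).mono (Icc_subset_Icc_right ?_)⟩
      · simp [h01, hz0]
      · rw [ht₁, ← min_add_add_right]
        refine le_min ((min_le_left _ _).trans (by linarith)) ((min_le_right _ _).trans ?_)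
        push_cast
        linarith
  obtain ⟨k, hk⟩ := exists_nat_ge ((T - t₀) / h)
  obtain ⟨z, hz0, hz⟩ := key k
  rw [div_le_iff₀ hh] at hk
  rw [min_eq_left (by linarith)] at hz
  exact ⟨z, hz0, hz⟩

/-- Solutions which are bounded a priori exist for all time. -/
theorem exists_solvesOn_Ici [CompleteSpace E] {t₀ M : ℝ} {z₀ : E}
    (hcont : ∀ z, ContinuousOn (fun t => f t z) (Ici t₀))
    (hlip : ∀ T r : ℝ, ∃ K : ℝ≥0, ∀ t ∈ Icc t₀ T, LipschitzOnWith K (f t) (closedBall 0 r))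
    (hbound : ∀ T, t₀ ≤ T → ∀ z, z t₀ = z₀ → SolvesOn f (Icc t₀ T) z →
      ∀ t ∈ Icc t₀ T, ‖z t‖ ≤ M) :
    ∃ z, z t₀ = z₀ ∧ SolvesOn f (Ici t₀) z := by
  have hex : ∀ k : ℕ, ∃ z, z t₀ = z₀ ∧ SolvesOn f (Icc t₀ (t₀ + k)) z := fun k =>
    exists_solvesOn_Icc hcont hlip hbound (by linarith [k.cast_nonneg (α := ℝ)])
  choose z hz0 hz using hex
  -- The a priori bound confines both solutions to one ball, on which the field is Lipschitz, so
  -- uniqueness applies.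
  have huniq : ∀ i j : ℕ, i ≤ j → EqOn (z i) (z j) (Icc t₀ (t₀ + i)) := fun i j hij => by
    have hsub : Icc t₀ (t₀ + (i : ℝ)) ⊆ Icc t₀ (t₀ + j) :=
      Icc_subset_Icc_right (by have : (i : ℝ) ≤ j := by exact_mod_cast hij
                               linarith)
    have hj := (hz j).mono hsub
    obtain ⟨K, hK⟩ := hlip (t₀ + i) M
    have hi0 : t₀ ≤ t₀ + (i : ℝ) := by linarith [i.cast_nonneg (α := ℝ)]
    exact ODE_solution_unique_of_mem_Icc_right (s := fun _ => closedBall 0 M)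
      (fun t ht => hK t (Ico_subset_Icc_self ht))
      (fun t ht => (hz i t ht).continuousWithinAt)
      (fun t ht => (hz i t (Ico_subset_Icc_self ht)).mono_of_mem_nhdsWithin
        (Icc_mem_nhdsGE_of_mem ht))
      (fun t ht => mem_closedBall_zero_iff.2
        (hbound _ hi0 _ (hz0 i) (hz i) t (Ico_subset_Icc_self ht)))
      (fun t ht => (hj t ht).continuousWithinAt)
      (fun t ht => (hj t (Ico_subset_Icc_self ht)).mono_of_mem_nhdsWithin
        (Icc_mem_nhdsGE_of_mem ht))
      (fun t ht => mem_closedBall_zero_iff.2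
        (hbound _ hi0 _ (hz0 j) hj t (Ico_subset_Icc_self ht)))
      ((hz0 i).trans (hz0 j).symm)
  -- Each time is evaluated on the shortest of the intervals that contain it; by uniqueness any
  -- longer one gives the same value.
  set y : ℝ → E := fun t => z ⌈t - t₀⌉₊ t with hy
  have hyz : ∀ k : ℕ, ∀ t ∈ Icc t₀ (t₀ + k), y t = z k t := fun k t ht =>
    huniq _ k (Nat.ceil_le.2 (by linarith [ht.2])) ⟨ht.1, by linarith [Nat.le_ceil (t - t₀)]⟩
  refine ⟨y, ?_, fun t ht => ?_⟩
  · simp [hy, hz0]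
  · obtain ⟨k, hk⟩ := exists_nat_gt (t - t₀)
    have htm : t ∈ Icc t₀ (t₀ + k) := ⟨ht, by linarith⟩
    have h1 : HasDerivWithinAt y (f t (y t)) (Icc t₀ (t₀ + k)) t :=
      ((hz k t htm).congr (hyz k) (hyz k t htm)).congr_deriv (by rw [hyz k t htm])
    refine h1.mono_of_mem_nhdsWithin ?_
    have : Icc t₀ (t₀ + (k : ℝ)) = Ici t₀ ∩ Iic (t₀ + k) := rfl
    rw [this]
    exact Filter.inter_mem self_mem_nhdsWithin
      (mem_nhdsWithin_of_mem_nhds (Iic_mem_nhds (by linarith)))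

end GlobalExistence

/-! ### Rotations, cross products and projections -/

section Geometry

theorem rot_transpose_mul {Q : M3} (hQ : Q ∈ Matrix.specialOrthogonalGroup (Fin 3) ℝ) :
    Qᵀ * Q = 1 := by
  have := (Matrix.mem_specialOrthogonalGroup_iff.1 hQ).1
  rw [Matrix.mem_orthogonalGroup_iff'] at this
  simpa [Matrix.star_eq_conjTranspose, Matrix.conjTranspose_eq_transpose_of_trivial] using this

theorem rot_mul_transpose {Q : M3} (hQ : Q ∈ Matrix.specialOrthogonalGroup (Fin 3) ℝ) :
    Q * Qᵀ = 1 :=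
  mul_eq_one_comm.1 (rot_transpose_mul hQ)

theorem eucl_mulVec_of_transpose_mul {n : Type} [Fintype n] [DecidableEq n] {Q : Matrix n n ℝ}
    (hQ : Qᵀ * Q = 1) (z : n → ℝ) : eucl (Q *ᵥ z) = eucl z := by
  have h : eucl (Q *ᵥ z) ^ 2 = eucl z ^ 2 := by
    rw [eucl_sq, eucl_sq, ← dotProduct_transpose_mulVec, Matrix.mulVec_mulVec, hQ,
      Matrix.one_mulVec]
  exact (sq_eq_sq₀ (eucl_nonneg _) (eucl_nonneg _)).1 h

theorem eucl_rot_mulVec {Q : M3} (hQ : Q ∈ Matrix.specialOrthogonalGroup (Fin 3) ℝ) (z : V3) :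
    eucl (Q *ᵥ z) = eucl z :=
  eucl_mulVec_of_transpose_mul (rot_transpose_mul hQ) z

theorem eucl_rot_transpose_mulVec {Q : M3} (hQ : Q ∈ Matrix.specialOrthogonalGroup (Fin 3) ℝ)
    (z : V3) : eucl (Qᵀ *ᵥ z) = eucl z :=
  eucl_mulVec_of_transpose_mul (by rw [Matrix.transpose_transpose, rot_mul_transpose hQ]) z

/-- For every 3 × 3 matrix Qᵀ(Qv × Qw) = (det Q)(v × w), as a polynomial identity; orthogonality and
det Q = 1 finish. -/
theorem rot_cross {Q : M3} (hQ : Q ∈ Matrix.specialOrthogonalGroup (Fin 3) ℝ) (v w : V3) :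
    (Q *ᵥ v) ⨯₃ (Q *ᵥ w) = Q *ᵥ (v ⨯₃ w) := by
  have h : Qᵀ *ᵥ ((Q *ᵥ v) ⨯₃ (Q *ᵥ w)) = Q.det • (v ⨯₃ w) := by
    rw [Matrix.det_fin_three]
    ext i
    fin_cases i <;>
    · simp [crossProduct, Matrix.mulVec, dotProduct, Fin.sum_univ_three]
      ring
  rw [(Matrix.mem_specialOrthogonalGroup_iff.1 hQ).2, one_smul] at h
  rw [← h, Matrix.mulVec_mulVec, rot_mul_transpose hQ, Matrix.one_mulVec]

theorem skew_mulVec (w z : V3) : skew w *ᵥ z = w ⨯₃ z := by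
  ext i
  fin_cases i <;>
  · simp [skew, crossProduct, Matrix.mulVec, dotProduct, Fin.sum_univ_three]
    ring

theorem skew_transpose (w : V3) : (skew w)ᵀ = -skew w := by
  ext i j
  fin_cases i <;> fin_cases j <;> simp [skew]

theorem eucl_skew_mulVec_le (w z : V3) : eucl (skew w *ᵥ z) ≤ eucl w * eucl z := by
  refine abs_le_of_sq_le_sq' ?_ (mul_nonneg (eucl_nonneg w) (eucl_nonneg z)) |>.2
  rw [mul_pow, eucl_sq, eucl_sq, eucl_sq]
  have : (skew w *ᵥ z) ⬝ᵥ (skew w *ᵥ z) = (w ⬝ᵥ w) * (z ⬝ᵥ z) - (w ⬝ᵥ z) ^ 2 := by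
    simp [skew, Matrix.mulVec, dotProduct, Fin.sum_univ_three]
    ring
  rw [this]
  linarith [sq_nonneg (w ⬝ᵥ z)]

theorem eucl_e3 : eucl e3 = 1 := by
  have : eucl e3 ^ 2 = 1 ^ 2 := by
    rw [eucl_sq]
    simp [e3, dotProduct, Fin.sum_univ_three]
  exact (sq_eq_sq₀ (eucl_nonneg _) zero_le_one).1 this

theorem eucl_skew_e3_le (w : V3) : eucl (skew w *ᵥ e3) ≤ eucl w := by
  simpa [eucl_e3] using eucl_skew_mulVec_le w e3

theorem proj_mulVec (y z : V3) : proj y *ᵥ z = z - (y ⬝ᵥ z) • y := by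
  rw [proj, Matrix.sub_mulVec, Matrix.one_mulVec, Matrix.vecMulVec_mulVec]
  simp

theorem eucl_proj_mulVec_sq {y : V3} (hy : eucl y = 1) (z : V3) :
    eucl (proj y *ᵥ z) ^ 2 = z ⬝ᵥ (proj y *ᵥ z) := by
  have h : y ⬝ᵥ y = 1 := by rw [← eucl_sq, hy, one_pow]
  rw [eucl_sq, proj_mulVec]
  simp only [sub_dotProduct, dotProduct_sub, smul_dotProduct, dotProduct_smul, smul_eq_mul, h]
  rw [dotProduct_comm z y]
  ring

theorem eucl_proj_mulVec_le {y : V3} (hy : eucl y = 1) (z : V3) :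
    eucl (proj y *ᵥ z) ≤ eucl z := by
  refine abs_le_of_sq_le_sq' ?_ (eucl_nonneg z) |>.2
  rw [eucl_proj_mulVec_sq hy, proj_mulVec, eucl_sq]
  simp only [dotProduct_sub, dotProduct_smul, smul_eq_mul]
  rw [dotProduct_comm z y]
  linarith [mul_self_nonneg (y ⬝ᵥ z)]

/-- This is Q π_y Qᵀ = π_{Qy}. It moves the output from the body frame to the inertial frame, where
excitation is assumed. -/
theorem proj_rot_mulVec {Q : M3} (hQ : Q ∈ Matrix.specialOrthogonalGroup (Fin 3) ℝ) (y z : V3) :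
    eucl (proj y *ᵥ (Qᵀ *ᵥ z)) = eucl (proj (Q *ᵥ y) *ᵥ z) := by
  rw [← eucl_rot_mulVec hQ (proj y *ᵥ _), proj_mulVec, proj_mulVec, Matrix.mulVec_sub,
    Matrix.mulVec_mulVec, rot_mul_transpose hQ, Matrix.one_mulVec, Matrix.mulVec_smul,
    dotProduct_transpose_mulVec]

theorem ContinuousOn.proj {J : Set ℝ} {y : ℝ → V3} (hy : ContinuousOn y J) :
    ContinuousOn (fun s => proj (y s)) J := by
  refine continuousOn_pi.2 fun i => continuousOn_pi.2 fun j => ?_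
  simp only [_root_.proj, Matrix.sub_apply, Matrix.vecMulVec_apply]
  exact continuousOn_const.sub ((continuousOn_pi.1 hy i).mul (continuousOn_pi.1 hy j))

end Geometry

/-! ### Rigid motions -/

section Motion

variable {g : ℝ} {QB QT : ℝ → M3} {pB vB ωB aB pT vT ωT aT : ℝ → V3}

theorem IsRigidMotion.continuousOn_rot (h : IsRigidMotion g QB pB vB ωB aB) :
    ContinuousOn QB (Set.Ici 0) := fun t ht => (h.att t ht).continuousWithinAt

theorem IsRigidMotion.continuousOn_pos (h : IsRigidMotion g QB pB vB ωB aB) :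
    ContinuousOn pB (Set.Ici 0) := fun t ht => (h.pos t ht).continuousWithinAt

theorem eucl_bearing (hB : IsRigidMotion g QB pB vB ωB aB)
    (hsep : ∀ t, 0 ≤ t → pB t ≠ pT t) {t : ℝ} (ht : 0 ≤ t) : eucl (bearing QB pB pT t) = 1 := by
  have h : 0 < eucl (relPos QB pB pT t) := by
    rw [relPos, eucl_rot_transpose_mulVec (hB.rot t ht)]
    exact eucl_pos (sub_ne_zero.2 (hsep t ht))
  rw [bearing, eucl_smul, abs_of_pos (inv_pos.2 h), inv_mul_cancel₀ h.ne']

theorem eucl_bearingI (hB : IsRigidMotion g QB pB vB ωB aB)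
    (hsep : ∀ t, 0 ≤ t → pB t ≠ pT t) {t : ℝ} (ht : 0 ≤ t) :
    eucl (bearingI QB pB pT t) = 1 := by
  rw [bearingI, eucl_rot_mulVec (hB.rot t ht), eucl_bearing hB hsep ht]

theorem continuousOn_bearing (hB : IsRigidMotion g QB pB vB ωB aB)
    (hT : IsRigidMotion g QT pT vT ωT aT)
    (hsep : ∀ t, 0 ≤ t → pB t ≠ pT t) : ContinuousOn (bearing QB pB pT) (Set.Ici 0) := by
  have h1 : ContinuousOn (relPos QB pB pT) (Set.Ici 0) :=
    hB.continuousOn_rot.matrix_transpose.matrix_mulVec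
      (hB.continuousOn_pos.sub hT.continuousOn_pos)
  refine ((continuous_eucl.comp_continuousOn h1).inv₀ fun t ht => ?_).smul h1
  change eucl ((QB t)ᵀ *ᵥ (pB t - pT t)) ≠ 0
  rw [eucl_rot_transpose_mulVec (hB.rot t ht)]
  exact (eucl_pos (sub_ne_zero.2 (hsep t ht))).ne'

theorem continuousOn_bearingI (hB : IsRigidMotion g QB pB vB ωB aB)
    (hT : IsRigidMotion g QT pT vT ωT aT)
    (hsep : ∀ t, 0 ≤ t → pB t ≠ pT t) : ContinuousOn (bearingI QB pB pT) (Set.Ici 0) :=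
  hB.continuousOn_rot.matrix_mulVec (continuousOn_bearing hB hT hsep)

theorem relAtt_mem (hB : IsRigidMotion g QB pB vB ωB aB)
    (hT : IsRigidMotion g QT pT vT ωT aT) {t : ℝ} (ht : 0 ≤ t) :
    relAtt QB QT t ∈ Matrix.specialOrthogonalGroup (Fin 3) ℝ := by
  refine mul_mem ?_ (hB.rot t ht)
  refine Matrix.mem_specialOrthogonalGroup_iff.2 ⟨?_, ?_⟩
  · rw [Matrix.mem_orthogonalGroup_iff', Matrix.transpose_transpose]
    exact rot_mul_transpose (hT.rot t ht)
  · rw [Matrix.det_transpose]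
    exact (Matrix.mem_specialOrthogonalGroup_iff.1 (hT.rot t ht)).2

theorem continuousOn_relAtt (hB : IsRigidMotion g QB pB vB ωB aB)
    (hT : IsRigidMotion g QT pT vT ωT aT) : ContinuousOn (relAtt QB QT) (Set.Ici 0) :=
  hT.continuousOn_rot.matrix_transpose.matrix_mul hB.continuousOn_rot

end Motion

/-! ### Quadratic forms of integrals -/

section Integrals

theorem quadForm_matIntegral {n : Type} [Fintype n] {M : ℝ → Matrix n n ℝ} {a b : ℝ} (hab : a ≤ b)
    (hM : ContinuousOn M (Set.Icc a b)) (q : n → ℝ) :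
    q ⬝ᵥ (matIntegral M a b *ᵥ q) = ∫ s in a..b, q ⬝ᵥ (M s *ᵥ q) := by
  have hi : ∀ i j, IntervalIntegrable (fun s => M s i j) MeasureTheory.volume a b := fun i j =>
    (hM.matrix_elem i j).intervalIntegrable_of_Icc hab
  simp only [dotProduct, Matrix.mulVec, matIntegral, Matrix.of_apply]
  rw [intervalIntegral.integral_finsetSum fun i _ =>
    (IntervalIntegrable.sum (f := fun j s => M s i j * q j) Finset.univ
      fun j _ => (hi i j).mul_const (q j)).const_mul (q i) |>.congr (fun s _ => by simp)]
  refine Finset.sum_congr rfl fun i _ => ?_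
  rw [intervalIntegral.integral_const_mul, intervalIntegral.integral_finsetSum fun j _ =>
    (hi i j).mul_const (q j)]
  simp only [intervalIntegral.integral_mul_const]

theorem BearingPE.le_integral {y : ℝ → V3} {δ μ : ℝ} (h : BearingPE y δ μ) (hδ : 0 < δ)
    (hy : ContinuousOn y (Set.Ici 0)) (hy1 : ∀ t, 0 ≤ t → eucl (y t) = 1) {t : ℝ} (ht : 0 ≤ t)
    (z : V3) : δ * μ * eucl z ^ 2 ≤ ∫ s in t..(t + δ), eucl (proj (y s) *ᵥ z) ^ 2 := by
  have h1 := (h t ht).mul_sq_le z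
  have htd : t ≤ t + δ := by linarith
  have hc : ContinuousOn (fun s => proj (y s)) (Set.Icc t (t + δ)) :=
    hy.proj.mono fun s hs => ht.trans hs.1
  rw [Matrix.smul_mulVec, dotProduct_smul, quadForm_matIntegral htd hc, smul_eq_mul, one_div,
    ← div_eq_inv_mul, le_div_iff₀ hδ] at h1
  have h2 : ∫ s in t..(t + δ), eucl (proj (y s) *ᵥ z) ^ 2
      = ∫ s in t..(t + δ), z ⬝ᵥ (proj (y s) *ᵥ z) := by
    refine intervalIntegral.integral_congr fun s hs => ?_
    rw [Set.uIcc_of_le htd] at hs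
    exact eucl_proj_mulVec_sq (hy1 s (ht.trans hs.1)) z
  rw [h2]
  linarith

/-- The mean value inequality for the Euclidean norm. -/
theorem eucl_sub_le_of_deriv {n : Type} [Fintype n] {x x' : ℝ → n → ℝ} {a b c : ℝ} (hab : a ≤ b)
    (hx : ∀ s ∈ Set.Icc a b, HasDerivWithinAt x (x' s) (Set.Icc a b) s)
    (hc : ∀ s ∈ Set.Icc a b, eucl (x' s) ≤ c) : eucl (x b - x a) ≤ c * (b - a) := by
  -- Testing the curve against its own increment reduces the claim to a scalar mean value
  -- inequality.
  set v := x b - x a with hv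
  have h1 := sub_le_mul_of_deriv_le (c := eucl v * c) hab
    (fun s hs => (hasDerivWithinAt_const s _ v).dotProduct (hx s hs)) fun s hs => by
      rw [zero_dotProduct, zero_add]
      exact (dotProduct_le_eucl _ _).trans (mul_le_mul_of_nonneg_left (hc s hs) (eucl_nonneg v))
  rw [← dotProduct_sub, ← hv, ← eucl_sq] at h1
  have hc0 : 0 ≤ c := (eucl_nonneg _).trans (hc a (Set.left_mem_Icc.2 hab))
  rcases (eucl_nonneg v).eq_or_lt with h0 | h0
  · rw [← h0]
    exact mul_nonneg hc0 (sub_nonneg.2 hab)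
  · nlinarith

end Integrals

/-! ### Curves with prescribed acceleration -/

section Curves

noncomputable section

/-- The velocity `∫_t^s b`. -/
def velInt (b : ℝ → V3) (t s : ℝ) : V3 := ∫ r in t..s, b r

/-- The position `∫_t^s ∫_t^r b`. -/
def posInt (b : ℝ → V3) (t s : ℝ) : V3 := ∫ r in t..s, velInt b t r

end

variable {b : ℝ → V3}

theorem hasDerivAt_velInt (hb : Continuous b) (t s : ℝ) : HasDerivAt (velInt b t) (b s) s :=
  intervalIntegral.integral_hasDerivAt_right (hb.intervalIntegrable _ _)
    hb.aestronglyMeasurable.stronglyMeasurableAtFilter hb.continuousAt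

theorem hasDerivAt_posInt (hb : Continuous b) (t s : ℝ) :
    HasDerivAt (posInt b t) (velInt b t s) s := by
  have hc : Continuous (velInt b t) :=
    continuous_iff_continuousAt.2 fun s => (hasDerivAt_velInt hb t s).continuousAt
  exact intervalIntegral.integral_hasDerivAt_right (hc.intervalIntegrable _ _)
    hc.aestronglyMeasurable.stronglyMeasurableAtFilter hc.continuousAt

@[simp] theorem velInt_self (t : ℝ) : velInt b t t = 0 := intervalIntegral.integral_same

@[simp] theorem posInt_self (t : ℝ) : posInt b t t = 0 := intervalIntegral.integral_same

theorem eucl_velInt_le (hb : Continuous b) {c : ℝ} (hc : ∀ s, eucl (b s) ≤ c) {t s : ℝ}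
    (hts : t ≤ s) : eucl (velInt b t s) ≤ c * (s - t) := by
  have := eucl_sub_le_of_deriv hts
    (fun r _ => (hasDerivAt_velInt hb t r).hasDerivWithinAt) (fun r _ => hc r)
  simpa using this

theorem eucl_posInt_le (hb : Continuous b) {c : ℝ} (hc : ∀ s, eucl (b s) ≤ c) {t s : ℝ}
    (hts : t ≤ s) : eucl (posInt b t s) ≤ c * (s - t) ^ 2 := by
  have hc0 : 0 ≤ c := (eucl_nonneg _).trans (hc 0)
  have := eucl_sub_le_of_deriv (c := c * (s - t)) hts
    (fun r _ => (hasDerivAt_posInt hb t r).hasDerivWithinAt)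
    (fun r hr => (eucl_velInt_le hb hc hr.1).trans
      (mul_le_mul_of_nonneg_left (by linarith [hr.2]) hc0))
  rw [posInt_self, sub_zero] at this
  linarith

/-- Second differences of a curve whose acceleration has a positive component along `b₀`. -/
theorem mul_sq_le_second_difference (hb : Continuous b) {b₀ : V3} {c₀ : ℝ}
    (hc₀ : ∀ s, c₀ ≤ b₀ ⬝ᵥ b s) {t h : ℝ} (hh : 0 ≤ h) :
    c₀ * h ^ 2 ≤ b₀ ⬝ᵥ (posInt b t (t + 2 * h) - (2 : ℝ) • posInt b t (t + h)) := by
  have hd1 : ∀ s, HasDerivAt (fun s => b₀ ⬝ᵥ velInt b t s) (b₀ ⬝ᵥ b s) s := fun s => by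
    have := (hasDerivWithinAt_const s Set.univ b₀).dotProduct
      (hasDerivAt_velInt hb t s).hasDerivWithinAt
    simpa [hasDerivWithinAt_univ] using this
  have hd2 : ∀ s, HasDerivAt (fun s => b₀ ⬝ᵥ posInt b t s) (b₀ ⬝ᵥ velInt b t s) s := fun s => by
    have := (hasDerivWithinAt_const s Set.univ b₀).dotProduct
      (hasDerivAt_posInt hb t s).hasDerivWithinAt
    simpa [hasDerivWithinAt_univ] using this
  have h1 : ∀ s, c₀ * h ≤ b₀ ⬝ᵥ velInt b t (s + h) - b₀ ⬝ᵥ velInt b t s := fun s => by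
    have := sub_le_mul_of_deriv_le (a := s) (b := s + h) (c := -c₀) (by linarith)
      (fun r _ => (hd1 r).neg.hasDerivWithinAt) (fun r _ => neg_le_neg (hc₀ r))
    simp only [Pi.neg_apply] at this
    linarith
  have hd3 : ∀ s, HasDerivAt (fun s => b₀ ⬝ᵥ posInt b t s - b₀ ⬝ᵥ posInt b t (s + h))
      (b₀ ⬝ᵥ velInt b t s - b₀ ⬝ᵥ velInt b t (s + h)) s := fun s =>
    (hd2 s).sub ((hd2 (s + h)).comp_add_const s h)
  have h2 := sub_le_mul_of_deriv_le (a := t) (b := t + h) (c := -(c₀ * h)) (by linarith)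
    (fun r _ => (hd3 r).hasDerivWithinAt) (fun r _ => by linarith [h1 r])
  rw [posInt_self, dotProduct_zero, show t + h + h = t + 2 * h by ring] at h2
  rw [dotProduct_sub, dotProduct_smul, smul_eq_mul]
  linarith

/-- The three values of a curve at equidistant times control its initial data. -/
theorem initial_data_le (hb : Continuous b) {b₀ : V3} {c₀ c : ℝ} (hc0 : 0 < c₀)
    (hc₀ : ∀ s, c₀ ≤ b₀ ⬝ᵥ b s) (hc : ∀ s, eucl (b s) ≤ c) {t h : ℝ} (hh : 0 < h)
    (X₀ V₀ : V3) (θ : ℝ) {X : ℝ → V3} (hX : ∀ s, X s = X₀ + (s - t) • V₀ + θ • posInt b t s) :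
    |θ| * h ^ 2 ≤ 2 * eucl b₀ / c₀ * (eucl (X t) + eucl (X (t + h)) + eucl (X (t + 2 * h))) ∧
    eucl V₀ * h ≤ (1 + 2 * eucl b₀ / c₀ * c)
      * (eucl (X t) + eucl (X (t + h)) + eucl (X (t + 2 * h))) := by
  have hcn : 0 ≤ c := (eucl_nonneg _).trans (hc 0)
  have hθ : |θ| * h ^ 2 ≤
      2 * eucl b₀ / c₀ * (eucl (X t) + eucl (X (t + h)) + eucl (X (t + 2 * h))) := by
    have h1 := mul_sq_le_second_difference hb hc₀ (t := t) hh.le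
    -- The affine part X₀ + (s - t)V₀ has zero second difference, so only the drift term remains.
    have h2 : θ • (posInt b t (t + 2 * h) - (2 : ℝ) • posInt b t (t + h))
        = X t - (2 : ℝ) • X (t + h) + X (t + 2 * h) := by
      rw [hX, hX, hX, posInt_self]
      module
    have h3 : |θ| * (c₀ * h ^ 2) ≤ |b₀ ⬝ᵥ (X t - (2 : ℝ) • X (t + h) + X (t + 2 * h))| := by
      rw [← h2, dotProduct_smul, smul_eq_mul, abs_mul]
      exact mul_le_mul_of_nonneg_left (h1.trans (le_abs_self _)) (abs_nonneg θ)
    have h4 := h3.trans (abs_dotProduct_le_eucl _ _)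
    have h5 : eucl (X t - (2 : ℝ) • X (t + h) + X (t + 2 * h))
        ≤ 2 * (eucl (X t) + eucl (X (t + h)) + eucl (X (t + 2 * h))) := by
      refine (eucl_add_le _ _).trans ?_
      have := eucl_sub_le (X t) ((2 : ℝ) • X (t + h))
      rw [eucl_smul, abs_two] at this
      linarith [eucl_nonneg (X t), eucl_nonneg (X (t + 2 * h))]
    have h6 := h4.trans (mul_le_mul_of_nonneg_left h5 (eucl_nonneg b₀))
    rw [div_mul_eq_mul_div, le_div_iff₀ hc0]
    linarith
  refine ⟨hθ, ?_⟩
  have h1 : h • V₀ = X (t + h) - X t - θ • posInt b t (t + h) := by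
    rw [hX, hX, posInt_self]
    module
  have h2 : h * eucl V₀ ≤ eucl (X (t + h)) + eucl (X t) + |θ| * (c * h ^ 2) := by
    have h0 : h * eucl V₀ = eucl (h • V₀) := by rw [eucl_smul, abs_of_pos hh]
    rw [h0, h1]
    refine (eucl_sub_le _ _).trans (add_le_add (eucl_sub_le _ _) ?_)
    rw [eucl_smul]
    have := eucl_posInt_le hb hc (t := t) (s := t + h) (by linarith)
    rw [add_sub_cancel_left] at this
    exact mul_le_mul_of_nonneg_left this (abs_nonneg θ)
  have h3 := mul_le_mul_of_nonneg_right hθ hcn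
  linarith [eucl_nonneg (X (t + 2 * h))]

theorem half_sq_sub_sq_le {n : Type} [Fintype n] (v w : n → ℝ) :
    eucl v ^ 2 / 2 - eucl (w - v) ^ 2 ≤ eucl w ^ 2 := by
  have h1 := eucl_sub_le w (w - v)
  rw [sub_sub_cancel] at h1
  have h2 := pow_le_pow_left₀ (eucl_nonneg v) h1 2
  nlinarith [sq_nonneg (eucl w - eucl (w - v))]

/-- Persistently exciting directions detect a slowly moving point. -/
theorem window_le {y : ℝ → V3} {δ μ : ℝ} (hδ : 0 < δ) (hPE : BearingPE y δ μ)
    (hy : ContinuousOn y (Set.Ici 0)) (hy1 : ∀ t, 0 ≤ t → eucl (y t) = 1) {X : ℝ → V3}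
    (hXc : Continuous X) {t v : ℝ} (ht : 0 ≤ t)
    (hX : ∀ s ∈ Set.Icc t (t + δ), eucl (X s - X t) ≤ v) :
    δ * μ / 2 * eucl (X t) ^ 2 - δ * v ^ 2 ≤ ∫ s in t..(t + δ), eucl (proj (y s) *ᵥ X s) ^ 2 := by
  have htd : t ≤ t + δ := by linarith
  have hyc : ContinuousOn (fun s => proj (y s)) (Set.Icc t (t + δ)) :=
    hy.proj.mono fun s hs => ht.trans hs.1
  have h1 := hPE.le_integral hδ hy hy1 ht (X t)
  have hi1 : IntervalIntegrable (fun s => eucl (proj (y s) *ᵥ X t) ^ 2) MeasureTheory.volume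
      t (t + δ) :=
    ((continuous_eucl.comp_continuousOn
      (hyc.matrix_mulVec continuousOn_const)).pow 2).intervalIntegrable_of_Icc htd
  have hi2 : IntervalIntegrable (fun s => eucl (proj (y s) *ᵥ X s) ^ 2) MeasureTheory.volume
      t (t + δ) :=
    ((continuous_eucl.comp_continuousOn
      (hyc.matrix_mulVec hXc.continuousOn)).pow 2).intervalIntegrable_of_Icc htd
  -- Excitation speaks of constant vectors. Freezing X at the start of the window costs at most v²,
  -- because projections are contractions.
  have h2 : ∫ s in t..(t + δ), (eucl (proj (y s) *ᵥ X t) ^ 2 / 2 - v ^ 2)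
      ≤ ∫ s in t..(t + δ), eucl (proj (y s) *ᵥ X s) ^ 2 := by
    refine intervalIntegral.integral_mono_on htd ((hi1.div_const 2).sub
      intervalIntegrable_const) hi2 fun s hs => ?_
    have h3 := half_sq_sub_sq_le (proj (y s) *ᵥ X t) (proj (y s) *ᵥ X s)
    rw [← Matrix.mulVec_sub] at h3
    have h4 := (eucl_proj_mulVec_le (hy1 s (ht.trans hs.1)) (X s - X t)).trans (hX s hs)
    have h5 := pow_le_pow_left₀ (eucl_nonneg _) h4 2
    linarith
  rw [intervalIntegral.integral_sub (hi1.div_const 2) intervalIntegrable_const,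
    intervalIntegral.integral_div, intervalIntegral.integral_const, smul_eq_mul] at h2
  linarith

theorem sum_sq_le_sq {x y z w : ℝ} (hx : 0 ≤ x) (hy : 0 ≤ y) (hz : 0 ≤ z) (h : x + y + z ≤ w) :
    x ^ 2 + y ^ 2 + z ^ 2 ≤ w ^ 2 := by
  have h4 := pow_le_pow_left₀ (by positivity) h 2
  nlinarith [mul_nonneg hx hy, mul_nonneg hx hz, mul_nonneg hy hz]

/-- If the speed `v` is small compared with the distances `n₀, n₁, n₂` at three times, the
lower bounds over three windows combine. -/
theorem mul_sq_le_of_windows {δ μ κ h v J n₀ n₁ n₂ : ℝ} (hδ : 0 < δ) (hμ : 0 < μ) (hh0 : 0 < h)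
    (hv0 : 0 ≤ v) (hvM : v * h ≤ κ * (n₀ + n₁ + n₂)) (hhμ : 36 * δ ^ 2 * κ ^ 2 ≤ μ * h ^ 2)
    (h0 : δ * μ / 2 * n₀ ^ 2 - δ * (v * δ) ^ 2 ≤ J)
    (h1 : δ * μ / 2 * n₁ ^ 2 - δ * (v * δ) ^ 2 ≤ J)
    (h2 : δ * μ / 2 * n₂ ^ 2 - δ * (v * δ) ^ 2 ≤ J) :
    δ * μ * (n₀ + n₁ + n₂) ^ 2 ≤ 36 * J := by
  have hMsq : (n₀ + n₁ + n₂) ^ 2 ≤ 3 * (n₀ ^ 2 + n₁ ^ 2 + n₂ ^ 2) := by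
    nlinarith [sq_nonneg (n₀ - n₁), sq_nonneg (n₀ - n₂), sq_nonneg (n₁ - n₂)]
  generalize n₀ + n₁ + n₂ = M at hvM hMsq ⊢
  -- Adding the three windows gives a gain of at least δμM²/6 against a loss of 3δ(vδ)². The factor
  -- 36 makes the loss at most half the gain, which leaves δμM²/12 ≤ 3J.
  have hvsq : 36 * (v * δ) ^ 2 ≤ μ * M ^ 2 := by
    have h3 := pow_le_pow_left₀ (by positivity) hvM 2
    have h4 : h ^ 2 * (36 * (v * δ) ^ 2) ≤ h ^ 2 * (μ * M ^ 2) := by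
      calc h ^ 2 * (36 * (v * δ) ^ 2) = 36 * δ ^ 2 * (v * h) ^ 2 := by ring
        _ ≤ 36 * δ ^ 2 * (κ * M) ^ 2 := mul_le_mul_of_nonneg_left h3 (by positivity)
        _ = 36 * δ ^ 2 * κ ^ 2 * M ^ 2 := by ring
        _ ≤ μ * h ^ 2 * M ^ 2 := mul_le_mul_of_nonneg_right hhμ (sq_nonneg M)
        _ = _ := by ring
    exact le_of_mul_le_mul_left h4 (by positivity)
  have h5 := mul_le_mul_of_nonneg_left hMsq (by positivity : 0 ≤ δ * μ)
  have h6 := mul_le_mul_of_nonneg_left hvsq hδ.le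
  linarith

/-- Uniform observability of a point with unknown initial position and velocity, and with an
acceleration that is known up to a factor, from persistently exciting bearings. -/
theorem exists_observability_constants {δ μ c₀ c : ℝ} (hδ : 0 < δ) (hμ : 0 < μ) (hc₀ : 0 < c₀)
    (hc : 0 ≤ c) (b₀ : V3) :
    ∃ δ' μ' : ℝ, 0 < δ' ∧ 0 < μ' ∧ ∀ y : ℝ → V3, BearingPE y δ μ → ContinuousOn y (Set.Ici 0) →
      (∀ t, 0 ≤ t → eucl (y t) = 1) → ∀ b : ℝ → V3, Continuous b → (∀ s, c₀ ≤ b₀ ⬝ᵥ b s) →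
      (∀ s, eucl (b s) ≤ c) → ∀ t, 0 ≤ t → ∀ (X₀ V₀ : V3) (θ : ℝ),
      δ' * μ' * (eucl X₀ ^ 2 + eucl V₀ ^ 2 + θ ^ 2) ≤
        ∫ s in t..(t + δ'),
          eucl (proj (y s) *ᵥ (X₀ + (s - t) • V₀ + θ • posInt b t s)) ^ 2 := by
  set B := 2 * eucl b₀ / c₀ with hB
  have hB0 : 0 ≤ B := div_nonneg (mul_nonneg zero_le_two (eucl_nonneg _)) hc₀.le
  set κ := 1 + 4 * B * c with hκ
  have hκ0 : 0 < κ := by positivity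
  have hsμ := Real.sqrt_pos.2 hμ
  -- The spacing exceeds 1, so that powers of h may be dropped from `initial_data_le`. It exceeds δ,
  -- so that the whole horizon 2h + δ is at most 3h. The last term makes the displacement over one
  -- window small against M; this is possible because κ does not involve h.
  set h := 1 + δ + 6 * δ * κ / Real.sqrt μ with hh
  have hh0 : 0 < h := by positivity
  have hh1 : 1 ≤ h := by
    have : 0 ≤ 6 * δ * κ / Real.sqrt μ := by positivity
    linarith
  have hhδ : δ ≤ h := by
    have : 0 ≤ 6 * δ * κ / Real.sqrt μ := by positivity
    linarith
  have hhμ : 36 * δ ^ 2 * κ ^ 2 ≤ μ * h ^ 2 := by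
    have h1 : 6 * δ * κ / Real.sqrt μ ≤ h := by linarith
    rw [div_le_iff₀ hsμ] at h1
    have h2 := pow_le_pow_left₀ (by positivity) h1 2
    rw [mul_pow h, Real.sq_sqrt hμ.le] at h2
    linarith
  have hδ' : 0 < 2 * h + δ := by linarith
  refine ⟨2 * h + δ, δ * μ / (36 * (2 * h + δ) * (1 + κ + B) ^ 2), hδ', by positivity, ?_⟩
  intro y hPE hy hy1 b hb hbc₀ hbc t ht X₀ V₀ θ
  set X : ℝ → V3 := fun s => X₀ + (s - t) • V₀ + θ • posInt b t s with hX
  have hXd : ∀ s, HasDerivAt X (V₀ + θ • velInt b t s) s := fun s => by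
    have h1 := ((hasDerivAt_id s).sub_const t).smul_const V₀
    rw [one_smul] at h1
    exact (h1.const_add X₀).add ((hasDerivAt_posInt hb t s).const_smul θ)
  have hXc : Continuous X := continuous_iff_continuousAt.2 fun s => (hXd s).continuousAt
  obtain ⟨hθ, hV⟩ := initial_data_le hb hc₀ hbc₀ hbc hh0 X₀ V₀ θ (X := X) fun s => rfl
  have hX₀ : X t = X₀ := by simp [hX]
  set M := eucl (X t) + eucl (X (t + h)) + eucl (X (t + 2 * h)) with hM
  have hn0 := eucl_nonneg (X t)
  have hn1 := eucl_nonneg (X (t + h))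
  have hn2 := eucl_nonneg (X (t + 2 * h))
  have hM0 : 0 ≤ M := by positivity
  -- A bound of the speed over the whole horizon. In κ = 1 + 4Bc, the part 1 + Bc accounts for V₀
  -- and 3Bc for the drift.
  set v := eucl V₀ + |θ| * (c * (3 * h)) with hv
  have hvM : v * h ≤ κ * M := by
    have := mul_le_mul_of_nonneg_left hθ hc
    have e : v * h = eucl V₀ * h + 3 * (c * (|θ| * h ^ 2)) := by
      rw [hv]
      ring
    rw [e, hκ]
    linarith
  have hv0 : 0 ≤ v := by
    have := eucl_nonneg V₀
    positivity
  have hXv : ∀ r s, t ≤ r → r ≤ s → s ≤ t + (2 * h + δ) → eucl (X s - X r) ≤ v * (s - r) :=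
    fun r s hr hrs hs => eucl_sub_le_of_deriv hrs (fun u _ => (hXd u).hasDerivWithinAt)
      fun u hu => by
        refine (eucl_add_le _ _).trans (add_le_add le_rfl ?_)
        rw [eucl_smul]
        refine mul_le_mul_of_nonneg_left ((eucl_velInt_le hb hbc (hr.trans hu.1)).trans ?_)
          (abs_nonneg θ)
        exact mul_le_mul_of_nonneg_left (by linarith [hu.2]) hc
  set J := ∫ s in t..(t + (2 * h + δ)), eucl (proj (y s) *ᵥ X s) ^ 2 with hJ
  have hyc : ContinuousOn (fun s => eucl (proj (y s) *ᵥ X s) ^ 2) (Set.Ici 0) :=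
    (continuous_eucl.comp_continuousOn (hy.proj.matrix_mulVec hXc.continuousOn)).pow 2
  have hwin : ∀ r, t ≤ r → r ≤ t + 2 * h →
      δ * μ / 2 * eucl (X r) ^ 2 - δ * (v * δ) ^ 2 ≤ J := fun r hr1 hr2 => by
    refine (window_le hδ hPE hy hy1 hXc (ht.trans hr1) fun s hs => ?_).trans ?_
    · exact (hXv r s hr1 hs.1 (by linarith [hs.2])).trans
        (mul_le_mul_of_nonneg_left (by linarith [hs.2]) hv0)
    · refine intervalIntegral.integral_mono_interval hr1 (by linarith) (by linarith)
        (Filter.Eventually.of_forall fun s => sq_nonneg _) ?_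
      exact (hyc.mono fun s hs => ht.trans hs.1).intervalIntegrable_of_Icc (by linarith)
  have h0 := hwin t le_rfl (by linarith)
  have h1 := hwin (t + h) (by linarith) (by linarith)
  have h2 := hwin (t + 2 * h) (by linarith) le_rfl
  have hJM : δ * μ * M ^ 2 ≤ 36 * J := mul_sq_le_of_windows hδ hμ hh0 hv0 hvM hhμ h0 h1 h2
  have hθM : |θ| ≤ B * M := by
    have : |θ| * 1 ≤ |θ| * h ^ 2 :=
      mul_le_mul_of_nonneg_left (one_le_pow₀ hh1) (abs_nonneg θ)
    linarith
  have hVM : eucl V₀ ≤ κ * M := by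
    have h3 : eucl V₀ * 1 ≤ eucl V₀ * h := mul_le_mul_of_nonneg_left hh1 (eucl_nonneg _)
    have h4 : (1 + B * c) * M ≤ κ * M :=
      mul_le_mul_of_nonneg_right (by rw [hκ]; linarith [mul_nonneg hB0 hc]) hM0
    linarith
  have hX0M : eucl X₀ ≤ M := by
    rw [← hX₀]
    linarith
  have hq : eucl X₀ ^ 2 + eucl V₀ ^ 2 + θ ^ 2 ≤ (1 + κ + B) ^ 2 * M ^ 2 := by
    rw [← sq_abs θ, ← mul_pow]
    exact sum_sq_le_sq (eucl_nonneg X₀) (eucl_nonneg V₀) (abs_nonneg θ) (by linarith)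
  have e1 : (2 * h + δ) * (δ * μ / (36 * (2 * h + δ) * (1 + κ + B) ^ 2))
      = δ * μ / (36 * (1 + κ + B) ^ 2) := by
    field_simp
  rw [e1]
  calc δ * μ / (36 * (1 + κ + B) ^ 2) * (eucl X₀ ^ 2 + eucl V₀ ^ 2 + θ ^ 2)
      ≤ δ * μ / (36 * (1 + κ + B) ^ 2) * ((1 + κ + B) ^ 2 * M ^ 2) :=
        mul_le_mul_of_nonneg_left hq (by positivity)
    _ = δ * μ * M ^ 2 / 36 := by field_simp
    _ ≤ J := by linarith

end Curves

/-! ### The error state and its matrices -/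

section ErrorState

theorem sumElim_posErr_velErr_yawErr (x : V7) :
    Sum.elim (Sum.elim (posErr x) (velErr x)) (fun _ => yawErr x) = x := by
  ext i
  rcases i with (i | i) | i
  · rfl
  · rfl
  · rw [Subsingleton.elim i 0]
    rfl

theorem eucl_const_sq (c : ℝ) : eucl (fun _ : Fin 1 => c) ^ 2 = c ^ 2 := by
  rw [eucl_sq]
  simp [dotProduct, sq]

theorem eucl_state_sq (x : V7) :
    eucl x ^ 2 = eucl (posErr x) ^ 2 + eucl (velErr x) ^ 2 + yawErr x ^ 2 := by
  conv_lhs => rw [← sumElim_posErr_velErr_yawErr x]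
  rw [eucl_sumElim_sq, eucl_sumElim_sq, eucl_const_sq]

theorem eucl_posErr_le (x : V7) : eucl (posErr x) ≤ eucl x :=
  abs_le_of_sq_le_sq' (by
    rw [eucl_state_sq x]
    linarith [sq_nonneg (eucl (velErr x)), sq_nonneg (yawErr x)]) (eucl_nonneg x) |>.2

theorem eucl_velErr_le (x : V7) : eucl (velErr x) ≤ eucl x :=
  abs_le_of_sq_le_sq' (by
    rw [eucl_state_sq x]
    linarith [sq_nonneg (eucl (posErr x)), sq_nonneg (yawErr x)]) (eucl_nonneg x) |>.2

theorem abs_yawErr_le (x : V7) : |yawErr x| ≤ eucl x := abs_apply_le_eucl x _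

theorem Ctheta_mulVec (y : V3) (x : V7) : Ctheta y *ᵥ x = proj y *ᵥ posErr x := by
  conv_lhs => rw [← sumElim_posErr_velErr_yawErr x]
  rw [Ctheta, Matrix.fromCols_mulVec_sumElim, Matrix.fromCols_mulVec_sumElim]
  simp

theorem Atheta_mulVec (ω : V3) (R : M3) (a : V3) (x : V7) :
    Atheta ω R a *ᵥ x = Sum.elim (Sum.elim (-(skew ω *ᵥ posErr x) + velErr x)
      (-(skew ω *ᵥ velErr x) + yawErr x • (Rᵀ *ᵥ (skew a *ᵥ e3)))) 0 := by
  conv_lhs => rw [← sumElim_posErr_velErr_yawErr x]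
  rw [Atheta, Matrix.fromBlocks_mulVec]
  simp only [Sum.elim_comp_inl, Sum.elim_comp_inr]
  rw [Matrix.fromBlocks_mulVec]
  ext i
  rcases i with (i | i) | i <;>
    simp [Matrix.mulVec, dotProduct, Matrix.neg_apply, mul_comm]

/-- The system matrix is bounded. -/
theorem eucl_Atheta_mulVec_le {ω a : V3} {R : M3}
    (hR : R ∈ Matrix.specialOrthogonalGroup (Fin 3) ℝ) {cω ca : ℝ} (hω : eucl ω ≤ cω)
    (ha : eucl a ≤ ca) (x : V7) :
    eucl (Atheta ω R a *ᵥ x) ≤ (2 * cω + 1 + ca) * eucl x := by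
  rw [Atheta_mulVec]
  refine (eucl_sumElim_le _ _).trans ?_
  rw [eucl_zero, add_zero]
  refine (eucl_sumElim_le _ _).trans ?_
  have h1 : eucl (-(skew ω *ᵥ posErr x) + velErr x) ≤ cω * eucl x + eucl x := by
    refine (eucl_add_le _ _).trans (add_le_add ?_ (eucl_velErr_le x))
    rw [eucl_neg]
    exact (eucl_skew_mulVec_le _ _).trans (mul_le_mul hω (eucl_posErr_le x) (eucl_nonneg _)
      ((eucl_nonneg _).trans hω))
  have h2 : eucl (-(skew ω *ᵥ velErr x) + yawErr x • (Rᵀ *ᵥ (skew a *ᵥ e3)))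
      ≤ cω * eucl x + eucl x * ca := by
    refine (eucl_add_le _ _).trans (add_le_add ?_ ?_)
    · rw [eucl_neg]
      exact (eucl_skew_mulVec_le _ _).trans (mul_le_mul hω (eucl_velErr_le x) (eucl_nonneg _)
        ((eucl_nonneg _).trans hω))
    · rw [eucl_smul, eucl_rot_transpose_mulVec hR]
      exact mul_le_mul (abs_yawErr_le x) ((eucl_skew_e3_le a).trans ha) (eucl_nonneg _)
        (eucl_nonneg _)
  linarith

theorem eucl_Ctheta_mulVec_le {y : V3} (hy : eucl y = 1) (x : V7) :
    eucl (Ctheta y *ᵥ x) ≤ eucl x := by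
  rw [Ctheta_mulVec]
  exact (eucl_proj_mulVec_le hy _).trans (eucl_posErr_le x)

theorem ContinuousOn.Ctheta {J : Set ℝ} {y : ℝ → V3} (hy : ContinuousOn y J) :
    ContinuousOn (fun s => Ctheta (y s)) J := by
  refine continuousOn_pi.2 fun i => continuousOn_pi.2 fun j => ?_
  rcases j with (j | j) | j
  · simpa [_root_.Ctheta] using hy.proj.matrix_elem i j
  · simpa [_root_.Ctheta] using continuousOn_const
  · simpa [_root_.Ctheta] using continuousOn_const

theorem ContinuousOn.skew {J : Set ℝ} {w : ℝ → V3} (hw : ContinuousOn w J) :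
    ContinuousOn (fun s => skew (w s)) J := by
  have hi := continuousOn_pi.1 hw
  refine continuousOn_pi.2 fun i => continuousOn_pi.2 fun j => ?_
  fin_cases i <;> fin_cases j <;> simp [_root_.skew] <;>
    first | exact continuousOn_const | exact hi _ | exact (hi _).neg

theorem ContinuousOn.Atheta {J : Set ℝ} {ω a : ℝ → V3} {R : ℝ → M3} (hω : ContinuousOn ω J)
    (hR : ContinuousOn R J) (ha : ContinuousOn a J) :
    ContinuousOn (fun s => Atheta (ω s) (R s) (a s)) J := by
  have hcol : ContinuousOn (fun s => (R s)ᵀ *ᵥ (_root_.skew (a s) *ᵥ e3)) J :=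
    hR.matrix_transpose.matrix_mulVec (ha.skew.matrix_mulVec continuousOn_const)
  refine continuousOn_pi.2 fun i => continuousOn_pi.2 fun j => ?_
  rcases i with (i | i) | i <;> rcases j with (j | j) | j <;>
    simp only [_root_.Atheta, Matrix.fromBlocks_apply₁₁, Matrix.fromBlocks_apply₁₂,
      Matrix.fromBlocks_apply₂₁, Matrix.fromBlocks_apply₂₂, Matrix.replicateCol_apply,
      Sum.elim_inl, Sum.elim_inr, Matrix.neg_apply, Matrix.zero_apply, Pi.zero_apply] <;>
    first
      | exact continuousOn_const
      | exact (hω.skew.matrix_elem _ _).neg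
      | exact continuousOn_pi.1 hcol _

end ErrorState

/-! ### The transition matrix -/

section Transition

noncomputable section

/-- The change of frame `diag(Q, Q, 1)`. -/
def frame (Q : M3) : M7 := Matrix.fromBlocks (Matrix.fromBlocks Q 0 0 Q) 0 0 1

/-- The transition matrix of the error system in the inertial frame. -/
def driftFlow (τ : ℝ) (p v : V3) : M7 :=
  Matrix.fromBlocks (Matrix.fromBlocks 1 (τ • 1) 0 1)
    (Matrix.replicateCol (Fin 1) (Sum.elim p v)) 0 1

/-- The generator of the error system in the inertial frame. -/
def driftGen (v b : V3) : M7 :=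
  Matrix.fromBlocks (Matrix.fromBlocks 0 1 0 0) (Matrix.replicateCol (Fin 1) (Sum.elim v b)) 0 0

/-- The transition matrix of the error system. -/
def thetaFlow (Q : ℝ → M3) (b : ℝ → V3) (s t : ℝ) : M7 :=
  (frame (Q s))ᵀ * driftFlow (s - t) (posInt b t s) (velInt b t s) * frame (Q t)

end

theorem replicateCol_sumElim_mul (M : Matrix (Fin 3 ⊕ Fin 3) (Fin 3 ⊕ Fin 3) ℝ)
    (v : Fin 3 ⊕ Fin 3 → ℝ) :
    M * Matrix.replicateCol (Fin 1) v = Matrix.replicateCol (Fin 1) (M *ᵥ v) := by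
  ext i j
  simp [Matrix.mul_apply, Matrix.mulVec, dotProduct]

theorem frame_mul_transpose {Q : M3} (hQ : Q * Qᵀ = 1) : frame Q * (frame Q)ᵀ = 1 := by
  simp [frame, Matrix.fromBlocks_transpose, Matrix.fromBlocks_multiply, hQ,
    Matrix.fromBlocks_one]

/-- The generator proper has v = 0; the entry v in `driftGen` is what the derivative of `driftFlow`
produces. The identity is thus the differential equation of the drift flow. -/
theorem driftGen_mul_driftFlow (b : V3) (τ : ℝ) (p v : V3) :
    driftGen 0 b * driftFlow τ p v = driftGen v b := by
  rw [driftGen, driftFlow, Matrix.fromBlocks_multiply, replicateCol_sumElim_mul,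
    Matrix.fromBlocks_multiply, Matrix.fromBlocks_mulVec, driftGen]
  simp only [Matrix.zero_mul, Matrix.mul_zero, Matrix.mul_one, zero_add, add_zero,
    Matrix.one_mulVec, Matrix.zero_mulVec, Sum.elim_comp_inr]
  congr 1
  ext i j
  rcases i with i | i <;> simp

/-- The rotational part is the one generated by the moving frame itself; what remains is the
inertial generator seen from the body frame. -/
theorem Atheta_eq (ω a : V3) (R : M3) {Q : M3} (hQ : Qᵀ * Q = 1) :
    Atheta ω R a = -Matrix.fromBlocks (Matrix.fromBlocks (skew ω) 0 0 (skew ω)) 0 0 0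
      + (frame Q)ᵀ * driftGen 0 (Q *ᵥ (Rᵀ *ᵥ (skew a *ᵥ e3))) * frame Q := by
  rw [frame, driftGen, Matrix.fromBlocks_transpose, Matrix.fromBlocks_multiply,
    replicateCol_sumElim_mul, Matrix.fromBlocks_multiply, Matrix.fromBlocks_transpose,
    Matrix.fromBlocks_mulVec, Matrix.fromBlocks_multiply, Atheta]
  simp only [Matrix.zero_mul, Matrix.mul_zero, Matrix.mul_one, zero_add, add_zero,
    Matrix.transpose_zero, Matrix.transpose_one, Matrix.fromBlocks_neg, Matrix.fromBlocks_add,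
    Sum.elim_comp_inl, Sum.elim_comp_inr, Matrix.mulVec_zero, Matrix.zero_mulVec, neg_zero,
    Matrix.mulVec_mulVec, Matrix.fromBlocks_multiply, hQ]
  rw [← Matrix.mul_assoc Qᵀ Q, hQ, Matrix.one_mul]

theorem frame_transpose_deriv {Q : ℝ → M3} {ω : V3} {J : Set ℝ} {s : ℝ}
    (hQ : MatHasDerivWithinAt Q (Q s * skew ω) J s) :
    MatHasDerivWithinAt (fun r => (frame (Q r))ᵀ)
      (-Matrix.fromBlocks (Matrix.fromBlocks (skew ω) 0 0 (skew ω)) 0 0 0 * (frame (Q s))ᵀ) J s := by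
  have hT := hQ.transpose
  rw [Matrix.transpose_mul, skew_transpose] at hT
  have e : -Matrix.fromBlocks (Matrix.fromBlocks (skew ω) 0 0 (skew ω)) 0 0 0 * (frame (Q s))ᵀ
      = (Matrix.fromBlocks (Matrix.fromBlocks (-skew ω * (Q s)ᵀ) 0 0 (-skew ω * (Q s)ᵀ)) 0 0 0
        : M7) := by
    rw [frame, Matrix.fromBlocks_transpose, Matrix.fromBlocks_transpose, Matrix.fromBlocks_neg,
      Matrix.fromBlocks_neg, Matrix.fromBlocks_multiply, Matrix.fromBlocks_multiply]
    simp
  rw [e]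
  intro i j
  rcases i with (i | i) | i <;> rcases j with (j | j) | j <;>
    simp only [frame, Matrix.fromBlocks_transpose, Matrix.fromBlocks_apply₁₁,
      Matrix.fromBlocks_apply₁₂, Matrix.fromBlocks_apply₂₁, Matrix.fromBlocks_apply₂₂,
      Matrix.transpose_zero, Matrix.zero_apply] <;>
    first
      | exact hasDerivWithinAt_const ..
      | exact hT i j

theorem driftFlow_deriv {b : ℝ → V3} (hb : Continuous b) (t s : ℝ) (J : Set ℝ) :
    MatHasDerivWithinAt (fun r => driftFlow (r - t) (posInt b t r) (velInt b t r))
      (driftGen (velInt b t s) (b s)) J s := by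
  have hv := hasDerivAt_pi.1 (hasDerivAt_velInt hb t s)
  have hp := hasDerivAt_pi.1 (hasDerivAt_posInt hb t s)
  intro i j
  rcases i with (i | i) | i <;> rcases j with (j | j) | j <;>
    simp only [driftFlow, driftGen, Matrix.fromBlocks_apply₁₁,
      Matrix.fromBlocks_apply₁₂, Matrix.fromBlocks_apply₂₁, Matrix.fromBlocks_apply₂₂,
      Matrix.zero_apply, Matrix.replicateCol_apply, Sum.elim_inl, Sum.elim_inr,
      Matrix.smul_apply, smul_eq_mul] <;>
    first
      | exact hasDerivWithinAt_const ..
      | exact (hv i).hasDerivWithinAt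
      | exact (hp i).hasDerivWithinAt
      | simpa using (((hasDerivAt_id s).sub_const t).mul_const
          ((1 : M3) i j)).hasDerivWithinAt

/-- By the product rule, differentiating the frame gives the rotational part of `Atheta_eq`, and
differentiating the drift flow gives the conjugated generator. The hypothesis `hbs` identifies b as
the forcing direction in inertial coordinates. -/
theorem thetaFlow_deriv {Q : ℝ → M3} {b : ℝ → V3} (hb : Continuous b) {ω a : V3} {R : M3}
    {J : Set ℝ} {s : ℝ} (t : ℝ) (hQ : MatHasDerivWithinAt Q (Q s * skew ω) J s)
    (hQs : Q s ∈ Matrix.specialOrthogonalGroup (Fin 3) ℝ)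
    (hbs : b s = Q s *ᵥ (Rᵀ *ᵥ (skew a *ᵥ e3))) :
    MatHasDerivWithinAt (fun r => thetaFlow Q b r t) (Atheta ω R a * thetaFlow Q b s t) J s := by
  refine (((frame_transpose_deriv hQ).mul (driftFlow_deriv hb t s J)).mul
    (matHasDerivWithinAt_const (frame (Q t)))).congr_deriv ?_
  rw [Atheta_eq ω a R (rot_transpose_mul hQs), ← hbs, Matrix.mul_zero, add_zero, thetaFlow,
    ← driftGen_mul_driftFlow (b s) (s - t) (posInt b t s), Matrix.add_mul, Matrix.add_mul]
  congr 1
  · simp only [Matrix.mul_assoc]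
  · have h : ∀ Z : M7, frame (Q s) * ((frame (Q s))ᵀ * Z) = Z := fun Z => by
      rw [← Matrix.mul_assoc, frame_mul_transpose (rot_mul_transpose hQs), Matrix.one_mul]
    simp only [Matrix.mul_assoc, h]

theorem thetaFlow_self {Q : ℝ → M3} {b : ℝ → V3} {t : ℝ}
    (hQ : Q t ∈ Matrix.specialOrthogonalGroup (Fin 3) ℝ) : thetaFlow Q b t t = 1 := by
  have h1 : driftFlow 0 0 0 = 1 := by
    rw [driftFlow, zero_smul, Matrix.fromBlocks_one, ← Matrix.fromBlocks_one]
    ext i j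
    rcases i with i | i <;> simp
  rw [thetaFlow, sub_self, posInt_self, velInt_self, h1, Matrix.mul_one]
  exact mul_eq_one_comm.1 (frame_mul_transpose (rot_mul_transpose hQ))

theorem frame_mulVec (Q : M3) (x : V7) : frame Q *ᵥ x =
    Sum.elim (Sum.elim (Q *ᵥ posErr x) (Q *ᵥ velErr x)) (fun _ => yawErr x) := by
  conv_lhs => rw [← sumElim_posErr_velErr_yawErr x]
  rw [frame, Matrix.fromBlocks_mulVec]
  simp [Matrix.fromBlocks_mulVec]

theorem posErr_frame_transpose_mulVec (Q : M3) (x : V7) :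
    posErr ((frame Q)ᵀ *ᵥ x) = Qᵀ *ᵥ posErr x := by
  have h : (frame Q)ᵀ = frame Qᵀ := by
    simp [frame, Matrix.fromBlocks_transpose]
  rw [h, frame_mulVec]
  rfl

theorem posErr_driftFlow_mulVec (τ : ℝ) (p v : V3) (x : V7) :
    posErr (driftFlow τ p v *ᵥ x) = posErr x + τ • velErr x + yawErr x • p := by
  conv_lhs => rw [← sumElim_posErr_velErr_yawErr x]
  rw [driftFlow, Matrix.fromBlocks_mulVec]
  simp only [Sum.elim_comp_inl, Sum.elim_comp_inr, Matrix.fromBlocks_mulVec]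
  ext i
  simp [posErr, Matrix.smul_mulVec]
  simp [Matrix.mulVec, dotProduct, mul_comm]

/-- The output sees only this component; up to the rotation (Q s)ᵀ it is the curve treated in
`exists_observability_constants`. -/
theorem posErr_thetaFlow_mulVec (Q : ℝ → M3) (b : ℝ → V3) (s t : ℝ) (q : V7) :
    posErr (thetaFlow Q b s t *ᵥ q) = (Q s)ᵀ *ᵥ (Q t *ᵥ posErr q + (s - t) • (Q t *ᵥ velErr q)
      + yawErr q • posInt b t s) := by
  rw [thetaFlow, ← Matrix.mulVec_mulVec, ← Matrix.mulVec_mulVec, posErr_frame_transpose_mulVec,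
    posErr_driftFlow_mulVec, frame_mulVec]
  rfl

end Transition

/-! ### Uniform observability -/

section Observability

theorem eucl_mulVec_le_of_abs_le {M : M3} {ε : ℝ} (hε : 0 ≤ ε) (hM : ∀ i j, |M i j| ≤ ε)
    (z : V3) : eucl (M *ᵥ z) ≤ 9 * ε * eucl z := by
  have h1 : ∀ i, |(M *ᵥ z) i| ≤ 3 * ε * eucl z := fun i => by
    rw [Matrix.mulVec, dotProduct]
    refine (Finset.abs_sum_le_sum_abs _ _).trans ?_
    have : ∀ j ∈ Finset.univ, |M i j * z j| ≤ ε * eucl z := fun j _ => by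
      rw [abs_mul]
      exact mul_le_mul (hM i j) (abs_apply_le_eucl z j) (abs_nonneg _) hε
    refine (Finset.sum_le_sum this).trans (le_of_eq ?_)
    simp
    ring
  refine (eucl_le_sum_abs _).trans ?_
  refine (Finset.sum_le_sum fun i _ => h1 i).trans (le_of_eq ?_)
  simp
  ring

variable {g : ℝ} {QB QT : ℝ → M3} {pB vB ωB aB pT vT ωT aT : ℝ → V3}

/-- The disturbance `b₁` is at most half as large as `b₀`, so that `b` keeps a positive component
along `b₀`. -/
theorem half_sq_le_dotProduct_bVec (hB : IsRigidMotion g QB pB vB ωB aB)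
    (hT : IsRigidMotion g QT pT vT ωT aT) (hsep : ∀ t, 0 ≤ t → pB t ≠ pT t)
    {δ μ : ℝ} (hδ : 0 < δ) (hμ : 0 < μ) (hPE : BearingPE (bearingI QB pB pT) δ μ)
    {b₀ : V3} {b₁ : ℝ → V3}
    (hb : ∀ t, 0 ≤ t → bVec QT aT t = b₀ + b₁ t)
    (hb₁ : ∀ t, 0 ≤ t →
      (1 / δ) * ∫ s in t..(t + δ), eucl (proj (bearingI QB pB pT s) *ᵥ b₁ t) ^ 2
        ≤ μ / 4 * eucl b₀ ^ 2) {t : ℝ} (ht : 0 ≤ t) :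
    eucl b₀ ^ 2 / 2 ≤ b₀ ⬝ᵥ bVec QT aT t := by
  -- In the smallness hypothesis b₁ is frozen at t, so excitation applies to the constant vector b₁
  -- t and bounds its norm.
  have h1 := hPE.le_integral hδ (continuousOn_bearingI hB hT hsep)
    (fun s hs => eucl_bearingI hB hsep hs) ht (b₁ t)
  have h2 := hb₁ t ht
  rw [one_div, ← div_eq_inv_mul, div_le_iff₀ hδ] at h2
  have h3 : eucl (b₁ t) ^ 2 ≤ (eucl b₀ / 2) ^ 2 := by
    refine le_of_mul_le_mul_left (a := δ * μ) ?_ (by positivity)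
    linarith
  have h4 : eucl (b₁ t) ≤ eucl b₀ / 2 :=
    abs_le_of_sq_le_sq' h3 (by linarith [eucl_nonneg b₀]) |>.2
  have h5 := neg_le_of_abs_le (abs_dotProduct_le_eucl b₀ (b₁ t))
  rw [hb t ht, dotProduct_add, ← eucl_sq]
  nlinarith [mul_le_mul_of_nonneg_left h4 (eucl_nonneg b₀)]

/-- Since Q_B Rᵀ = Q_T, the inertial forcing direction for the true attitude is b. -/
theorem rot_relAtt_transpose_mulVec (hB : IsRigidMotion g QB pB vB ωB aB)
    (hT : IsRigidMotion g QT pT vT ωT aT) {t : ℝ} (ht : 0 ≤ t) :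
    QB t *ᵥ ((relAtt QB QT t)ᵀ *ᵥ (skew (aT t) *ᵥ e3)) = bVec QT aT t := by
  rw [relAtt, Matrix.transpose_mul, Matrix.transpose_transpose, ← Matrix.mulVec_mulVec,
    Matrix.mulVec_mulVec _ (QB t), rot_mul_transpose (hB.rot t ht), Matrix.one_mulVec, bVec,
    rot_cross (hT.rot t ht), skew_mulVec]

/-- The observability constants depend on the forcing direction only through a bound of its norm and
a positive lower bound of its component along b₀. Both are common to all estimates R̂ that are
entrywise close to R. -/
theorem exists_uniformlyObservable (hB : IsRigidMotion g QB pB vB ωB aB)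
    (hT : IsRigidMotion g QT pT vT ωT aT) (hsep : ∀ t, 0 ≤ t → pB t ≠ pT t)
    {δ μ : ℝ} (hδ : 0 < δ) (hμ : 0 < μ) (hPE : BearingPE (bearingI QB pB pT) δ μ)
    (haT : ContinuousOn aT (Set.Ici 0)) (haT' : ∃ c, ∀ t, 0 ≤ t → eucl (aT t) ≤ c)
    {b₀ : V3} {b₁ : ℝ → V3} (hb₀ : b₀ ≠ 0)
    (hb : ∀ t, 0 ≤ t → bVec QT aT t = b₀ + b₁ t)
    (hb₁ : ∀ t, 0 ≤ t →
      (1 / δ) * ∫ s in t..(t + δ), eucl (proj (bearingI QB pB pT s) *ᵥ b₁ t) ^ 2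
        ≤ μ / 4 * eucl b₀ ^ 2) :
    ∃ ε δ' μ' : ℝ, 0 < ε ∧ ∀ Rhat : ℝ → M3,
      ContinuousOn Rhat (Set.Ici 0) →
      (∀ t, 0 ≤ t → Rhat t ∈ Matrix.specialOrthogonalGroup (Fin 3) ℝ) →
      (∀ t, 0 ≤ t → ∀ i j, |Rhat t i j - relAtt QB QT t i j| ≤ ε) →
      UniformlyObservableWith (fun t => Atheta (ωB t) (Rhat t) (aT t))
        (fun t => Ctheta (bearing QB pB pT t)) δ' μ' := by
  obtain ⟨c, hc⟩ := haT'
  have hc0 : 0 ≤ c := (eucl_nonneg _).trans (hc 0 le_rfl)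
  have hb₀' := eucl_pos hb₀
  obtain ⟨δ', μ', hδ', hμ', hobs⟩ := exists_observability_constants hδ hμ
    (by positivity : 0 < eucl b₀ ^ 2 / 4) hc0 b₀
  -- An entrywise error ε moves the forcing direction by at most 9ε(c + 1) = |b₀|/4, so half of the
  -- margin |b₀|²/2 along b₀ survives.
  refine ⟨eucl b₀ / (36 * (c + 1)), δ', μ', by positivity, fun Rhat hRc hR hRε => ?_⟩
  set ε := eucl b₀ / (36 * (c + 1)) with hε
  have hε0 : 0 < ε := by positivity
  -- Holding the value at time 0 for negative times makes the forcing direction continuous on the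
  -- whole line with the same bounds.
  set bh : ℝ → V3 := fun s =>
    QB (max s 0) *ᵥ ((Rhat (max s 0))ᵀ *ᵥ (skew (aT (max s 0)) *ᵥ e3)) with hbh
  have hbc : Continuous bh := by
    have h1 : ContinuousOn (fun s => QB s *ᵥ ((Rhat s)ᵀ *ᵥ (skew (aT s) *ᵥ e3))) (Set.Ici 0) :=
      hB.continuousOn_rot.matrix_mulVec (hRc.matrix_transpose.matrix_mulVec
        (haT.skew.matrix_mulVec continuousOn_const))
    exact h1.comp_continuous (continuous_id.max continuous_const)
      fun s => Set.mem_Ici.2 (le_max_right s 0)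
  have hbn : ∀ s, eucl (bh s) ≤ c := fun s => by
    have h0 : 0 ≤ max s 0 := le_max_right _ _
    rw [hbh, eucl_rot_mulVec (hB.rot _ h0), eucl_rot_transpose_mulVec (hR _ h0)]
    exact (eucl_skew_e3_le _).trans (hc _ h0)
  have hbl : ∀ s, eucl b₀ ^ 2 / 4 ≤ b₀ ⬝ᵥ bh s := fun s => by
    have h0 : 0 ≤ max s 0 := le_max_right _ _
    set u := max s 0 with hu
    have h1 : bh s - bVec QT aT u
        = QB u *ᵥ ((Rhat u - relAtt QB QT u)ᵀ *ᵥ (skew (aT u) *ᵥ e3)) := by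
      rw [← rot_relAtt_transpose_mulVec hB hT h0, hbh, ← Matrix.mulVec_sub, ← Matrix.sub_mulVec,
        Matrix.transpose_sub]
    have h2 : eucl (bh s - bVec QT aT u) ≤ eucl b₀ / 4 := by
      rw [h1, eucl_rot_mulVec (hB.rot _ h0)]
      refine (eucl_mulVec_le_of_abs_le hε0.le (fun i j => hRε u h0 j i) _).trans ?_
      have h3 := (eucl_skew_e3_le (aT u)).trans (hc u h0)
      have h4 : 9 * ε * eucl (skew (aT u) *ᵥ e3) ≤ 9 * ε * (c + 1) :=
        mul_le_mul_of_nonneg_left (by linarith) (by positivity)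
      refine h4.trans (le_of_eq ?_)
      rw [hε]
      field_simp
      norm_num
    have h5 := half_sq_le_dotProduct_bVec hB hT hsep hδ hμ hPE hb hb₁ h0
    have h6 := neg_le_of_abs_le (abs_dotProduct_le_eucl b₀ (bh s - bVec QT aT u))
    rw [dotProduct_sub] at h6
    nlinarith [mul_le_mul_of_nonneg_left h2 (eucl_nonneg b₀)]
  refine ⟨hδ', hμ', thetaFlow QB bh, ?_, fun t ht => ?_⟩
  · refine fun t ht => ⟨thetaFlow_self (hB.rot t ht), fun s hs => ?_⟩
    have hs0 : 0 ≤ s := ht.trans hs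
    refine thetaFlow_deriv hbc t ((hB.att s hs0).mono (Set.Ici_subset_Ici.2 ht))
      (hB.rot s hs0) ?_
    simp only [hbh, max_eq_left hs0]
  · have htd : t ≤ t + δ' := by linarith
    set C := fun s => Ctheta (bearing QB pB pT s) with hC
    have hCc : ContinuousOn C (Set.Icc t (t + δ')) :=
      ((continuousOn_bearing hB hT hsep).mono fun s hs => ht.trans hs.1).Ctheta
    have hΦc : ContinuousOn (fun s => thetaFlow QB bh s t) (Set.Icc t (t + δ')) := fun s hs => by
      have hs0 : 0 ≤ s := ht.trans hs.1
      refine (thetaFlow_deriv (ω := ωB s) (a := aT s) (R := Rhat s) hbc t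
        ((hB.att s hs0).mono fun r hr => ht.trans hr.1) (hB.rot s hs0) ?_).continuousWithinAt
      simp only [hbh, max_eq_left hs0]
    have hGc : ContinuousOn (fun s => (thetaFlow QB bh s t)ᵀ * (C s)ᵀ * C s * thetaFlow QB bh s t)
        (Set.Icc t (t + δ')) :=
      ((hΦc.matrix_transpose.matrix_mul hCc.matrix_transpose).matrix_mul hCc).matrix_mul hΦc
    refine succeq_of_mul_sq_le ?_ fun q => ?_
    · ext i j
      simp only [gramian, matIntegral, Matrix.transpose_apply, Matrix.smul_apply, Matrix.of_apply]
      congr 2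
      ext s
      have : ((thetaFlow QB bh s t)ᵀ * (C s)ᵀ * C s * thetaFlow QB bh s t)ᵀ
          = (thetaFlow QB bh s t)ᵀ * (C s)ᵀ * C s * thetaFlow QB bh s t := by
        simp only [Matrix.transpose_mul, Matrix.transpose_transpose, Matrix.mul_assoc]
      exact congrFun (congrFun this i) j
    · have key := hobs _ hPE (continuousOn_bearingI hB hT hsep)
        (fun s hs => eucl_bearingI hB hsep hs) bh hbc hbl hbn t ht (QB t *ᵥ posErr q)
        (QB t *ᵥ velErr q) (yawErr q)
      rw [eucl_rot_mulVec (hB.rot t ht), eucl_rot_mulVec (hB.rot t ht), ← eucl_state_sq] at key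
      rw [gramian, Matrix.smul_mulVec, dotProduct_smul, quadForm_matIntegral htd hGc, smul_eq_mul,
        one_div, ← div_eq_inv_mul, le_div_iff₀ hδ']
      refine le_trans (by linarith) (key.trans (le_of_eq ?_))
      refine intervalIntegral.integral_congr fun s hs => ?_
      rw [Set.uIcc_of_le htd] at hs
      have hs0 : 0 ≤ s := ht.trans hs.1
      simp only [← Matrix.mulVec_mulVec, Matrix.mul_assoc]
      rw [dotProduct_transpose_mulVec, dotProduct_transpose_mulVec, ← eucl_sq, hC, Ctheta_mulVec,
        posErr_thetaFlow_mulVec, proj_rot_mulVec (hB.rot s hs0)]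
      rfl

end Observability

/-! ### The attitude estimate -/

section Attitude

theorem rodrigues_e3 (θ : ℝ) : rodrigues θ e3 =
    !![Real.cos θ, -Real.sin θ, 0; Real.sin θ, Real.cos θ, 0; 0, 0, 1] := by
  ext i j
  fin_cases i <;> fin_cases j <;>
    simp [rodrigues, skew, e3]

theorem rodrigues_e3_mem (θ : ℝ) :
    rodrigues θ e3 ∈ Matrix.specialOrthogonalGroup (Fin 3) ℝ := by
  rw [rodrigues_e3]
  refine Matrix.mem_specialOrthogonalGroup_iff.2 ⟨?_, ?_⟩
  · rw [Matrix.mem_orthogonalGroup_iff']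
    ext i j
    fin_cases i <;> fin_cases j <;>
      simp [Matrix.mul_apply, Fin.sum_univ_three] <;> nlinarith [Real.sin_sq_add_cos_sq θ]
  · rw [Matrix.det_fin_three]
    simp
    nlinarith [Real.sin_sq_add_cos_sq θ]

theorem attEst_mem {R : M3} (hR : R ∈ Matrix.specialOrthogonalGroup (Fin 3) ℝ) (x : V7) :
    attEst R x ∈ Matrix.specialOrthogonalGroup (Fin 3) ℝ :=
  mul_mem (rodrigues_e3_mem _) hR

theorem abs_rot_apply_le {R : M3} (hR : R ∈ Matrix.specialOrthogonalGroup (Fin 3) ℝ)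
    (i j : Fin 3) : |R i j| ≤ 1 := by
  have h1 := eucl_rot_mulVec hR (Pi.single j 1)
  have h2 : eucl (Pi.single j 1 : V3) = 1 := by
    have : eucl (Pi.single j 1 : V3) ^ 2 = 1 ^ 2 := by simp [eucl_sq]
    exact (sq_eq_sq₀ (eucl_nonneg _) zero_le_one).1 this
  have h3 := abs_apply_le_eucl (R *ᵥ Pi.single j 1) i
  rw [h1, h2] at h3
  simpa using h3

theorem abs_attEst_sub_le {R : M3} (hR : R ∈ Matrix.specialOrthogonalGroup (Fin 3) ℝ) (x : V7)
    (i j : Fin 3) : |attEst R x i j - R i j| ≤ 3 * |yawErr x| := by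
  set θ := yawErr x with hθ
  have hs : |Real.sin θ| ≤ |θ| := Real.abs_sin_le_abs
  have hc : |Real.cos θ - 1| ≤ |θ| := by
    simpa using Real.abs_cos_sub_cos_le θ 0
  have hE : ∀ k, |(rodrigues θ e3 - 1) i k| ≤ |θ| := fun k => by
    rw [rodrigues_e3]
    fin_cases i <;> fin_cases k <;> simp [hs, hc]
  have h1 : attEst R x i j - R i j = ((rodrigues θ e3 - 1) * R) i j := by
    rw [Matrix.sub_mul, Matrix.one_mul, Matrix.sub_apply]
    rfl
  rw [h1, Matrix.mul_apply]
  refine (Finset.abs_sum_le_sum_abs _ _).trans ?_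
  have : ∀ k ∈ Finset.univ, |(rodrigues θ e3 - 1) i k * R k j| ≤ |θ| := fun k _ => by
    rw [abs_mul]
    exact (mul_le_mul (hE k) (abs_rot_apply_le hR k j) (abs_nonneg _) (abs_nonneg _)).trans
      (by rw [mul_one])
  refine (Finset.sum_le_sum this).trans (le_of_eq ?_)
  simp

theorem continuous_rodrigues_e3 : Continuous fun θ => rodrigues θ e3 := by
  refine continuous_pi fun i => continuous_pi fun j => ?_
  simp only [rodrigues, Matrix.add_apply, Matrix.smul_apply, smul_eq_mul]
  fun_prop

theorem ContinuousOn.attEst {J : Set ℝ} {R : ℝ → M3} {x : ℝ → V7} (hR : ContinuousOn R J)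
    (hx : ContinuousOn x J) : ContinuousOn (fun s => attEst (R s) (x s)) J :=
  (continuous_rodrigues_e3.comp_continuousOn
    ((continuous_apply (Sum.inr 0 : Idx7)).comp_continuousOn hx)).matrix_mul hR

end Attitude

/-! ### Bootstrapping -/

/-- Up to and including the first time at which f reaches r one has f ≤ r, and then the step gives f
< r there, a contradiction. -/
theorem forall_lt_of_bootstrap {f : ℝ → ℝ} {a b r : ℝ} (hf : ContinuousOn f (Set.Icc a b))
    (h0 : f a < r)
    (hstep : ∀ τ ∈ Set.Icc a b, (∀ t ∈ Set.Icc a τ, f t ≤ r) → f τ < r) :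
    ∀ t ∈ Set.Icc a b, f t < r := by
  by_contra! hcon
  have hclosed : IsClosed (Set.Icc a b ∩ f ⁻¹' Set.Ici r) :=
    hf.preimage_isClosed_of_isClosed isClosed_Icc isClosed_Ici
  have hcomp : IsCompact (Set.Icc a b ∩ f ⁻¹' Set.Ici r) :=
    isCompact_Icc.of_isClosed_subset hclosed Set.inter_subset_left
  obtain ⟨t, ht, hrt⟩ := hcon
  obtain ⟨τ, ⟨hτ, hrτ⟩, hmin⟩ := hcomp.exists_isLeast ⟨t, ht, hrt⟩
  have hlt : ∀ s ∈ Set.Ico a τ, f s < r := fun s hs => by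
    by_contra! h
    exact absurd (hmin ⟨⟨hs.1, hs.2.le.trans hτ.2⟩, h⟩) (not_le.2 hs.2)
  have haτ : a < τ := by
    rcases hτ.1.eq_or_lt with h | h
    · rw [h] at h0
      exact absurd hrτ (not_le.2 h0)
    · exact h
  have hnb : (nhdsWithin τ (Set.Ico a τ)).NeBot := by
    rw [← mem_closure_iff_nhdsWithin_neBot, closure_Ico haτ.ne]
    exact Set.right_mem_Icc.2 haτ.le
  have hle : f τ ≤ r :=
    le_of_tendsto ((hf τ hτ).mono (Set.Ico_subset_Icc_self.trans (Set.Icc_subset_Icc_right hτ.2)))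
      (eventually_nhdsWithin_of_forall fun s hs => (hlt s hs).le)
  refine absurd (hstep τ hτ fun s hs => ?_) (not_lt.2 hrτ)
  rcases hs.2.eq_or_lt with h | h
  · rw [h]
    exact hle
  · exact (hlt s ⟨hs.1, h⟩).le

/-! ### A priori estimates for the observer -/

section Observer

/-- The data of the error system, with uniform observability around `R̂ = R`. -/
structure IsErrorSystem (ωB aT : ℝ → V3) (R : ℝ → M3) (y : ℝ → V3) (S : ℝ → M7) (D : ℝ → M3) :
    Prop where
  ω_cont : ContinuousOn ωB (Set.Ici 0)
  ω_bdd : ∃ c, ∀ t, 0 ≤ t → eucl (ωB t) ≤ c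
  a_cont : ContinuousOn aT (Set.Ici 0)
  a_bdd : ∃ c, ∀ t, 0 ≤ t → eucl (aT t) ≤ c
  R_cont : ContinuousOn R (Set.Ici 0)
  R_mem : ∀ t, 0 ≤ t → R t ∈ Matrix.specialOrthogonalGroup (Fin 3) ℝ
  y_cont : ContinuousOn y (Set.Ici 0)
  y_unit : ∀ t, 0 ≤ t → eucl (y t) = 1
  S_weight : IsWeight S
  D_weight : IsWeight D
  observable : ∃ ε δ' μ' : ℝ, 0 < ε ∧ ∀ Rhat : ℝ → M3, ContinuousOn Rhat (Set.Ici 0) →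
    (∀ t, 0 ≤ t → Rhat t ∈ Matrix.specialOrthogonalGroup (Fin 3) ℝ) →
    (∀ t, 0 ≤ t → ∀ i j, |Rhat t i j - R t i j| ≤ ε) →
    UniformlyObservableWith (fun t => Atheta (ωB t) (Rhat t) (aT t))
      (fun t => Ctheta (y t)) δ' μ'

variable {ωB aT : ℝ → V3} {R : ℝ → M3} {y : ℝ → V3} {S : ℝ → M7} {D : ℝ → M3}

/-- The information rate `Cᵀ D C`. -/
def infoRate (y : V3) (D : M3) : M7 := (Ctheta y)ᵀ * D * Ctheta y

theorem quadForm_infoRate (y : V3) (D : M3) (z : V7) :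
    z ⬝ᵥ (infoRate y D *ᵥ z) = (Ctheta y *ᵥ z) ⬝ᵥ (D *ᵥ (Ctheta y *ᵥ z)) := by
  rw [infoRate, ← Matrix.mulVec_mulVec, ← Matrix.mulVec_mulVec, dotProduct_transpose_mulVec]

theorem infoRate_transpose (y : V3) {D : M3} (hD : Dᵀ = D) :
    (infoRate y D)ᵀ = infoRate y D := by
  simp only [infoRate, Matrix.transpose_mul, Matrix.transpose_transpose, hD, Matrix.mul_assoc]

theorem IsErrorSystem.exists_eucl_Atheta_le (h : IsErrorSystem ωB aT R y S D) :
    ∃ α, 0 ≤ α ∧ ∀ t, 0 ≤ t → ∀ x z : V7,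
      eucl (Atheta (ωB t) (attEst (R t) x) (aT t) *ᵥ z) ≤ α * eucl z := by
  obtain ⟨cω, hcω⟩ := h.ω_bdd
  obtain ⟨ca, hca⟩ := h.a_bdd
  refine ⟨2 * cω + 1 + ca, ?_, fun t ht x z =>
    eucl_Atheta_mulVec_le (attEst_mem (h.R_mem t ht) x) (hcω t ht) (hca t ht) z⟩
  linarith [(eucl_nonneg _).trans (hcω 0 le_rfl), (eucl_nonneg _).trans (hca 0 le_rfl)]

theorem quadForm_infoRate_le {y : V3} (hy : eucl y = 1) {D : M3} {d : ℝ} (hd : 0 ≤ d)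
    (hD : Succeq (d • 1) D) (z : V7) : z ⬝ᵥ (infoRate y D *ᵥ z) ≤ d * eucl z ^ 2 := by
  rw [quadForm_infoRate]
  exact (hD.le_mul_sq _).trans (mul_le_mul_of_nonneg_left
    (pow_le_pow_left₀ (eucl_nonneg _) (eucl_Ctheta_mulVec_le hy z) 2) hd)

theorem quadForm_infoRate_nonneg (y : V3) {D : M3} {d : ℝ} (hd : 0 ≤ d)
    (hD : Succeq D (d • 1)) (z : V7) : 0 ≤ z ⬝ᵥ (infoRate y D *ᵥ z) := by
  rw [quadForm_infoRate]
  exact (mul_nonneg hd (sq_nonneg _)).trans (hD.mul_sq_le _)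

theorem IsErrorSystem.continuousOn_infoRate (h : IsErrorSystem ωB aT R y S D) :
    ContinuousOn (fun s => infoRate (y s) (D s)) (Set.Ici 0) :=
  (h.y_cont.Ctheta.matrix_transpose.matrix_mul h.D_weight.1).matrix_mul h.y_cont.Ctheta

/-- The observability Gramian weighted by `D`. -/
theorem le_quadForm_weighted_gramian {Φ : ℝ → ℝ → M7} {t δ μ d : ℝ} (hδ : 0 < δ) (hd : 0 ≤ d)
    (hΦ : ContinuousOn (fun s => Φ s t) (Set.Icc t (t + δ)))
    (hy : ContinuousOn y (Set.Icc t (t + δ))) (hDc : ContinuousOn D (Set.Icc t (t + δ)))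
    (hD : ∀ s ∈ Set.Icc t (t + δ), Succeq (D s) (d • 1))
    (hW : Succeq (gramian Φ (fun s => Ctheta (y s)) t δ) (μ • 1)) (q : V7) :
    d * (δ * μ) * eucl q ^ 2 ≤ q ⬝ᵥ (matIntegral
      (fun s => (Φ s t)ᵀ * infoRate (y s) (D s) * Φ s t) t (t + δ) *ᵥ q) := by
  have htd : t ≤ t + δ := by linarith
  have hC := hy.Ctheta
  have hc1 : ContinuousOn (fun s => (Φ s t)ᵀ * (Ctheta (y s))ᵀ * Ctheta (y s) * Φ s t)
      (Set.Icc t (t + δ)) :=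
    ((hΦ.matrix_transpose.matrix_mul hC.matrix_transpose).matrix_mul hC).matrix_mul hΦ
  have hc2 : ContinuousOn (fun s => (Φ s t)ᵀ * infoRate (y s) (D s) * Φ s t)
      (Set.Icc t (t + δ)) :=
    (hΦ.matrix_transpose.matrix_mul
      ((hC.matrix_transpose.matrix_mul hDc).matrix_mul hC)).matrix_mul hΦ
  have h1 := hW.mul_sq_le q
  rw [gramian, Matrix.smul_mulVec, dotProduct_smul, quadForm_matIntegral htd hc1, smul_eq_mul,
    one_div, ← div_eq_inv_mul, le_div_iff₀ hδ] at h1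
  rw [quadForm_matIntegral htd hc2]
  have hq : ∀ M : ℝ → M7, ContinuousOn M (Set.Icc t (t + δ)) →
      IntervalIntegrable (fun s => q ⬝ᵥ (M s *ᵥ q)) MeasureTheory.volume t (t + δ) :=
    fun M hM => by
      have : ContinuousOn (fun s => q ⬝ᵥ (M s *ᵥ q)) (Set.Icc t (t + δ)) := by
        have h2 := hM.matrix_mulVec (v := fun _ => q) continuousOn_const
        rw [continuousOn_iff_continuous_domRestrict] at h2 ⊢
        exact continuous_const.dotProduct h2
      exact this.intervalIntegrable_of_Icc htd
  have h3 : ∫ s in t..(t + δ), d * (q ⬝ᵥ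
      (((Φ s t)ᵀ * (Ctheta (y s))ᵀ * Ctheta (y s) * Φ s t) *ᵥ q))
      ≤ ∫ s in t..(t + δ), q ⬝ᵥ (((Φ s t)ᵀ * infoRate (y s) (D s) * Φ s t) *ᵥ q) := by
    refine intervalIntegral.integral_mono_on htd ((hq _ hc1).const_mul d) (hq _ hc2)
      fun s hs => ?_
    have h4 := (hD s hs).mul_sq_le (Ctheta (y s) *ᵥ (Φ s t *ᵥ q))
    rw [eucl_sq] at h4
    simp only [infoRate, ← Matrix.mulVec_mulVec, dotProduct_transpose_mulVec]
    exact h4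
  rw [intervalIntegral.integral_const_mul] at h3
  have h5 := mul_le_mul_of_nonneg_left h1 hd
  linarith

/-- Uniform upper bound of the Riccati matrix as long as the yaw error is small. -/
theorem IsErrorSystem.exists_riccati_le (h : IsErrorSystem ωB aT R y S D) {p : ℝ} (hp : 0 < p) :
    ∃ η pM : ℝ, 0 < η ∧ 0 < pM ∧ ∀ t₀ τ, 0 ≤ t₀ → t₀ ≤ τ → ∀ (x : ℝ → V7) (P : ℝ → M7),
      ContinuousOn x (Set.Icc t₀ τ) → (∀ s ∈ Set.Icc t₀ τ, |yawErr (x s)| ≤ η) →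
      SolvesRiccatiOn (fun s => Atheta (ωB s) (attEst (R s) (x s)) (aT s))
        (fun s => infoRate (y s) (D s)) S P t₀ τ →
      (∀ s ∈ Set.Icc t₀ τ, (P s)ᵀ = P s) →
      (∀ z, z ⬝ᵥ (P t₀ *ᵥ z) ≤ p * eucl z ^ 2) →
      ∀ z, z ⬝ᵥ (P τ *ᵥ z) ≤ pM * eucl z ^ 2 := by
  obtain ⟨α, hα, hA⟩ := h.exists_eucl_Atheta_le
  obtain ⟨ε, δ, μ, hε, hobs⟩ := h.observable
  -- Positivity of the constants is part of observability, so it is read off at the true attitude.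
  obtain ⟨hδ, hμ, -⟩ := hobs R h.R_cont h.R_mem fun t _ i j => by simpa using hε.le
  obtain ⟨hDc, d₁, d₂, hd₁, hd₂, hD⟩ := h.D_weight
  obtain ⟨hSc, s₁, s₂, hs₁, hs₂, hS⟩ := h.S_weight
  set E := Real.exp (α * δ) with hE
  have hE0 : 0 < E := Real.exp_pos _
  set K₁ := (p + s₂ * E ^ 2 * δ) * E ^ 2 with hK₁
  set K₂ := (d₂ * E ^ 2 + s₂ * (E * (d₂ * E ^ 2 * δ + 1)) ^ 2) * δ * (E / (d₁ * (δ * μ))) ^ 2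
    with hK₂
  have hK₁0 : 0 < K₁ := by positivity
  have hK₂0 : 0 < K₂ := by positivity
  -- The entries of R̂ - R are at most 3|θ̃|, whence ε/3. K₁ bounds P up to time δ after the start,
  -- K₂ afterwards.
  refine ⟨ε / 3, K₁ + K₂, by positivity, by positivity, ?_⟩
  intro t₀ τ ht₀ htτ x P hx hyaw hP hPs hP0 z
  have hτ0 : 0 ≤ τ := ht₀.trans htτ
  -- Observability concerns estimates defined and close to R on all of [0, ∞), whereas x is
  -- controlled on [t₀, τ] only. Freezing x outside the interval extends the estimate without
  -- changing it inside.
  set clamp : ℝ → ℝ := fun s => max t₀ (min s τ) with hclamp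
  have hclampc : Continuous clamp := continuous_const.max (continuous_id.min continuous_const)
  have hclampm : ∀ s, clamp s ∈ Set.Icc t₀ τ := fun s =>
    ⟨le_max_left _ _, max_le htτ (min_le_right _ _)⟩
  have hclampe : ∀ s ∈ Set.Icc t₀ τ, clamp s = s := fun s hs => by
    rw [hclamp]
    simp only [min_eq_left hs.2, max_eq_right hs.1]
  obtain ⟨-, -, Φ, hΦ, hW⟩ := hobs (fun s => attEst (R s) (x (clamp s)))
    (h.R_cont.attEst (hx.comp hclampc.continuousOn fun s _ => hclampm s))
    (fun t ht => attEst_mem (h.R_mem t ht) _)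
    (fun t ht i j => (abs_attEst_sub_le (h.R_mem t ht) _ i j).trans
      (by linarith [hyaw _ (hclampm t)]))
  have hnn : ∀ {a b s : ℝ}, t₀ ≤ a → s ∈ Set.Icc a b → 0 ≤ s := fun ha hs =>
    ht₀.trans (ha.trans hs.1)
  have hFd : ∀ a b, t₀ ≤ a → b ≤ τ → ∀ s ∈ Set.Icc a b, MatHasDerivWithinAt (fun r => Φ r a)
      (Atheta (ωB s) (attEst (R s) (x s)) (aT s) * Φ s a) (Set.Icc a b) s :=
    fun a b ha hb s hs => by
      have h1 := ((hΦ a (ht₀.trans ha)).2 s hs.1).mono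
        (Set.Icc_subset_Ici_self : Set.Icc a b ⊆ Set.Ici a)
      beta_reduce at h1
      rwa [hclampe s ⟨ha.trans hs.1, hs.2.trans hb⟩] at h1
  have hzsq := sq_nonneg (eucl z)
  rcases le_total τ (t₀ + δ) with hle | hle
  · have key := hP.quadForm_le_growth htτ hα hs₂.le hp.le hPs
      (fun s hs => infoRate_transpose _ (hD s (hnn le_rfl hs)).1.transpose_eq)
      (fun s hs => quadForm_infoRate_nonneg _ hd₁.le (hD s (hnn le_rfl hs)).1)
      (fun s hs => (hS s (hnn le_rfl hs)).2.le_mul_sq)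
      (fun s hs => hA s (hnn le_rfl hs) (x s))
      (hFd t₀ τ le_rfl le_rfl) (hΦ t₀ ht₀).1 hP0 z
    refine key.trans (mul_le_mul_of_nonneg_right ?_ hzsq)
    have hEle : Real.exp (α * (τ - t₀)) ≤ E :=
      Real.exp_le_exp.2 (mul_le_mul_of_nonneg_left (by linarith) hα)
    have hE2 : Real.exp (α * (τ - t₀)) ^ 2 ≤ E ^ 2 :=
      pow_le_pow_left₀ (Real.exp_pos _).le hEle 2
    have h1 : (p + s₂ * Real.exp (α * (τ - t₀)) ^ 2 * (τ - t₀))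
        * Real.exp (α * (τ - t₀)) ^ 2 ≤ K₁ := by
      rw [hK₁]
      have h0 : 0 ≤ τ - t₀ := by linarith
      have h2 : τ - t₀ ≤ δ := by linarith
      gcongr
    linarith
  -- A full observation window ends at τ, so the bound does not involve the value of P at the start
  -- of the window.
  · set a := τ - δ with ha
    have haτ : a + δ = τ := by rw [ha]; ring
    have hta : t₀ ≤ a := by linarith
    have ha0 : 0 ≤ a := ht₀.trans hta
    have hFd' := hFd a τ hta le_rfl
    have hsub : Set.Icc a τ ⊆ Set.Ici 0 := fun s hs => hnn hta hs
    have hmono : Set.Icc a τ ⊆ Set.Icc t₀ τ := Set.Icc_subset_Icc_left hta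
    have hw := le_quadForm_weighted_gramian (y := y) (D := D) hδ hd₁.le (t := a) (Φ := Φ)
      (by rw [haτ]; exact fun s hs => (hFd' s hs).continuousWithinAt)
      (by rw [haτ]; exact h.y_cont.mono hsub) (by rw [haτ]; exact hDc.mono hsub)
      (by rw [haτ]; exact fun s hs => (hD s (hsub hs)).1) (hW a ha0)
    rw [haτ] at hw
    have key := (hP.mono hta le_rfl).quadForm_le_of_gramian (by linarith) hα hd₂.le hs₂.le
      (by positivity : 0 < d₁ * (δ * μ)) (fun s hs => hPs s (hmono hs))
      (fun s hs => infoRate_transpose _ (hD s (hsub hs)).1.transpose_eq)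
      (h.continuousOn_infoRate.mono hsub)
      (fun s hs => quadForm_infoRate_nonneg _ hd₁.le (hD s (hsub hs)).1)
      (fun s hs => quadForm_infoRate_le (h.y_unit s (hsub hs)) hd₂.le (hD s (hsub hs)).2)
      (fun s hs => (hS s (hsub hs)).2.le_mul_sq)
      (fun s hs => hA s (hsub hs) (x s)) hFd' (hΦ a ha0).1 hw z
    rw [show τ - a = δ by rw [ha]; ring, ← hE] at key
    refine key.trans (mul_le_mul_of_nonneg_right ?_ hzsq)
    linarith

end Observer

/-! ### Closing the loop between smallness of the error and boundedness of the Riccati matrix. -/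

section APriori

variable {ωB aT : ℝ → V3} {R : ℝ → M3} {y : ℝ → V3} {S : ℝ → M7} {D : ℝ → M3}
  {ρ : ℝ → V7 → V7}

theorem errField_eq (t : ℝ) (x : V7) (P : M7) : errField ωB aT R y D ρ t x P =
    Atheta (ωB t) (attEst (R t) x) (aT t) *ᵥ x - P *ᵥ (infoRate (y t) (D t) *ᵥ x) + ρ t x := by
  simp only [errField, innovation, infoRate, Matrix.mulVec_mulVec, Matrix.mul_assoc]

theorem riccatiField_eq (t : ℝ) (x : V7) (P : M7) : riccatiField ωB aT R y S D t x P =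
    Atheta (ωB t) (attEst (R t) x) (aT t) * P + P * (Atheta (ωB t) (attEst (R t) x) (aT t))ᵀ
      - P * infoRate (y t) (D t) * P + S t := by
  simp only [riccatiField, infoRate, Matrix.mul_assoc]

/-- Solutions that start close to the origin stay there and decay, and their Riccati matrices stay
between two multiples of the identity. -/
theorem IsErrorSystem.exists_apriori (h : IsErrorSystem ωB aT R y S D)
    (hρ : IsQuadraticRemainder ρ) {p₁ p₂ : ℝ} (hp₁ : 0 < p₁) (hp₂ : 0 < p₂) :
    ∃ r k l m M : ℝ, 0 < r ∧ 0 < k ∧ 0 < l ∧ 0 < m ∧ 0 < M ∧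
      ∀ t₀, 0 ≤ t₀ → ∀ (x₀ : V7) (P₀ : M7), eucl x₀ < r →
        Succeq P₀ (p₁ • 1) → Succeq (p₂ • 1) P₀ → ∀ T, t₀ ≤ T → ∀ x P,
        IsObserverSolution (errField ωB aT R y D ρ) (riccatiField ωB aT R y S D)
          (Set.Icc t₀ T) x P → x t₀ = x₀ → P t₀ = P₀ → ∀ t ∈ Set.Icc t₀ T,
          eucl (x t) ≤ k * Real.exp (-l * (t - t₀)) * eucl x₀ ∧ (P t)ᵀ = P t ∧
          (∀ z, m * eucl z ^ 2 ≤ z ⬝ᵥ (P t *ᵥ z)) ∧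
          ∀ z, z ⬝ᵥ (P t *ᵥ z) ≤ M * eucl z ^ 2 := by
  obtain ⟨α, hα, hA⟩ := h.exists_eucl_Atheta_le
  obtain ⟨hDc, d₁, d₂, hd₁, hd₂, hD⟩ := h.D_weight
  obtain ⟨hSc, s₁, s₂, hs₁, hs₂, hS⟩ := h.S_weight
  obtain ⟨η, M, hη, hM, hup⟩ := h.exists_riccati_le hp₂
  obtain ⟨rρ, c, hrρ, hquad⟩ := hρ.quad
  -- Strictly below the initial bound p₁, and small enough for 2αm + d₂m² < s₁, where m ≤ 1 allows
  -- m² ≤ m.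
  set m := min (p₁ / 2) (min 1 (s₁ / (2 * α + d₂ + 1))) with hm
  have hm0 : 0 < m := by positivity
  have hmp : m < p₁ := lt_of_le_of_lt (min_le_left _ _) (by linarith)
  have hms : 2 * α * m + d₂ * m ^ 2 < s₁ := by
    have h1 : m ≤ 1 := (min_le_right _ _).trans (min_le_left _ _)
    have h2 : m ≤ s₁ / (2 * α + d₂ + 1) := (min_le_right _ _).trans (min_le_right _ _)
    rw [le_div_iff₀ (by positivity)] at h2
    have h3 : m ^ 2 ≤ m := by nlinarith
    nlinarith [mul_le_mul_of_nonneg_left h3 hd₂.le]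
  -- In this ball the yaw error is small enough for the Riccati bound, the quadratic estimate of ρ
  -- is valid, and 4M|ρ| ≤ s₁|x|, as `SolvesRiccatiOn.error_le` requires.
  set r₀ := min η (min rρ (s₁ / (4 * M * (|c| + 1)))) with hr₀
  have hr₀0 : 0 < r₀ := by positivity
  have hr₀c : 4 * M * |c| * r₀ ≤ s₁ := by
    have h1 : r₀ ≤ s₁ / (4 * M * (|c| + 1)) := (min_le_right _ _).trans (min_le_right _ _)
    rw [le_div_iff₀ (by positivity)] at h1
    have h2 : 0 ≤ 4 * M * r₀ := by positivity
    linarith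
  set k := Real.sqrt (M / p₁) with hk
  have hk0 : 0 < k := Real.sqrt_pos.2 (by positivity)
  set l := s₁ / (4 * M) with hl
  have hl0 : 0 < l := by positivity
  -- The divisor k + 1 keeps both |x₀| and the transient peak k|x₀| below r₀.
  refine ⟨r₀ / (k + 1), k, l, m, M, by positivity, hk0, hl0, hm0, hM, ?_⟩
  intro t₀ ht₀ x₀ P₀ hx₀ hP₁ hP₂ T hT x P hsol hxt₀ hPt₀
  have hsub0 : Set.Icc t₀ T ⊆ Set.Ici 0 := fun s hs => ht₀.trans hs.1
  have hxc : ContinuousOn x (Set.Icc t₀ T) := fun s hs => (hsol s hs).1.continuousWithinAt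
  set A : ℝ → M7 := fun s => Atheta (ωB s) (attEst (R s) (x s)) (aT s) with hAdef
  set G : ℝ → M7 := fun s => infoRate (y s) (D s) with hGdef
  have hric : SolvesRiccatiOn A G S P t₀ T := fun s hs => by
    have := (hsol s hs).2
    rwa [riccatiField_eq] at this
  have hxd : ∀ s ∈ Set.Icc t₀ T, HasDerivWithinAt x
      (A s *ᵥ x s - P s *ᵥ (G s *ᵥ x s) + ρ s (x s)) (Set.Icc t₀ T) s := fun s hs => by
    have := (hsol s hs).1
    rwa [errField_eq] at this
  have hAc : ContinuousOn A (Set.Icc t₀ T) :=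
    (h.ω_cont.mono hsub0).Atheta ((h.R_cont.mono hsub0).attEst hxc) (h.a_cont.mono hsub0)
  have hGs : ∀ s ∈ Set.Icc t₀ T, (G s)ᵀ = G s := fun s hs =>
    infoRate_transpose _ (hD s (hsub0 hs)).1.transpose_eq
  have hG0 : ∀ s ∈ Set.Icc t₀ T, ∀ z, 0 ≤ z ⬝ᵥ (G s *ᵥ z) := fun s hs =>
    quadForm_infoRate_nonneg _ hd₁.le (hD s (hsub0 hs)).1
  have hSl : ∀ s ∈ Set.Icc t₀ T, ∀ z, s₁ * eucl z ^ 2 ≤ z ⬝ᵥ (S s *ᵥ z) := fun s hs =>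
    (hS s (hsub0 hs)).1.mul_sq_le
  have hPs : ∀ s ∈ Set.Icc t₀ T, (P s)ᵀ = P s :=
    hric.transpose_eq hAc (h.continuousOn_infoRate.mono hsub0) hGs
      (fun s hs => (hS s (hsub0 hs)).1.transpose_eq) (by rw [hPt₀]; exact hP₁.transpose_eq)
  have hPl : ∀ s ∈ Set.Icc t₀ T, ∀ z, m * eucl z ^ 2 ≤ z ⬝ᵥ (P s *ᵥ z) := fun s hs z => by
    rcases eq_or_ne z 0 with rfl | hz
    · simp
    · refine (hric.lt_quadForm hPs hm0 (fun s hs => hA s (hsub0 hs) (x s))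
        (fun s hs => quadForm_infoRate_le (h.y_unit s (hsub0 hs)) hd₂.le (hD s (hsub0 hs)).2)
        hSl hms (fun w hw => ?_) s hs z hz).le
      rw [hPt₀]
      exact lt_of_lt_of_le (mul_lt_mul_of_pos_right hmp (pow_pos (eucl_pos hw) 2))
        (hP₁.mul_sq_le w)
  have hPu : ∀ τ ∈ Set.Icc t₀ T, (∀ s ∈ Set.Icc t₀ τ, eucl (x s) ≤ r₀) →
      ∀ z, z ⬝ᵥ (P τ *ᵥ z) ≤ M * eucl z ^ 2 := fun τ hτ hsmall => by
    have hmono : Set.Icc t₀ τ ⊆ Set.Icc t₀ T := Set.Icc_subset_Icc_right hτ.2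
    exact hup t₀ τ ht₀ hτ.1 x P (hxc.mono hmono)
      (fun s hs => (abs_yawErr_le _).trans ((hsmall s hs).trans (min_le_left _ _)))
      (hric.mono le_rfl hτ.2) (fun s hs => hPs s (hmono hs))
      (fun z => by rw [hPt₀]; exact hP₂.le_mul_sq z)
  have hdecay : ∀ τ ∈ Set.Icc t₀ T, (∀ s ∈ Set.Icc t₀ τ, eucl (x s) ≤ r₀) →
      eucl (x τ) ≤ k * Real.exp (-l * (τ - t₀)) * eucl x₀ := fun τ hτ hsmall => by
    have hmono : Set.Icc t₀ τ ⊆ Set.Icc t₀ T := Set.Icc_subset_Icc_right hτ.2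
    have := (hric.mono le_rfl hτ.2).error_le hτ.1 (l := l) (s₁ := s₁) (p₃ := p₁) hm0 hp₁ hM
      (by rw [hl]; field_simp; exact le_rfl) hs₁.le (fun s hs => hPs s (hmono hs))
      (fun s hs => hG0 s (hmono hs)) (fun s hs => hSl s (hmono hs))
      (fun s hs => hPl s (hmono hs))
      (fun s hs => hPu s (hmono hs) fun u hu => hsmall u ⟨hu.1, hu.2.trans hs.2⟩)
      (fun z => by rw [hPt₀]; exact hP₁.mul_sq_le z)
      (r := fun s => ρ s (x s)) (fun s hs => (hxd s (hmono hs)).mono hmono)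
      (fun s hs => by
        have h1 := hsmall s hs
        have h2 := hquad s (ht₀.trans hs.1) (x s)
          (h1.trans ((min_le_right _ _).trans (min_le_left _ _)))
        have h3 : |yawErr (x s)| ^ 2 ≤ eucl (x s) * r₀ := by
          rw [sq]
          exact mul_le_mul (abs_yawErr_le _) ((abs_yawErr_le _).trans h1) (abs_nonneg _)
            (eucl_nonneg _)
        have h4 : c * |yawErr (x s)| ^ 2 ≤ |c| * (eucl (x s) * r₀) :=
          mul_le_mul (le_abs_self c) h3 (sq_nonneg _) (abs_nonneg c)
        calc 4 * M * eucl (ρ s (x s)) ≤ 4 * M * (|c| * (eucl (x s) * r₀)) :=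
              mul_le_mul_of_nonneg_left (h2.trans h4) (by positivity)
          _ = 4 * M * |c| * r₀ * eucl (x s) := by ring
          _ ≤ s₁ * eucl (x s) := mul_le_mul_of_nonneg_right hr₀c (eucl_nonneg _))
    rwa [hxt₀] at this
  have hx₀r : (k + 1) * eucl x₀ < r₀ := by
    rwa [lt_div_iff₀ (by positivity), mul_comm] at hx₀
  have hkx : 0 ≤ k * eucl x₀ := mul_nonneg hk0.le (eucl_nonneg _)
  -- The upper bound of P and the decay hold as long as |x| ≤ r₀, and the decay improves this to a
  -- strict inequality.
  have hsmall : ∀ t ∈ Set.Icc t₀ T, eucl (x t) < r₀ := by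
    refine forall_lt_of_bootstrap (continuous_eucl.comp_continuousOn hxc) ?_ fun τ hτ hle => ?_
    · rw [hxt₀]
      linarith
    · refine lt_of_le_of_lt (hdecay τ hτ hle) ?_
      have h1 : Real.exp (-l * (τ - t₀)) ≤ 1 := by
        rw [Real.exp_le_one_iff]
        nlinarith [hτ.1]
      have h2 := mul_le_mul_of_nonneg_left h1 hkx
      linarith [eucl_nonneg x₀]
  intro t ht
  have hle : ∀ s ∈ Set.Icc t₀ t, eucl (x s) ≤ r₀ := fun s hs =>
    (hsmall s ⟨hs.1, hs.2.trans ht.2⟩).le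
  exact ⟨hdecay t ht hle, hPs t ht, hPl t ht, hPu t ht hle⟩

end APriori

/-! ### Families of functions that are uniformly bounded and Lipschitz -/

section UnifLip

variable {E : Type} [PseudoMetricSpace E] {I : Set ℝ} {B : Set E}

/-- The functions `F t`, for `t ∈ I`, are bounded and Lipschitz on `B` with a common constant. -/
def UnifLip (I : Set ℝ) (B : Set E) (F : ℝ → E → ℝ) : Prop :=
  ∃ C, 0 ≤ C ∧ (∀ t ∈ I, ∀ z ∈ B, |F t z| ≤ C) ∧
    ∀ t ∈ I, ∀ z ∈ B, ∀ z' ∈ B, |F t z - F t z'| ≤ C * dist z z'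

theorem UnifLip.add {F G : ℝ → E → ℝ} (hF : UnifLip I B F) (hG : UnifLip I B G) :
    UnifLip I B fun t z => F t z + G t z := by
  obtain ⟨C, hC, hF1, hF2⟩ := hF
  obtain ⟨C', hC', hG1, hG2⟩ := hG
  refine ⟨C + C', by positivity, fun t ht z hz => ?_, fun t ht z hz z' hz' => ?_⟩
  · exact (abs_add_le _ _).trans (add_le_add (hF1 t ht z hz) (hG1 t ht z hz))
  · rw [add_sub_add_comm, add_mul]
    exact (abs_add_le _ _).trans (add_le_add (hF2 t ht z hz z' hz') (hG2 t ht z hz z' hz'))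

theorem UnifLip.mul {F G : ℝ → E → ℝ} (hF : UnifLip I B F) (hG : UnifLip I B G) :
    UnifLip I B fun t z => F t z * G t z := by
  obtain ⟨C, hC, hF1, hF2⟩ := hF
  obtain ⟨C', hC', hG1, hG2⟩ := hG
  refine ⟨2 * C * C' + C * C', by positivity, fun t ht z hz => ?_, fun t ht z hz z' hz' => ?_⟩
  · rw [abs_mul]
    have := mul_le_mul (hF1 t ht z hz) (hG1 t ht z hz) (abs_nonneg _) hC
    have h0 := mul_nonneg hC hC'
    linarith
  · have e : F t z * G t z - F t z' * G t z'
        = F t z * (G t z - G t z') + (F t z - F t z') * G t z' := by ring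
    rw [e]
    refine (abs_add_le _ _).trans ?_
    rw [abs_mul, abs_mul]
    have h1 := mul_le_mul (hF1 t ht z hz) (hG2 t ht z hz z' hz') (abs_nonneg _) hC
    have h2 := mul_le_mul (hF2 t ht z hz z' hz') (hG1 t ht z' hz') (abs_nonneg _)
      (mul_nonneg hC dist_nonneg)
    have h0 := mul_nonneg (mul_nonneg hC hC') (dist_nonneg (x := z) (y := z'))
    linarith

theorem unifLip_of_bounded {f : ℝ → ℝ} {C : ℝ} (hf : ∀ t ∈ I, |f t| ≤ C) :
    UnifLip I B fun t _ => f t := by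
  refine ⟨|C|, abs_nonneg C, fun t ht _ _ => (hf t ht).trans (le_abs_self C),
    fun t _ z _ z' _ => ?_⟩
  rw [sub_self, abs_zero]
  positivity

theorem unifLip_const (c : ℝ) : UnifLip I B fun _ _ => c :=
  unifLip_of_bounded (C := |c|) fun _ _ => le_rfl

theorem UnifLip.neg {F : ℝ → E → ℝ} (hF : UnifLip I B F) : UnifLip I B fun t z => -F t z := by
  simpa using (unifLip_const (I := I) (B := B) (-1)).mul hF

theorem UnifLip.sub {F G : ℝ → E → ℝ} (hF : UnifLip I B F) (hG : UnifLip I B G) :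
    UnifLip I B fun t z => F t z - G t z := by
  simpa [sub_eq_add_neg] using hF.add hG.neg

theorem UnifLip.sum {ι : Type} (s : Finset ι) {F : ι → ℝ → E → ℝ}
    (hF : ∀ i ∈ s, UnifLip I B (F i)) : UnifLip I B fun t z => ∑ i ∈ s, F i t z := by
  classical
  induction s using Finset.induction_on with
  | empty => simpa using unifLip_const 0
  | insert i s hi ih =>
    simp only [Finset.sum_insert hi]
    exact (hF i (Finset.mem_insert_self i s)).add
      (ih fun j hj => hF j (Finset.mem_insert_of_mem hj))

theorem UnifLip.comp_lipschitz {F : ℝ → E → ℝ} (hF : UnifLip I B F) {φ : ℝ → ℝ}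
    (hφ : ∀ u v, |φ u - φ v| ≤ |u - v|) {c : ℝ} (hc : ∀ u, |φ u| ≤ c) :
    UnifLip I B fun t z => φ (F t z) := by
  obtain ⟨C, hC, -, hF2⟩ := hF
  have hc0 : 0 ≤ c := (abs_nonneg _).trans (hc 0)
  refine ⟨C + c, by positivity, fun t _ z _ => (hc _).trans (by linarith),
    fun t ht z hz z' hz' => (hφ _ _).trans ((hF2 t ht z hz z' hz').trans ?_)⟩
  exact mul_le_mul_of_nonneg_right (by linarith) dist_nonneg

theorem UnifLip.matrix_mul {l m n : Type} [Fintype m] {M : ℝ → E → Matrix l m ℝ}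
    {N : ℝ → E → Matrix m n ℝ} (hM : ∀ i j, UnifLip I B fun t z => M t z i j)
    (hN : ∀ i j, UnifLip I B fun t z => N t z i j) (i : l) (j : n) :
    UnifLip I B fun t z => (M t z * N t z) i j := by
  simp only [Matrix.mul_apply]
  exact UnifLip.sum _ fun k _ => (hM i k).mul (hN k j)

theorem UnifLip.matrix_mulVec {m n : Type} [Fintype n] {M : ℝ → E → Matrix m n ℝ}
    {v : ℝ → E → n → ℝ} (hM : ∀ i j, UnifLip I B fun t z => M t z i j)
    (hv : ∀ i, UnifLip I B fun t z => v t z i) (i : m) :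
    UnifLip I B fun t z => (M t z *ᵥ v t z) i := by
  simp only [Matrix.mulVec, dotProduct]
  exact UnifLip.sum _ fun k _ => (hM i k).mul (hv k)

theorem unifLip_of_continuousOn {f : ℝ → ℝ} {a b : ℝ} (hf : ContinuousOn f (Set.Icc a b)) :
    UnifLip (Set.Icc a b) B fun t _ => f t := by
  obtain ⟨C, hC⟩ := isCompact_Icc.exists_bound_of_continuousOn hf
  exact unifLip_of_bounded hC

theorem exists_lipschitzOnWith_pi {ι : Type} [Fintype ι] {F : ℝ → E → ι → ℝ}
    (hF : ∀ i, UnifLip I B fun t z => F t z i) :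
    ∃ K : NNReal, ∀ t ∈ I, LipschitzOnWith K (F t) B := by
  choose C hC0 _ hC using hF
  refine ⟨⟨∑ i, C i, Finset.sum_nonneg fun i _ => hC0 i⟩, fun t ht => ?_⟩
  refine LipschitzOnWith.of_dist_le_mul fun z hz z' hz' => ?_
  change dist (F t z) (F t z') ≤ (∑ i, C i) * dist z z'
  refine (dist_pi_le_iff (mul_nonneg (Finset.sum_nonneg fun i _ => hC0 i) dist_nonneg)).2
    fun i => ?_
  rw [Real.dist_eq]
  refine (hC i t ht z hz z' hz').trans (mul_le_mul_of_nonneg_right ?_ dist_nonneg)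
  exact Finset.single_le_sum (fun j _ => hC0 j) (Finset.mem_univ i)

end UnifLip

/-! ### Existence of solutions of the observer -/

section Existence

variable {ωB aT : ℝ → V3} {R : ℝ → M3} {y : ℝ → V3} {S : ℝ → M7} {D : ℝ → M3}
  {ρ : ℝ → V7 → V7}

/-- The state space of the observer error and the Riccati matrix. -/
abbrev ObsState : Type := V7 × (Idx7 → Idx7 → ℝ)

/-- The right-hand side of the joint differential equation. -/
noncomputable def obsField (ωB aT : ℝ → V3) (R : ℝ → M3) (y : ℝ → V3) (S : ℝ → M7) (D : ℝ → M3)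
    (ρ : ℝ → V7 → V7) (t : ℝ) (z : ObsState) : ObsState :=
  (errField ωB aT R y D ρ t z.1 (Matrix.of z.2), riccatiField ωB aT R y S D t z.1 (Matrix.of z.2))

theorem unifLip_fst (I : Set ℝ) (r : ℝ) (i : Idx7) :
    UnifLip I (Metric.closedBall (0 : ObsState) r) fun _ z => z.1 i := by
  refine ⟨|r| + 1, by positivity, fun t _ z hz => ?_, fun t _ z _ z' _ => ?_⟩
  · have h1 := mem_closedBall_zero_iff.1 hz
    have h2 : |z.1 i| ≤ ‖z.1‖ := norm_le_pi_norm z.1 i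
    linarith [norm_fst_le z, le_abs_self r]
  · have h1 : dist (z.1 i) (z'.1 i) ≤ dist z z' :=
      (dist_le_pi_dist z.1 z'.1 i).trans (le_max_left _ _)
    rw [← Real.dist_eq]
    refine h1.trans (le_mul_of_one_le_left dist_nonneg ?_)
    linarith [abs_nonneg r]

theorem unifLip_snd (I : Set ℝ) (r : ℝ) (i j : Idx7) :
    UnifLip I (Metric.closedBall (0 : ObsState) r) fun _ z => z.2 i j := by
  refine ⟨|r| + 1, by positivity, fun t _ z hz => ?_, fun t _ z _ z' _ => ?_⟩
  · have h1 := mem_closedBall_zero_iff.1 hz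
    have h2 : |z.2 i j| ≤ ‖z.2‖ := (norm_le_pi_norm (z.2 i) j).trans (norm_le_pi_norm z.2 i)
    linarith [norm_snd_le z, le_abs_self r]
  · have h1 : dist (z.2 i j) (z'.2 i j) ≤ dist z z' :=
      ((dist_le_pi_dist (z.2 i) (z'.2 i) j).trans (dist_le_pi_dist z.2 z'.2 i)).trans
        (le_max_right _ _)
    rw [← Real.dist_eq]
    refine h1.trans (le_mul_of_one_le_left dist_nonneg ?_)
    linarith [abs_nonneg r]

theorem IsQuadraticRemainder.apply_zero (hρ : IsQuadraticRemainder ρ) {t : ℝ} (ht : 0 ≤ t) :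
    ρ t 0 = 0 := by
  obtain ⟨r, c, hr, h⟩ := hρ.quad
  have h1 := h t ht 0 (by simpa using hr.le)
  have h2 : yawErr 0 = 0 := rfl
  rw [h2, abs_zero] at h1
  by_contra hne
  have := eucl_pos hne
  norm_num at h1
  linarith

/-- Boundedness follows from the Lipschitz property because ρ vanishes at the origin. The factor N
passes between the Euclidean norm of the hypotheses and the sup norm of the state space. -/
theorem IsQuadraticRemainder.unifLip (hρ : IsQuadraticRemainder ρ) {t₀ : ℝ} (ht₀ : 0 ≤ t₀)
    (T r : ℝ) (i : Idx7) :
    UnifLip (Set.Icc t₀ T) (Metric.closedBall (0 : ObsState) r) fun t z => ρ t z.1 i := by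
  set N : ℝ := (Fintype.card Idx7 : ℝ) with hN
  have hN0 : 0 ≤ N := Nat.cast_nonneg _
  obtain ⟨L, hL⟩ := hρ.lip T (N * |r|)
  have hball : ∀ z ∈ Metric.closedBall (0 : ObsState) r, eucl z.1 ≤ N * |r| := fun z hz => by
    have h1 := mem_closedBall_zero_iff.1 hz
    exact (eucl_le_card_mul_norm z.1).trans (mul_le_mul_of_nonneg_left
      ((norm_fst_le z).trans (h1.trans (le_abs_self r))) hN0)
  have hd : ∀ t ∈ Set.Icc t₀ T, ∀ x x' : V7, eucl x ≤ N * |r| → eucl x' ≤ N * |r| →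
      |ρ t x i - ρ t x' i| ≤ |L| * (N * ‖x - x'‖) := fun t ht x x' hx hx' => by
    have h1 := (abs_apply_le_eucl (ρ t x - ρ t x') i).trans
      (hL t (ht₀.trans ht.1) ht.2 x x' hx hx')
    refine h1.trans ?_
    exact mul_le_mul (le_abs_self L) (eucl_le_card_mul_norm _) (eucl_nonneg _) (abs_nonneg L)
  refine ⟨|L| * N * (|r| + 1), by positivity, fun t ht z hz => ?_, fun t ht z hz z' hz' => ?_⟩
  · have h1 := hd t ht z.1 0 (hball z hz) (by simpa using by positivity)
    rw [hρ.apply_zero (ht₀.trans ht.1), Pi.zero_apply, sub_zero, sub_zero, ← mul_assoc] at h1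
    refine h1.trans (mul_le_mul_of_nonneg_left ?_ (by positivity))
    linarith [norm_fst_le z, mem_closedBall_zero_iff.1 hz, le_abs_self r]
  · have h1 := hd t ht z.1 z'.1 (hball z hz) (hball z' hz')
    rw [← mul_assoc] at h1
    refine h1.trans (mul_le_mul ?_ ?_ (norm_nonneg _) (by positivity))
    · have : 0 ≤ |L| * N := by positivity
      nlinarith [abs_nonneg r]
    · rw [← dist_eq_norm]
      exact le_max_left _ _

theorem IsErrorSystem.unifLip_Atheta (h : IsErrorSystem ωB aT R y S D) {t₀ : ℝ} (ht₀ : 0 ≤ t₀)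
    (T r : ℝ) (i j : Idx7) :
    UnifLip (Set.Icc t₀ T) (Metric.closedBall (0 : ObsState) r)
      fun t z => Atheta (ωB t) (attEst (R t) z.1) (aT t) i j := by
  have hsub : Set.Icc t₀ T ⊆ Set.Ici 0 := fun s hs => ht₀.trans hs.1
  have hrod : ∀ i j, UnifLip (Set.Icc t₀ T) (Metric.closedBall (0 : ObsState) r)
      fun _ z => rodrigues (yawErr z.1) e3 i j := fun i j => by
    simp only [rodrigues, Matrix.add_apply, Matrix.smul_apply, smul_eq_mul, yawErr]
    have hθ := unifLip_fst (Set.Icc t₀ T) r (Sum.inr 0)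
    refine ((unifLip_const _).add ((hθ.comp_lipschitz (φ := Real.sin) ?_
      Real.abs_sin_le_one).mul (unifLip_const _))).add
      (((unifLip_const 1).sub (hθ.comp_lipschitz (φ := Real.cos) ?_ Real.abs_cos_le_one)).mul
        (unifLip_const _))
    · exact fun u v => Real.abs_sin_sub_sin_le u v
    · exact fun u v => Real.abs_cos_sub_cos_le u v
  have hest : ∀ i j, UnifLip (Set.Icc t₀ T) (Metric.closedBall (0 : ObsState) r)
      fun t z => (attEst (R t) z.1)ᵀ i j := fun i j =>
    UnifLip.matrix_mul hrod
      (fun i j => unifLip_of_continuousOn ((h.R_cont.mono hsub).matrix_elem i j)) j i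
  have hcol : ∀ i, UnifLip (Set.Icc t₀ T) (Metric.closedBall (0 : ObsState) r)
      fun t z => ((attEst (R t) z.1)ᵀ *ᵥ (skew (aT t) *ᵥ e3)) i :=
    UnifLip.matrix_mulVec hest fun i => unifLip_of_continuousOn
      (continuousOn_pi.1 ((h.a_cont.mono hsub).skew.matrix_mulVec continuousOn_const) i)
  rcases i with (i | i) | i <;> rcases j with (j | j) | j <;>
    simp only [Atheta, Matrix.fromBlocks_apply₁₁, Matrix.fromBlocks_apply₁₂,
      Matrix.fromBlocks_apply₂₁, Matrix.fromBlocks_apply₂₂, Matrix.replicateCol_apply,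
      Sum.elim_inl, Sum.elim_inr, Matrix.neg_apply, Matrix.zero_apply, Pi.zero_apply] <;>
    first
      | exact unifLip_const _
      | exact (unifLip_of_continuousOn ((h.ω_cont.mono hsub).skew.matrix_elem _ _)).neg
      | exact hcol _

theorem IsErrorSystem.exists_lipschitz_obsField (h : IsErrorSystem ωB aT R y S D)
    (hρ : IsQuadraticRemainder ρ) {t₀ : ℝ} (ht₀ : 0 ≤ t₀) (T r : ℝ) :
    ∃ K : NNReal, ∀ t ∈ Set.Icc t₀ T,
      LipschitzOnWith K (obsField ωB aT R y S D ρ t) (Metric.closedBall 0 r) := by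
  have hsub : Set.Icc t₀ T ⊆ Set.Ici 0 := fun s hs => ht₀.trans hs.1
  have hA := h.unifLip_Atheta ht₀ T r
  have hG : ∀ i j, UnifLip (Set.Icc t₀ T) (Metric.closedBall (0 : ObsState) r)
      fun t _ => infoRate (y t) (D t) i j := fun i j =>
    unifLip_of_continuousOn ((h.continuousOn_infoRate.mono hsub).matrix_elem i j)
  have hS : ∀ i j, UnifLip (Set.Icc t₀ T) (Metric.closedBall (0 : ObsState) r)
      fun t _ => S t i j := fun i j =>
    unifLip_of_continuousOn ((h.S_weight.1.mono hsub).matrix_elem i j)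
  have hx := unifLip_fst (Set.Icc t₀ T) r
  have hP : ∀ i j, UnifLip (Set.Icc t₀ T) (Metric.closedBall (0 : ObsState) r)
      fun _ z => (Matrix.of z.2 : M7) i j := unifLip_snd (Set.Icc t₀ T) r
  obtain ⟨K₁, hK₁⟩ := exists_lipschitzOnWith_pi
    (F := fun t (z : ObsState) => errField ωB aT R y D ρ t z.1 (Matrix.of z.2)) fun i => by
      simp only [errField_eq, Pi.add_apply, Pi.sub_apply]
      exact ((UnifLip.matrix_mulVec hA hx i).sub
        (UnifLip.matrix_mulVec hP (UnifLip.matrix_mulVec hG hx) i)).add (hρ.unifLip ht₀ T r i)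
  have hrow : ∀ i, ∃ K : NNReal, ∀ t ∈ Set.Icc t₀ T, LipschitzOnWith K
      (fun z : ObsState => riccatiField ωB aT R y S D t z.1 (Matrix.of z.2) i)
      (Metric.closedBall 0 r) := fun i => exists_lipschitzOnWith_pi fun j => by
    simp only [riccatiField_eq, Matrix.add_apply, Matrix.sub_apply]
    exact (((UnifLip.matrix_mul hA hP i j).add
      (UnifLip.matrix_mul hP (fun i j => hA j i) i j)).sub
      (UnifLip.matrix_mul (UnifLip.matrix_mul hP hG) hP i j)).add (hS i j)
  choose K₂ hK₂ using hrow
  refine ⟨max K₁ (∑ i, K₂ i), fun t ht => (hK₁ t ht).prodMk ?_⟩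
  refine LipschitzOnWith.of_dist_le_mul fun z hz z' hz' => ?_
  refine (dist_pi_le_iff (by positivity)).2 fun i => ?_
  refine ((hK₂ i t ht).dist_le_mul z hz z' hz').trans
    (mul_le_mul_of_nonneg_right ?_ dist_nonneg)
  have : K₂ i ≤ ∑ i, K₂ i := Finset.single_le_sum (fun j _ => (K₂ j).2) (Finset.mem_univ i)
  exact_mod_cast this

theorem IsErrorSystem.continuousOn_obsField (h : IsErrorSystem ωB aT R y S D)
    (hρ : IsQuadraticRemainder ρ) (z : ObsState) :
    ContinuousOn (fun t => obsField ωB aT R y S D ρ t z) (Set.Ici 0) := by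
  have hA : ContinuousOn (fun t => Atheta (ωB t) (attEst (R t) z.1) (aT t)) (Set.Ici 0) :=
    h.ω_cont.Atheta (h.R_cont.attEst continuousOn_const) h.a_cont
  have hG := h.continuousOn_infoRate
  have hr : ContinuousOn (fun t => ρ t z.1) (Set.Ici 0) :=
    hρ.cont.comp (f := fun t : ℝ => (t, z.1)) (by fun_prop) fun t ht => ⟨ht, Set.mem_univ _⟩
  refine ContinuousOn.prodMk ?_ ?_
  · simp only [errField_eq]
    exact ((hA.matrix_mulVec continuousOn_const).sub (continuousOn_const.matrix_mulVec
      (hG.matrix_mulVec continuousOn_const))).add hr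
  · simp only [riccatiField_eq]
    exact (((hA.matrix_mul continuousOn_const).add
      (continuousOn_const.matrix_mul hA.matrix_transpose)).sub
      ((continuousOn_const.matrix_mul hG).matrix_mul continuousOn_const)).add h.S_weight.1

theorem isObserverSolution_of_solvesOn {J : Set ℝ} {z : ℝ → ObsState}
    (hz : SolvesOn (obsField ωB aT R y S D ρ) J z) :
    IsObserverSolution (errField ωB aT R y D ρ) (riccatiField ωB aT R y S D) J
      (fun t => (z t).1) (fun t => Matrix.of (z t).2) := fun t ht => by
  have h1 := (hasFDerivAt_fst (𝕜 := ℝ) (p := z t)).comp_hasDerivWithinAt t (hz t ht)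
  have h2 := (hasFDerivAt_snd (𝕜 := ℝ) (p := z t)).comp_hasDerivWithinAt t (hz t ht)
  exact ⟨h1, fun i j => hasDerivWithinAt_pi.1 (hasDerivWithinAt_pi.1 h2 i) j⟩

/-- The a priori estimates apply to every solution on a compact interval. They exclude blow-up,
which gives existence, and on [t₀, t] they give the decay of any solution on a half-open interval
containing t. -/
theorem IsErrorSystem.locallyExpStable (h : IsErrorSystem ωB aT R y S D)
    (hρ : IsQuadraticRemainder ρ) :
    LocallyExpStable (errField ωB aT R y D ρ) (riccatiField ωB aT R y S D) := by
  intro p₁ p₂ hp₁ hp₂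
  obtain ⟨r, k, l, m, M, hr, hk, hl, hm, hM, key⟩ := h.exists_apriori hρ hp₁ hp₂
  refine ⟨r, k, l, hr, hk, hl, fun t₀ ht₀ x₀ P₀ hx₀ hP₁ hP₂ => ⟨?_, ?_⟩⟩
  · have hbound : ∀ T, t₀ ≤ T → ∀ z : ℝ → ObsState, z t₀ = (x₀, P₀) →
        SolvesOn (obsField ωB aT R y S D ρ) (Set.Icc t₀ T) z →
        ∀ t ∈ Set.Icc t₀ T, ‖z t‖ ≤ max (k * eucl x₀) M := fun T hT z hz0 hz t ht => by
      obtain ⟨h1, h2, h3, h4⟩ := key t₀ ht₀ x₀ P₀ hx₀ hP₁ hP₂ T hT _ _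
        (isObserverSolution_of_solvesOn hz) (by simp [hz0]) (by rw [hz0]; rfl) t ht
      refine max_le_max ((norm_le_eucl _).trans (h1.trans ?_)) ?_
      · have e1 : Real.exp (-l * (t - t₀)) ≤ 1 := by
          rw [Real.exp_le_one_iff]
          nlinarith [ht.1]
        have := mul_le_mul_of_nonneg_left e1 (mul_nonneg hk.le (eucl_nonneg x₀))
        linarith
      · refine (pi_norm_le_iff_of_nonneg hM.le).2 fun i =>
          (pi_norm_le_iff_of_nonneg hM.le).2 fun j => ?_
        exact abs_apply_le_of_quadForm h2
          (fun z => (mul_nonneg hm.le (sq_nonneg _)).trans (h3 z)) h4 i j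
    obtain ⟨z, hz0, hz⟩ := exists_solvesOn_Ici
      (fun z => (h.continuousOn_obsField hρ z).mono (Set.Ici_subset_Ici.2 ht₀))
      (h.exists_lipschitz_obsField hρ ht₀) hbound
    refine ⟨fun t => (z t).1, fun t => Matrix.of (z t).2, isObserverSolution_of_solvesOn hz,
      by simp [hz0], by simp only [hz0]; rfl, fun t ht => ?_⟩
    obtain ⟨-, h2, h3, -⟩ := key t₀ ht₀ x₀ P₀ hx₀ hP₁ hP₂ t ht _ _
      (isObserverSolution_of_solvesOn (hz.mono Set.Icc_subset_Ici_self)) (by simp [hz0])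
      (by rw [hz0]; rfl) t (Set.right_mem_Icc.2 ht)
    exact posDef_of_quadForm h2 fun w hw =>
      lt_of_lt_of_le (mul_pos hm (pow_pos (eucl_pos hw) 2)) (h3 w)
  · intro T _ x P hsol hx hP t ht
    have hsub : Set.Icc t₀ t ⊆ Set.Ico t₀ T := fun s hs => ⟨hs.1, hs.2.trans_lt ht.2⟩
    exact (key t₀ ht₀ x₀ P₀ hx₀ hP₁ hP₂ t ht.1 x P
      (fun s hs => ⟨(hsol s (hsub hs)).1.mono hsub, (hsol s (hsub hs)).2.mono hsub⟩) hx hP t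
      (Set.right_mem_Icc.2 ht.1)).1

end Existence

/-! ### The remainder of the unexpanded dynamics -/

section ExactRemainder

variable {ωB aT : ℝ → V3} {R : ℝ → M3} {y : ℝ → V3} {S : ℝ → M7} {D : ℝ → M3}

noncomputable section

/-- The second-order terms of the velocity error in the yaw error. -/
def velRemainder (R : M3) (a : V3) (θ : ℝ) : V3 :=
  Rᵀ *ᵥ ((Real.cos θ - 1 + θ * Real.sin θ) • (skew e3 *ᵥ (skew a *ᵥ e3))
    + (Real.sin θ - θ * Real.cos θ) • (skew a *ᵥ e3))

/-- The remainder of the unexpanded error dynamics. -/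
def exactRemainder (aT : ℝ → V3) (R : ℝ → M3) (t : ℝ) (x : V7) : V7 :=
  Sum.elim (Sum.elim 0 (velRemainder (R t) (aT t) (yawErr x))) 0

end

theorem skew_mulVec_e3 (a : V3) : skew a *ᵥ e3 = ![a 1, -a 0, 0] := by
  ext i
  fin_cases i <;> simp [skew, e3, Matrix.mulVec, dotProduct, Fin.sum_univ_three]

theorem skew_e3_mulVec_skew_mulVec_e3 (a : V3) :
    skew e3 *ᵥ (skew a *ᵥ e3) = ![a 0, a 1, 0] := by
  rw [skew_mulVec_e3]
  ext i
  fin_cases i <;> simp [skew, e3, Matrix.mulVec, dotProduct, Fin.sum_univ_three]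

/-- By orthogonality the left side is Rᵀ(exp(-θe₃^×) - 1)a. The matrix `Atheta` uses R̂ rather than
R, so the term removed is θ exp(-θe₃^×)(a × e₃) before applying Rᵀ. What remains has the
coefficients cos θ - 1 + θ sin θ and sin θ - θ cos θ, which are both O(θ²). -/
theorem velRemainder_eq (R : M3) (a : V3) (x : V7) :
    (attEst R x)ᵀ *ᵥ ((1 - rodrigues (yawErr x) e3) *ᵥ a)
      = yawErr x • ((attEst R x)ᵀ *ᵥ (skew a *ᵥ e3)) + velRemainder R a (yawErr x) := by
  set θ := yawErr x with hθ
  have h1 : (rodrigues θ e3)ᵀ *ᵥ ((1 - rodrigues θ e3) *ᵥ a)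
      = θ • ((rodrigues θ e3)ᵀ *ᵥ (skew a *ᵥ e3))
        + ((Real.cos θ - 1 + θ * Real.sin θ) • (skew e3 *ᵥ (skew a *ᵥ e3))
          + (Real.sin θ - θ * Real.cos θ) • (skew a *ᵥ e3)) := by
    have h := Real.sin_sq_add_cos_sq θ
    rw [rodrigues_e3, skew_e3_mulVec_skew_mulVec_e3, skew_mulVec_e3]
    ext i
    fin_cases i <;>
      simp [Matrix.mulVec, dotProduct, Fin.sum_univ_three, Matrix.sub_apply]
    · linear_combination (-a 0) * h
    · linear_combination (-a 1) * h
  rw [attEst, Matrix.transpose_mul, ← Matrix.mulVec_mulVec, ← hθ, h1, ← Matrix.mulVec_mulVec,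
    Matrix.mulVec_add, Matrix.mulVec_smul, velRemainder]

theorem exactErrField_eq : exactErrField ωB aT R y D =
    errField ωB aT R y D (exactRemainder aT R) := by
  funext t x P
  rw [exactErrField, errField, Atheta_mulVec, velRemainder_eq, exactRemainder, sub_add_eq_add_sub]
  congr 1
  ext i
  rcases i with (i | i) | i <;> simp [add_assoc]

/-- One estimate serves two purposes: with r fixed it is the local Lipschitz property, and with v =
0, r = |u| and φ(0) = 0 it is the quadratic bound. -/
theorem abs_sub_le_of_hasDerivAt {φ φ' : ℝ → ℝ} (hφ : ∀ u, HasDerivAt φ (φ' u) u)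
    (hb : ∀ u, |φ' u| ≤ |u|) {r u v : ℝ} (hu : |u| ≤ r) (hv : |v| ≤ r) :
    |φ u - φ v| ≤ r * |u - v| := by
  have := (convex_Icc (-r) r).norm_image_sub_le_of_norm_hasDerivWithin_le (f := φ) (f' := φ')
    (C := r) (fun w _ => (hφ w).hasDerivWithinAt)
    (fun w hw => (hb w).trans (abs_le.2 hw)) (abs_le.1 hv) (abs_le.1 hu)
  simpa using this

theorem hasDerivAt_cos_remainder (θ : ℝ) :
    HasDerivAt (fun θ => Real.cos θ - 1 + θ * Real.sin θ) (θ * Real.cos θ) θ := by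
  have := ((Real.hasDerivAt_cos θ).sub_const 1).add
    ((hasDerivAt_id θ).mul (Real.hasDerivAt_sin θ))
  refine this.congr_deriv ?_
  simp

theorem hasDerivAt_sin_remainder (θ : ℝ) :
    HasDerivAt (fun θ => Real.sin θ - θ * Real.cos θ) (θ * Real.sin θ) θ := by
  have := (Real.hasDerivAt_sin θ).sub ((hasDerivAt_id θ).mul (Real.hasDerivAt_cos θ))
  refine this.congr_deriv ?_
  simp

theorem eucl_velRemainder_sub_le {R : M3} (hR : R ∈ Matrix.specialOrthogonalGroup (Fin 3) ℝ)
    {a : V3} {c : ℝ} (ha : eucl a ≤ c) {r θ θ' : ℝ} (hθ : |θ| ≤ r) (hθ' : |θ'| ≤ r) :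
    eucl (velRemainder R a θ - velRemainder R a θ') ≤ 2 * c * r * |θ - θ'| := by
  have h1 := abs_sub_le_of_hasDerivAt hasDerivAt_cos_remainder (fun u => by
    rw [abs_mul]
    exact mul_le_of_le_one_right (abs_nonneg u) (Real.abs_cos_le_one u)) hθ hθ'
  have h2 := abs_sub_le_of_hasDerivAt hasDerivAt_sin_remainder (fun u => by
    rw [abs_mul]
    exact mul_le_of_le_one_right (abs_nonneg u) (Real.abs_sin_le_one u)) hθ hθ'
  have hv := (eucl_skew_e3_le a).trans ha
  have hu : eucl (skew e3 *ᵥ (skew a *ᵥ e3)) ≤ c := by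
    refine (eucl_skew_mulVec_le _ _).trans ?_
    rw [eucl_e3, one_mul]
    exact hv
  have e : velRemainder R a θ - velRemainder R a θ' = Rᵀ *ᵥ
      (((Real.cos θ - 1 + θ * Real.sin θ) - (Real.cos θ' - 1 + θ' * Real.sin θ'))
          • (skew e3 *ᵥ (skew a *ᵥ e3))
        + ((Real.sin θ - θ * Real.cos θ) - (Real.sin θ' - θ' * Real.cos θ'))
          • (skew a *ᵥ e3)) := by
    rw [velRemainder, velRemainder, ← Matrix.mulVec_sub]
    congr 1
    module
  rw [e, eucl_rot_transpose_mulVec hR]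
  refine (eucl_add_le _ _).trans ?_
  rw [eucl_smul, eucl_smul]
  have h3 : 0 ≤ r * |θ - θ'| := mul_nonneg ((abs_nonneg _).trans hθ) (abs_nonneg _)
  have h4 := mul_le_mul h1 hu (eucl_nonneg _) h3
  have h5 := mul_le_mul h2 hv (eucl_nonneg _) h3
  linarith

theorem eucl_exactRemainder_sub (t : ℝ) (x x' : V7) :
    eucl (exactRemainder aT R t x - exactRemainder aT R t x')
      = eucl (velRemainder (R t) (aT t) (yawErr x) - velRemainder (R t) (aT t) (yawErr x')) := by
  have e : exactRemainder aT R t x - exactRemainder aT R t x' = Sum.elim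
      (Sum.elim (0 : V3) (velRemainder (R t) (aT t) (yawErr x)
        - velRemainder (R t) (aT t) (yawErr x'))) (0 : Fin 1 → ℝ) := by
    ext i
    rcases i with (i | i) | i <;> simp [exactRemainder]
  have h : eucl (exactRemainder aT R t x - exactRemainder aT R t x') ^ 2
      = eucl (velRemainder (R t) (aT t) (yawErr x)
        - velRemainder (R t) (aT t) (yawErr x')) ^ 2 := by
    rw [e, eucl_sumElim_sq, eucl_sumElim_sq, eucl_zero, eucl_zero]
    ring
  exact (sq_eq_sq₀ (eucl_nonneg _) (eucl_nonneg _)).1 h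

theorem IsErrorSystem.isQuadraticRemainder_exact (h : IsErrorSystem ωB aT R y S D) :
    IsQuadraticRemainder (exactRemainder aT R) := by
  obtain ⟨c, hc⟩ := h.a_bdd
  have hc0 : 0 ≤ c := (eucl_nonneg _).trans (hc 0 le_rfl)
  have hzero : ∀ t, exactRemainder aT R t 0 = 0 := fun t => by
    have h0 : yawErr 0 = 0 := rfl
    ext i
    rcases i with (i | i) | i <;> simp [exactRemainder, velRemainder, h0]
  refine ⟨?_, fun T r => ⟨2 * c * |r|, fun t ht _ x x' hx hx' => ?_⟩,
    1, 2 * c, one_pos, fun t ht x _ => ?_⟩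
  · have hfst : Set.MapsTo (Prod.fst : ℝ × V7 → ℝ) (Set.Ici 0 ×ˢ Set.univ) (Set.Ici 0) :=
      fun q hq => hq.1
    have hR : ContinuousOn (fun q : ℝ × V7 => R q.1) (Set.Ici 0 ×ˢ Set.univ) :=
      h.R_cont.comp continuousOn_fst hfst
    have hv : ContinuousOn (fun q : ℝ × V7 => skew (aT q.1) *ᵥ e3) (Set.Ici 0 ×ˢ Set.univ) :=
      (h.a_cont.skew.matrix_mulVec continuousOn_const).comp continuousOn_fst hfst
    have hθ : Continuous (fun q : ℝ × V7 => yawErr q.2) :=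
      (continuous_apply (Sum.inr 0 : Idx7)).comp continuous_snd
    have hvel : ContinuousOn (fun q : ℝ × V7 => velRemainder (R q.1) (aT q.1) (yawErr q.2))
        (Set.Ici 0 ×ˢ Set.univ) := by
      have h1 : ContinuousOn (fun q : ℝ × V7 =>
          Real.cos (yawErr q.2) - 1 + yawErr q.2 * Real.sin (yawErr q.2))
          (Set.Ici 0 ×ˢ Set.univ) := Continuous.continuousOn (by fun_prop)
      have h2 : ContinuousOn (fun q : ℝ × V7 =>
          Real.sin (yawErr q.2) - yawErr q.2 * Real.cos (yawErr q.2))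
          (Set.Ici 0 ×ˢ Set.univ) := Continuous.continuousOn (by fun_prop)
      have hu : ContinuousOn (fun q : ℝ × V7 => skew e3 *ᵥ (skew (aT q.1) *ᵥ e3))
          (Set.Ici 0 ×ˢ Set.univ) :=
        ContinuousOn.matrix_mulVec (M := fun _ => skew e3) continuousOn_const hv
      exact hR.matrix_transpose.matrix_mulVec ((h1.smul hu).add (h2.smul hv))
    refine continuousOn_pi.2 fun i => ?_
    rcases i with (i | i) | i
    · exact continuousOn_const
    · exact continuousOn_pi.1 hvel i
    · exact continuousOn_const
  · rw [eucl_exactRemainder_sub]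
    refine (eucl_velRemainder_sub_le (h.R_mem t ht) (hc t ht)
      ((abs_yawErr_le x).trans (hx.trans (le_abs_self r)))
      ((abs_yawErr_le x').trans (hx'.trans (le_abs_self r)))).trans ?_
    exact mul_le_mul_of_nonneg_left (abs_yawErr_le (x - x')) (by positivity)
  -- Comparison with the origin on the ball of radius |θ̃| itself makes the Lipschitz estimate
  -- quadratic.
  · have h1 := eucl_exactRemainder_sub (aT := aT) (R := R) t x 0
    rw [hzero, sub_zero] at h1
    rw [h1]
    have h0 : yawErr 0 = 0 := rfl
    refine (eucl_velRemainder_sub_le (h.R_mem t ht) (hc t ht) le_rfl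
      (by rw [h0, abs_zero]; exact abs_nonneg _)).trans (le_of_eq ?_)
    rw [h0, sub_zero]
    ring

end ExactRemainder

theorem lemma3
    (g : ℝ)
    (QB QT : ℝ → M3) (pB vB ωB aB pT vT ωT aT : ℝ → V3)
    (hB : IsRigidMotion g QB pB vB ωB aB)
    (hT : IsRigidMotion g QT pT vT ωT aT)
    (hsep : ∀ t, 0 ≤ t → pB t ≠ pT t)
    (hωB : BddUnifCont ωB) (hωT : BddUnifCont ωT)
    (S : ℝ → M7) (D : ℝ → M3) (hS : IsWeight S) (hD : IsWeight D)
    (δ μ : ℝ) (hδ : 0 < δ) (hμ : 0 < μ)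
    (hPE : BearingPE (bearingI QB pB pT) δ μ)
    (haT : ContinuousOn aT (Set.Ici 0)) (haT' : ∃ c, ∀ t, 0 ≤ t → eucl (aT t) ≤ c)
    (b₀ : V3) (b₁ : ℝ → V3) (hb₀ : b₀ ≠ 0)
    (hb : ∀ t, 0 ≤ t → bVec QT aT t = b₀ + b₁ t)
    (hb₁ : ∀ t, 0 ≤ t →
      (1 / δ) * ∫ s in t..(t + δ), eucl (proj (bearingI QB pB pT s) *ᵥ b₁ t) ^ 2
        ≤ μ / 4 * eucl b₀ ^ 2) :
    -- uniform observability, for attitude estimates in a uniform neighbourhood of the attitude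
    (∃ ε δ' μ' : ℝ, 0 < ε ∧ ∀ Rhat : ℝ → M3,
      ContinuousOn Rhat (Set.Ici 0) →
      (∀ t, 0 ≤ t → Rhat t ∈ Matrix.specialOrthogonalGroup (Fin 3) ℝ) →
      (∀ t, 0 ≤ t → ∀ i j, |Rhat t i j - relAtt QB QT t i j| ≤ ε) →
      UniformlyObservableWith (fun t => Atheta (ωB t) (Rhat t) (aT t))
        (fun t => Ctheta (bearing QB pB pT t)) δ' μ') ∧
    -- local exponential stability of the error system, for every remainder `O(|θ̃|²)`
    (∀ ρ : ℝ → V7 → V7, IsQuadraticRemainder ρ →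
      LocallyExpStable
        (errField ωB aT (relAtt QB QT) (bearing QB pB pT) D ρ)
        (riccatiField ωB aT (relAtt QB QT) (bearing QB pB pT) S D)) ∧
    -- and in particular for the error dynamics before expansion in `θ̃`
    LocallyExpStable
      (exactErrField ωB aT (relAtt QB QT) (bearing QB pB pT) D)
      (riccatiField ωB aT (relAtt QB QT) (bearing QB pB pT) S D) := by

  have hobs := exists_uniformlyObservable hB hT hsep hδ hμ hPE haT haT' hb₀ hb hb₁
  have hsys : IsErrorSystem ωB aT (relAtt QB QT) (bearing QB pB pT) S D :=
    { ω_cont := hωB.1.continuousOn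
      ω_bdd := hωB.2
      a_cont := haT
      a_bdd := haT'
      R_cont := continuousOn_relAtt hB hT
      R_mem := fun t ht => relAtt_mem hB hT ht
      y_cont := continuousOn_bearing hB hT hsep
      y_unit := fun t ht => eucl_bearing hB hsep ht
      S_weight := hS
      D_weight := hD
      observable := hobs }
  refine ⟨hobs, fun ρ hρ => hsys.locallyExpStable hρ, ?_⟩
  rw [exactErrField_eq]
  exact hsys.locallyExpStable hsys.isQuadraticRemainder_exact
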